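/- Let $(P,\mathfrak p,k)$ be a regular local ring with algebraically closed residue field $k$, and write $\overline a$ for the image in $k$ of $a\in P$. Let $0\le q<r$ be integers and let $f_1,\dots,f_r\in\mathfrak p^2$. For $\boldsymbol a=(a_1,\dots,a_{r-1})\in P^{r-1}$ put $f_i^{\boldsymbol a}:=f_i-a_if_r$ for $1\le i\le r-1$, and $\overline{\boldsymbol a}:=(\overline a_1,\dots,\overline a_{r-1})\in k^{r-1}$. Let $\operatorname{gr}P=\bigoplus_{j\ge0}\mathfrak p^j/\mathfrak p^{j+1}$ be the associated graded ring of $P$ and, for $f\in\mathfrak p^2$, let $f^{\mathsf q}\in(\operatorname{gr}P)_2=\mathfrak p^2/\mathfrak p^3$ be the class of $f$. Recall that a noetherian local ring $(Q,\mathfrak q)$ is a complete intersection (c.i.) if its completion is isomorphic to the quotient of a regular local ring by a regular sequence. Let $\operatorname{codim}Q=\operatorname{edim}Q-\dim Q$, where $\operatorname{edim}Q$ is the minimal number of generators of $\mathfrak q$, and let $e(Q)=h(1)$ be the multiplicity of $Q$, where $h\in\mathbb Z[z]$ is the polynomial with $\sum_{j\ge 0}\operatorname{rank}_{Q/\mathfrak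 q}(\mathfrak q^j/\mathfrak q^{j+1})z^j=h(z)(1-z)^{-\dim Q}$. The ring $Q$ is c.i. of minimal multiplicity if it is c.i. and $e(Q)=2^{\operatorname{codim}Q}$. If $f_1,\dots,f_q,f_r$ is a $P$-regular sequence and $f_1^{\mathsf q},\dots,f_q^{\mathsf q}$ is a $\operatorname{gr}P$-regular sequence, then whether the ring $P/(f_1^{\boldsymbol a},\dots,f_q^{\boldsymbol a})$ is c.i. of minimal multiplicity depends only on $\overline{\boldsymbol a}$, and the set $$\mathcal U:=\{\overline{\boldsymbol a}\in\mathbb A^{r-1}_k=k^{r-1}\mid P/(f_1^{\boldsymbol a},\dots,f_q^{\boldsymbol a})\text{ is c.i. of minimal multiplicity}\}$$ is Zariski-open and not empty. -/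

import Mathlib

open IsLocalRing

/-! ### The associated graded ring `⨁ⱼ Iʲ / Iʲ⁺¹` -/

/-- The `j`-th graded piece `Iʲ / I·Iʲ = Iʲ / Iʲ⁺¹` of the associated graded ring of `I`. -/
def GrPiece {R : Type*} [CommRing R] (I : Ideal R) (j : ℕ) : Type _ :=
  ↥(I ^ j) ⧸ (I • ⊤ : Submodule R ↥(I ^ j))

namespace GrPiece

variable {R : Type*} [CommRing R] (I : Ideal R)

instance (j : ℕ) : AddCommGroup (GrPiece I j) :=
  inferInstanceAs (AddCommGroup (↥(I ^ j) ⧸ (I • ⊤ : Submodule R ↥(I ^ j))))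

instance (j : ℕ) : Module R (GrPiece I j) :=
  inferInstanceAs (Module R (↥(I ^ j) ⧸ (I • ⊤ : Submodule R ↥(I ^ j))))

instance (j : ℕ) : Module (R ⧸ I) (GrPiece I j) :=
  inferInstanceAs (Module (R ⧸ I) (↥(I ^ j) ⧸ (I • ⊤ : Submodule R ↥(I ^ j))))

variable {I}

/-- The class in `Iʲ / Iʲ⁺¹` of an element `x` of `Iʲ`. -/
def mk (j : ℕ) (x : R) (hx : x ∈ I ^ j) : GrPiece I j :=
  Submodule.Quotient.mk (p := (I • ⊤ : Submodule R ↥(I ^ j))) ⟨x, hx⟩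

theorem mk_eq_mk_iff {j : ℕ} {x y : R} (hx : x ∈ I ^ j) (hy : y ∈ I ^ j) :
    mk j x hx = mk j y hy ↔ x - y ∈ I ^ (j + 1) := by
  refine (Submodule.Quotient.eq (I • ⊤ : Submodule R ↥(I ^ j))).trans ?_
  rw [Submodule.mem_smul_top_iff, pow_succ']
  rfl

theorem ind {j : ℕ} {motive : GrPiece I j → Prop}
    (h : ∀ (x : R) (hx : x ∈ I ^ j), motive (mk j x hx)) (a : GrPiece I j) : motive a := by
  obtain ⟨⟨x, hx⟩, rfl⟩ := Submodule.Quotient.mk_surjective _ a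
  exact h x hx

theorem mul_mem_pow {i j : ℕ} {x y : R} (hx : x ∈ I ^ i) (hy : y ∈ I ^ j) :
    x * y ∈ I ^ (i + j) := by
  rw [pow_add]
  exact Ideal.mul_mem_mul hx hy

theorem mk_add_mk {j : ℕ} {x y : R} (hx : x ∈ I ^ j) (hy : y ∈ I ^ j) :
    mk j x hx + mk j y hy = mk j (x + y) (add_mem hx hy) := rfl

theorem zero_eq_mk (j : ℕ) : (0 : GrPiece I j) = mk j 0 (zero_mem _) := rfl

/-- The multiplication `Iⁱ/Iⁱ⁺¹ × Iʲ/Iʲ⁺¹ → Iⁱ⁺ʲ/Iⁱ⁺ʲ⁺¹` induced by that of the ring. -/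
def mul {i j : ℕ} (a : GrPiece I i) (b : GrPiece I j) : GrPiece I (i + j) :=
  Quotient.liftOn₂ a b
    (fun x y => mk (i + j) ((x : R) * (y : R)) (mul_mem_pow x.2 y.2)) (by
      rintro ⟨x, hx⟩ ⟨y, hy⟩ ⟨x', hx'⟩ ⟨y', hy'⟩ h h'
      have h1 : x - x' ∈ I ^ (i + 1) := (mk_eq_mk_iff hx hx').1 (Quotient.sound h)
      have h2 : y - y' ∈ I ^ (j + 1) := (mk_eq_mk_iff hy hy').1 (Quotient.sound h')
      rw [mk_eq_mk_iff]
      have e : x * y - x' * y' = (x - x') * y + x' * (y - y') := by ring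
      change x * y - x' * y' ∈ _
      rw [e]
      refine add_mem ?_ ?_
      · have := mul_mem_pow h1 hy
        rwa [show i + 1 + j = i + j + 1 by omega] at this
      · have := mul_mem_pow hx' h2
        rwa [← add_assoc] at this)

theorem mul_mk_mk {i j : ℕ} {x y : R} (hx : x ∈ I ^ i) (hy : y ∈ I ^ j) :
    mul (mk i x hx) (mk j y hy) = mk (i + j) (x * y) (mul_mem_pow hx hy) := rfl

theorem gradedMk_eq {i j : ℕ} (hij : i = j) {x y : R} (hxy : x = y) (hx : x ∈ I ^ i)
    (hy : y ∈ I ^ j) :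
    (GradedMonoid.mk i (mk i x hx) : GradedMonoid (GrPiece I)) = GradedMonoid.mk j (mk j y hy) := by
  subst hij hxy
  rfl

theorem mem_pow_zero (x : R) : x ∈ I ^ 0 := by simp

instance : GradedMonoid.GMul (GrPiece I) where
  mul := mul

instance : GradedMonoid.GOne (GrPiece I) where
  one := mk 0 1 (mem_pow_zero 1)

instance : DirectSum.GCommRing (GrPiece I) where
  mul_zero a := by
    induction a using ind with
    | h x hx => exact (mul_mk_mk hx _).trans ((mk_eq_mk_iff _ _).2 (by simp))
  zero_mul b := by
    induction b using ind with
    | h x hx => exact (mul_mk_mk _ hx).trans ((mk_eq_mk_iff _ _).2 (by simp))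
  mul_add a b c := by
    induction a using ind with | h x hx => ?_
    induction b using ind with | h y hy => ?_
    induction c using ind with | h z hz => ?_
    exact (mk_eq_mk_iff (mul_mem_pow hx (add_mem hy hz))
      (add_mem (mul_mem_pow hx hy) (mul_mem_pow hx hz))).2 (by simp [mul_add])
  add_mul a b c := by
    induction a using ind with | h x hx => ?_
    induction b using ind with | h y hy => ?_
    induction c using ind with | h z hz => ?_
    exact (mk_eq_mk_iff (mul_mem_pow (add_mem hx hy) hz)
      (add_mem (mul_mem_pow hx hz) (mul_mem_pow hy hz))).2 (by simp [add_mul])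
  one_mul := by
    rintro ⟨i, a⟩
    induction a using ind with | h x hx => ?_
    exact gradedMk_eq (zero_add i) (one_mul x) _ _
  mul_one := by
    rintro ⟨i, a⟩
    induction a using ind with | h x hx => ?_
    exact gradedMk_eq (add_zero i) (mul_one x) _ _
  mul_assoc := by
    rintro ⟨i, a⟩ ⟨j, b⟩ ⟨l, c⟩
    induction a using ind with | h x hx => ?_
    induction b using ind with | h y hy => ?_
    induction c using ind with | h z hz => ?_
    exact gradedMk_eq (add_assoc i j l) (mul_assoc x y z) _ _
  mul_comm := by
    rintro ⟨i, a⟩ ⟨j, b⟩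
    induction a using ind with | h x hx => ?_
    induction b using ind with | h y hy => ?_
    exact gradedMk_eq (add_comm i j) (mul_comm x y) _ _
  natCast n := mk 0 n (mem_pow_zero _)
  natCast_zero := (mk_eq_mk_iff _ _).2 (by simp)
  natCast_succ n := (mk_eq_mk_iff _ (add_mem (mem_pow_zero _) (mem_pow_zero _))).2 (by simp)
  intCast n := mk 0 n (mem_pow_zero _)
  intCast_ofNat n := (mk_eq_mk_iff _ _).2 (by simp)
  intCast_negSucc_ofNat n :=
    (mk_eq_mk_iff _ (neg_mem (mem_pow_zero ((n + 1 : ℕ) : R)))).2 (by simp)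

end GrPiece

/-- The associated graded ring `gr R = ⨁ⱼ 𝔪ʲ / 𝔪ʲ⁺¹` of a local ring. -/
abbrev AssocGraded (R : Type*) [CommRing R] [IsLocalRing R] : Type _ :=
  DirectSum ℕ (GrPiece (maximalIdeal R))

/-- The quadratic part of `f ∈ 𝔪²`: its class in `𝔪² / 𝔪³`, as a degree-two element of `gr R`. It is
the initial form of `f` when `f ∉ 𝔪³`, and `0` when `f ∈ 𝔪³`. -/
noncomputable def quadraticPart {R : Type*} [CommRing R] [IsLocalRing R] (f : R)
    (hf : f ∈ maximalIdeal R ^ 2) : AssocGraded R :=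
  DirectSum.of (GrPiece (maximalIdeal R)) 2 (GrPiece.mk 2 f hf)

/-! ### Numerical invariants of a noetherian local ring -/

/-- The Hilbert series `∑ⱼ rankₖ(𝔪ʲ / 𝔪ʲ⁺¹) zʲ`, where `k = R / 𝔪`. -/
noncomputable def localHilbertSeries (R : Type*) [CommRing R] [IsLocalRing R] : PowerSeries ℤ :=
  PowerSeries.mk fun j =>
    (Module.finrank (R ⧸ maximalIdeal R) (GrPiece (maximalIdeal R) j) : ℤ)

/-- `e` is the multiplicity of `R`: the Hilbert series is `h(z) / (1 - z) ^ dim R` with `h` an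
integer polynomial and `e = h(1)`. -/
def HasMultiplicity (R : Type*) [CommRing R] [IsLocalRing R] (e : ℤ) : Prop :=
  ∃ (d : ℕ) (h : Polynomial ℤ), ringKrullDim R = d ∧
    localHilbertSeries R * (1 - PowerSeries.X) ^ d = (h : PowerSeries ℤ) ∧ h.eval 1 = e

/-- `c` is the embedding codimension `edim R - dim R`, where `edim R` is the minimal number of
generators of the maximal ideal. -/
def HasCodim (R : Type*) [CommRing R] [IsLocalRing R] (c : ℕ) : Prop :=
  ringKrullDim R + c = (maximalIdeal R).spanFinrank

/-- A local ring is a complete intersection if its completion is the quotient of a regular local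
ring by a regular sequence. -/
def IsCompleteIntersection.{u} (R : Type u) [CommRing R] [IsLocalRing R] : Prop :=
  ∃ (S : Type u) (_ : CommRing S) (_ : IsRegularLocalRing S) (l : List S),
    RingTheory.Sequence.IsRegular S l ∧
      Nonempty (AdicCompletion (maximalIdeal R) R ≃+* S ⧸ Ideal.ofList l)

/-- `R` is a noetherian local ring that is a complete intersection of minimal multiplicity, that is,
of multiplicity `2 ^ codim R`. -/
def IsCIOfMinimalMultiplicity (R : Type*) [CommRing R] : Prop :=
  ∃ _ : IsLocalRing R, IsNoetherianRing R ∧ IsCompleteIntersection R ∧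
    ∃ c : ℕ, HasCodim R c ∧ HasMultiplicity R (2 ^ c)

/-! ### The family -/

/-- A subset of affine space `kⁿ` is Zariski-open if its complement is the set of common zeros of
a set of polynomials. -/
def IsZariskiOpen {σ k : Type*} [Field k] (U : Set (σ → k)) : Prop :=
  ∃ I : Ideal (MvPolynomial σ k), Uᶜ = MvPolynomial.zeroLocus k I

/-- The ring `P / (f₁ - a₁ fᵣ, …, f_q - a_q fᵣ)`, where `r = n + 1` and `fᵣ` is the last entry
of `f`. -/
abbrev FamilyRing {P : Type*} [CommRing P] {n q : ℕ} (hq : q ≤ n) (f : Fin (n + 1) → P)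
    (a : Fin n → P) : Type _ :=
  P ⧸ Ideal.span (Set.range fun i : Fin q =>
    f (Fin.castLE hq i).castSucc - a (Fin.castLE hq i) * f (Fin.last n))

/-- The set of the points `ā ∈ kⁿ`, for `a ∈ Pⁿ`, such that
`P / (f₁ - a₁ fᵣ, …, f_q - a_q fᵣ)` is a complete intersection of minimal multiplicity. -/
def minimalMultiplicityLocus {P : Type*} [CommRing P] [IsLocalRing P] {n q : ℕ} (hq : q ≤ n)
    (f : Fin (n + 1) → P) : Set (Fin n → ResidueField P) :=
  {x | ∃ a : Fin n → P, (fun i => residue P (a i)) = x ∧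
    IsCIOfMinimalMultiplicity (FamilyRing hq f a)}

/-!
Why the theorem is true. Write `𝔪` for the maximal ideal of `P` and `d` for its dimension. Since
nothing changes modulo `fᵣ` and regular sequences in `𝔪` may be permuted, the elements
`fᵢ - aᵢ fᵣ`, `i ≤ q`, are a regular sequence for every `a` (`isWeaklyRegular_ofFn_sub_mul`), so
`P / (fᵢ - aᵢ fᵣ)` is always a complete intersection: the completion of `P` is a flat regular local
extension of `P`, and completion commutes with quotients (`isCompleteIntersection_quotient`).
Hence only the multiplicity matters, and the heart of the proof is that it is `2 ^ q` if and only if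
the classes of the `fᵢ - aᵢ fᵣ` in `𝔪² / 𝔪³` are a regular sequence on the associated graded
ring (`isCIOfMinimalMultiplicity_iff_strictSeq`). This gives a point of the locus, namely `a = 0`
(`strictSeq_of_isWeaklyRegular_quadraticPart`), and the regularity of forms of degree two
which depend affinely on the residues of `a` is an open condition (`exists_eval_ne_zero_strictSeq`).

Instead of quotient rings, the proof works with ideals `J` of `P` and the series
`∑ length (P / (J + 𝔪ⁿ)) zⁿ` (`lengthSeries`). A sequence `L` with assigned orders `sᵢ` is *strict*
modulo `J` (`StrictSeq`) if the leading forms are a regular sequence on the associated graded ring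
of `P / J`. Dividing by one element multiplies the series by `1 - zˢ` and adds a series with
nonnegative coefficients (`defectSeries`) which vanishes precisely if the element is strict.
Therefore the series `excess`, that is
`∏ (1 - z ^ sᵢ)⁻¹ * lengthSeries (J + (L)) - lengthSeries J`, has nonnegative coefficients, and it
vanishes precisely if `L` is strict (`strictSeq_iff_excess_eq_zero`).

If `q` elements of order two are strict, their quotient has the Hilbert series
`(1 + z) ^ q / (1 - z) ^ (d - q)`, and the multiplicity is `2 ^ q`. Conversely, suppose that it is
`2 ^ q` and that `g` is the first element which is not strict, after a strict sequence `G`. The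
residue field being infinite, `G` extends by elements of order one to a strict sequence of length
`d` (`StrictSeq.exists_append`, by prime avoidance in the Rees algebra of `𝔪`). Because of these
linear elements, the multiples of a nonzero form killed by the leading form of `g` grow like a
polynomial ring (`coeff_geom_one_pow_add_colength_le`), so that the excess dominates a series with
a pole of order `d + 1` at `z = 1`. But multiplicity `2 ^ q` means that the poles of order `d + 1`
cancel in the excess, which is absurd (`not_isNonneg_sub`, `strictSeq_of_multiplicity`).

For the openness near `a₀`, extend the strict sequence of the `fᵢ - a₀ᵢ fᵣ` by linear elements to
one of length `d`, and keep these linear elements while `a` varies. For sequences of this shape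
strictness says that the leading forms span a large enough subspace of `𝔪ⁿ / 𝔪ⁿ⁺¹` for each
`n ≤ q + 1` (`strictSeq_iff_colength_leadingIdeal_le`). These are finitely many lower bounds on
ranks of families of vectors which depend affinely on the residues of `a`.
-/

/-! ### Colengths of ideals -/

section Colength

variable {P : Type*} [CommRing P]

/-- The length of `P ⧸ I` as a natural number (`0` if the length is infinite). -/
noncomputable def colength (I : Ideal P) : ℕ := (Module.length P (P ⧸ I)).toNat

/-- The colon ideal `(I : y)`. -/
abbrev colonElem (I : Ideal P) (y : P) : Ideal P := Submodule.comap (LinearMap.mulLeft P y) I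

theorem mem_colonElem {I : Ideal P} {y z : P} : z ∈ colonElem I y ↔ y * z ∈ I := Iff.rfl

theorem le_colonElem (I : Ideal P) (y : P) : I ≤ colonElem I y := fun _ hz => I.mul_mem_left y hz

/-- Additivity of length along the exact sequence `0 → P / (I : y) → P / I → P / (I + (y)) → 0`,
whose first map is multiplication by `y`. -/
theorem length_quotient_eq_add (I : Ideal P) (y : P) :
    Module.length P (P ⧸ I) =
      Module.length P (P ⧸ colonElem I y) + Module.length P (P ⧸ (I ⊔ Ideal.span {y})) := by
  refine Module.length_eq_add_of_exact
    (Submodule.mapQ (colonElem I y) I (LinearMap.mulLeft P y) le_rfl)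
    (Submodule.factor (le_sup_left : I ≤ I ⊔ Ideal.span {y})) ?_
    (Submodule.factor_surjective _) ?_
  · rw [← LinearMap.ker_eq_bot, Submodule.ker_mapQ, ← le_bot_iff, Submodule.map_le_iff_le_comap]
    intro z hz
    exact (Submodule.Quotient.mk_eq_zero _).2 hz
  · intro w
    obtain ⟨w, rfl⟩ := Submodule.Quotient.mk_surjective _ w
    constructor
    · intro h
      have h : w ∈ I ⊔ Ideal.span {y} := (Submodule.Quotient.mk_eq_zero _).1 h
      obtain ⟨i, hi, v, hv, rfl⟩ := Submodule.mem_sup.1 h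
      obtain ⟨c, rfl⟩ := Ideal.mem_span_singleton'.1 hv
      refine ⟨Submodule.Quotient.mk c, ?_⟩
      refine (Submodule.Quotient.eq _).2 ?_
      change y * c - (i + c * y) ∈ I
      convert I.neg_mem hi using 1
      ring
    · rintro ⟨z, hz⟩
      obtain ⟨z, rfl⟩ := Submodule.Quotient.mk_surjective _ z
      have hz : y * z - w ∈ I := (Submodule.Quotient.eq _).1 hz
      refine (Submodule.Quotient.mk_eq_zero _).2 ?_
      have : w = -(y * z - w) + z * y := by ring
      rw [this]
      exact add_mem (Ideal.mem_sup_left (I.neg_mem hz))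
        (Ideal.mem_sup_right (Ideal.mem_span_singleton'.2 ⟨z, rfl⟩))

theorem colength_top : colength (⊤ : Ideal P) = 0 := by
  have : Subsingleton (P ⧸ (⊤ : Ideal P)) := Ideal.Quotient.subsingleton_iff.2 rfl
  simp [colength]

theorem colength_maximalIdeal [IsLocalRing P] : colength (maximalIdeal P) = 1 := by
  have : IsSimpleModule P (P ⧸ maximalIdeal P) :=
    isSimpleModule_iff_isCoatom.2 (maximalIdeal.isMaximal P).out
  simp [colength]

variable [IsLocalRing P] [IsNoetherianRing P]

theorem length_quotient_ne_top {I : Ideal P} {n : ℕ} (h : maximalIdeal P ^ n ≤ I) :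
    Module.length P (P ⧸ I) ≠ ⊤ := by
  have h1 : ∀ n, Module.length P (P ⧸ maximalIdeal P ^ n) ≠ ⊤ := by
    intro n
    by_cases hn : n = 0
    · subst hn
      have : Subsingleton (P ⧸ maximalIdeal P ^ 0) := by
        rw [Ideal.Quotient.subsingleton_iff]; simp
      rw [Module.length_eq_zero]; simp
    have hA : IsArtinianRing (P ⧸ maximalIdeal P ^ n) := by
      have : Nontrivial (P ⧸ maximalIdeal P ^ n) :=
        Ideal.Quotient.nontrivial_iff.2 (fun h => (maximalIdeal.isMaximal P).ne_top
          (top_le_iff.1 (h ▸ Ideal.pow_le_self hn)))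
      have : IsLocalRing (P ⧸ maximalIdeal P ^ n) :=
        IsLocalRing.of_surjective' _ Ideal.Quotient.mk_surjective
      rw [isArtinianRing_iff_isNilpotent_maximalIdeal]
      refine ⟨n, ?_⟩
      rw [← IsLocalRing.map_maximalIdeal_of_surjective (Ideal.Quotient.mk (maximalIdeal P ^ n))
        Ideal.Quotient.mk_surjective, ← Ideal.map_pow, Ideal.map_quotient_self]
      rfl
    rw [Module.length_eq_of_surjective (R := P ⧸ maximalIdeal P ^ n) Ideal.Quotient.mk_surjective]
    exact Module.length_ne_top
  exact ne_top_of_le_ne_top (h1 n)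
    (Module.length_le_of_surjective (Submodule.factor h) (Submodule.factor_surjective h))

theorem colength_eq_add {I : Ideal P} {n : ℕ} (h : maximalIdeal P ^ n ≤ I) (y : P) :
    colength I = colength (colonElem I y) + colength (I ⊔ Ideal.span {y}) := by
  unfold colength
  rw [length_quotient_eq_add I y, ENat.toNat_add]
  · exact length_quotient_ne_top (h.trans (le_colonElem I y))
  · exact length_quotient_ne_top (h.trans le_sup_left)

theorem colength_mono {I I' : Ideal P} {n : ℕ} (h : maximalIdeal P ^ n ≤ I) (hI : I ≤ I') :
    colength I' ≤ colength I :=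
  ENat.toNat_le_toNat (Module.length_le_of_surjective (Submodule.factor hI)
    (Submodule.factor_surjective hI)) (length_quotient_ne_top h)

theorem colength_pos {I : Ideal P} {n : ℕ} (h : maximalIdeal P ^ n ≤ I) (hI : I ≠ ⊤) :
    0 < colength I := by
  have : Nontrivial (P ⧸ I) := Ideal.Quotient.nontrivial_iff.2 hI
  rw [colength, Nat.pos_iff_ne_zero, Ne, ENat.toNat_eq_zero, not_or]
  exact ⟨(Module.length_pos (R := P) (M := P ⧸ I)).ne', length_quotient_ne_top h⟩

theorem colength_strictMono {I I' : Ideal P} {n : ℕ} (h : maximalIdeal P ^ n ≤ I) (hI : I < I') :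
    colength I' < colength I := by
  obtain ⟨hle, y, hy, hyI⟩ := SetLike.lt_iff_le_and_exists.1 hI
  have h1 : colength I' ≤ colength (I ⊔ Ideal.span {y}) :=
    colength_mono (h.trans le_sup_left) (sup_le hle (by simpa [Ideal.span_le] using hy))
  have h2 : 0 < colength (colonElem I y) := by
    refine colength_pos (h.trans (le_colonElem I y)) fun e => hyI ?_
    have : (1 : P) ∈ colonElem I y := e ▸ Submodule.mem_top
    simpa [mem_colonElem] using this
  have h3 := colength_eq_add h y
  omega

end Colength

/-! ### Coefficientwise inequalities between power series -/

section NonnegSeries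

open PowerSeries

/-- A power series over `ℤ` all of whose coefficients are nonnegative. -/
def IsNonneg (f : PowerSeries ℤ) : Prop := ∀ n, 0 ≤ coeff n f

namespace IsNonneg

variable {f g : PowerSeries ℤ}

theorem zero : IsNonneg 0 := fun n => by simp

theorem one : IsNonneg 1 := fun n => by rw [coeff_one]; split_ifs <;> simp

theorem add (hf : IsNonneg f) (hg : IsNonneg g) : IsNonneg (f + g) := fun n => by
  rw [map_add]; exact add_nonneg (hf n) (hg n)

theorem mul (hf : IsNonneg f) (hg : IsNonneg g) : IsNonneg (f * g) := fun n => by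
  rw [coeff_mul]; exact Finset.sum_nonneg fun p _ => mul_nonneg (hf _) (hg _)

theorem pow (hf : IsNonneg f) (n : ℕ) : IsNonneg (f ^ n) := by
  induction n with
  | zero => simpa using one
  | succ n ih => rw [pow_succ]; exact ih.mul hf

theorem X_pow (n : ℕ) : IsNonneg (X ^ n) := fun m => by
  rw [coeff_X_pow]; split_ifs <;> simp

theorem eq_zero_of_add_eq_zero (hf : IsNonneg f) (hg : IsNonneg g) (h : f + g = 0) :
    f = 0 := by
  ext n
  have h1 : coeff n f + coeff n g = 0 := by rw [← map_add, h, map_zero]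
  have := hf n
  have := hg n
  rw [map_zero]
  omega

end IsNonneg

/-- The geometric series `1 / (1 - z ^ s)`. -/
noncomputable def geom (s : ℕ) : PowerSeries ℤ := PowerSeries.mk fun n => if s ∣ n then 1 else 0

theorem geom_nonneg (s : ℕ) : IsNonneg (geom s) := fun n => by
  rw [geom, coeff_mk]; split_ifs <;> simp

theorem geom_mul {s : ℕ} (hs : 0 < s) : geom s * (1 - X ^ s) = 1 := by
  ext n
  rw [mul_sub, mul_one, map_sub, coeff_mul_X_pow', coeff_one, geom, coeff_mk, coeff_mk]
  by_cases h : s ≤ n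
  · have : s ∣ n - s ↔ s ∣ n := by
      rw [Nat.dvd_sub_iff_left h dvd_rfl]
    simp only [this, h, if_true, sub_self]
    rw [if_neg (by omega)]
  · rw [if_neg h]
    by_cases hn : n = 0
    · subst hn; simp
    · rw [if_neg hn, if_neg fun hd => h (Nat.le_of_dvd (Nat.pos_of_ne_zero hn) hd)]; simp

theorem eq_zero_of_geom_mul_eq_zero {s : ℕ} (hs : 0 < s) {f : PowerSeries ℤ}
    (h : geom s * f = 0) : f = 0 := by
  calc f = geom s * (1 - X ^ s) * f := by rw [geom_mul hs, one_mul]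
    _ = (1 - X ^ s) * (geom s * f) := by ring
    _ = 0 := by rw [h, mul_zero]

end NonnegSeries

/-! ### Strict sequences -/

section Strict

variable {P : Type*} [CommRing P] [IsLocalRing P]

/-- `y`, viewed as an element of order (at least) `s`, is strict modulo `J` if its class in
`𝔪ˢ / 𝔪ˢ⁺¹` is a nonzerodivisor on the associated graded ring of `P / J`. -/
def IsStrict (J : Ideal P) (y : P) (s : ℕ) : Prop :=
  ∀ n z, y * z ∈ J ⊔ maximalIdeal P ^ (n + s) → z ∈ J ⊔ maximalIdeal P ^ n

/-- The ideal generated by the elements of a list of elements with assigned orders. -/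
def seqIdeal (L : List (P × ℕ)) : Ideal P := Ideal.ofList (L.map Prod.fst)

/-- The orders assigned to the elements of the list are positive and are lower bounds for the
`𝔪`-adic orders. -/
def HasOrders (L : List (P × ℕ)) : Prop := ∀ p ∈ L, p.1 ∈ maximalIdeal P ^ p.2 ∧ 0 < p.2

/-- Each element of the list is strict modulo `J` and its predecessors; equivalently, the leading
forms of the elements are a weakly regular sequence on the associated graded ring of `P / J`. -/
def StrictSeq : Ideal P → List (P × ℕ) → Prop
  | _, [] => True
  | J, p :: L => IsStrict J p.1 p.2 ∧ StrictSeq (J ⊔ Ideal.span {p.1}) L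

omit [IsLocalRing P] in
@[simp] theorem seqIdeal_nil : seqIdeal ([] : List (P × ℕ)) = ⊥ := by simp [seqIdeal]

omit [IsLocalRing P] in
@[simp] theorem seqIdeal_cons (p : P × ℕ) (L : List (P × ℕ)) :
    seqIdeal (p :: L) = Ideal.span {p.1} ⊔ seqIdeal L := by simp [seqIdeal]

omit [IsLocalRing P] in
@[simp] theorem seqIdeal_append (L M : List (P × ℕ)) :
    seqIdeal (L ++ M) = seqIdeal L ⊔ seqIdeal M := by simp [seqIdeal]

omit [IsLocalRing P] in
theorem seqIdeal_perm {L M : List (P × ℕ)} (h : L.Perm M) : seqIdeal L = seqIdeal M := by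
  unfold seqIdeal Ideal.ofList
  congr 1
  ext x
  exact (h.map _).mem_iff

theorem HasOrders.cons {p : P × ℕ} {L : List (P × ℕ)} :
    HasOrders (p :: L) ↔ (p.1 ∈ maximalIdeal P ^ p.2 ∧ 0 < p.2) ∧ HasOrders L := by
  simp [HasOrders]

theorem HasOrders.append {L M : List (P × ℕ)} :
    HasOrders (L ++ M) ↔ HasOrders L ∧ HasOrders M := by
  simp only [HasOrders, List.mem_append]
  exact ⟨fun h => ⟨fun p hp => h p (.inl hp), fun p hp => h p (.inr hp)⟩,
    fun h p hp => hp.elim (h.1 p) (h.2 p)⟩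

theorem HasOrders.perm {L M : List (P × ℕ)} (h : L.Perm M) (hL : HasOrders L) : HasOrders M :=
  fun p hp => hL p (h.mem_iff.2 hp)

theorem strictSeq_append {J : Ideal P} {L M : List (P × ℕ)} :
    StrictSeq J (L ++ M) ↔ StrictSeq J L ∧ StrictSeq (J ⊔ seqIdeal L) M := by
  induction L generalizing J with
  | nil => simp [StrictSeq]
  | cons p L ih => simp [StrictSeq, ih, and_assoc, sup_assoc]

variable [IsNoetherianRing P]

open PowerSeries

/-- The generating function of the lengths of `P / (J + 𝔪ⁿ)`. -/
noncomputable def lengthSeries (J : Ideal P) : PowerSeries ℤ :=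
  PowerSeries.mk fun n => (colength (J ⊔ maximalIdeal P ^ n) : ℤ)

/-- The generating function of the lengths of `((J + 𝔪ⁿ) : y) / (J + 𝔪ⁿ⁻ˢ)`. -/
noncomputable def defectSeries (J : Ideal P) (y : P) (s : ℕ) : PowerSeries ℤ :=
  PowerSeries.mk fun n => if s ≤ n then
    (colength (J ⊔ maximalIdeal P ^ (n - s)) : ℤ) -
      colength (colonElem (J ⊔ maximalIdeal P ^ n) y) else 0

omit [IsNoetherianRing P] in
theorem sup_pow_le_colonElem (J : Ideal P) {y : P} {s : ℕ} (hy : y ∈ maximalIdeal P ^ s) (n : ℕ) :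
    J ⊔ maximalIdeal P ^ n ≤ colonElem (J ⊔ maximalIdeal P ^ (n + s)) y := by
  refine sup_le (le_sup_left.trans (le_colonElem _ _)) fun z hz => ?_
  rw [mem_colonElem, mul_comm]
  exact Ideal.mem_sup_right (by rw [pow_add]; exact Ideal.mul_mem_mul hz hy)

/-- Dividing by an element of order `s` multiplies the length series by `1 - zˢ`, up to the defect.
-/
theorem lengthSeries_sup_span (J : Ideal P) {y : P} {s : ℕ} (hy : y ∈ maximalIdeal P ^ s) :
    lengthSeries (J ⊔ Ideal.span {y}) =
      (1 - X ^ s) * lengthSeries J + defectSeries J y s := by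
  ext n
  rw [sub_mul, one_mul, map_add, map_sub, coeff_X_pow_mul']
  simp only [lengthSeries, defectSeries, coeff_mk]
  have e : J ⊔ Ideal.span {y} ⊔ maximalIdeal P ^ n = J ⊔ maximalIdeal P ^ n ⊔ Ideal.span {y} := by
    ac_rfl
  by_cases h : s ≤ n
  · have := colength_eq_add (le_sup_right : maximalIdeal P ^ n ≤ J ⊔ maximalIdeal P ^ n) y
    rw [if_pos h, if_pos h, e]
    omega
  · have : Ideal.span {y} ≤ maximalIdeal P ^ n := by
      rw [Ideal.span_singleton_le_iff_mem]
      exact Ideal.pow_le_pow_right (by omega) hy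
    rw [if_neg h, if_neg h, e, sup_eq_left.2 (this.trans le_sup_right)]
    simp

theorem defectSeries_nonneg (J : Ideal P) {y : P} {s : ℕ} (hy : y ∈ maximalIdeal P ^ s) :
    IsNonneg (defectSeries J y s) := by
  intro n
  rw [defectSeries, coeff_mk]
  split_ifs with h
  · have h1 := sup_pow_le_colonElem J hy (n - s)
    rw [Nat.sub_add_cancel h] at h1
    have := colength_mono le_sup_right h1
    omega
  · rfl

theorem defectSeries_eq_zero_iff (J : Ideal P) {y : P} {s : ℕ} (hy : y ∈ maximalIdeal P ^ s) :
    defectSeries J y s = 0 ↔ IsStrict J y s := by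
  constructor
  · intro h n z hz
    have h1 := congrArg (coeff (n + s)) h
    rw [defectSeries, coeff_mk, if_pos (Nat.le_add_left _ _), Nat.add_sub_cancel, map_zero] at h1
    by_contra hz'
    have h2 : J ⊔ maximalIdeal P ^ n < colonElem (J ⊔ maximalIdeal P ^ (n + s)) y :=
      SetLike.lt_iff_le_and_exists.2 ⟨sup_pow_le_colonElem J hy n, z, hz, hz'⟩
    have := colength_strictMono le_sup_right h2
    omega
  · intro h
    ext n
    rw [defectSeries, coeff_mk, map_zero]
    split_ifs with hn
    · obtain ⟨n, rfl⟩ := Nat.exists_eq_add_of_le' hn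
      rw [Nat.add_sub_cancel, le_antisymm (sup_pow_le_colonElem J hy n) fun z hz => h n z hz,
        sub_self]
    · rfl

/-- The product of the series `1 / (1 - zˢ)` over the orders `s` assigned to the elements. -/
noncomputable def geomProd (L : List (P × ℕ)) : PowerSeries ℤ := (L.map fun p => geom p.2).prod

/-- The amount by which the length series of `P / J` falls short of the upper bound provided by that
of `P / (J + (L))`. -/
noncomputable def excess (J : Ideal P) (L : List (P × ℕ)) : PowerSeries ℤ :=
  geomProd L * lengthSeries (J ⊔ seqIdeal L) - lengthSeries J

omit [CommRing P] [IsLocalRing P] [IsNoetherianRing P] in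
theorem geomProd_nonneg (L : List (P × ℕ)) : IsNonneg (geomProd L) := by
  induction L with
  | nil => exact .one
  | cons p L ih => simpa [geomProd] using (geom_nonneg p.2).mul ih

omit [IsNoetherianRing P] in
theorem excess_append (J : Ideal P) (L M : List (P × ℕ)) :
    excess J (L ++ M) = geomProd L * excess (J ⊔ seqIdeal L) M + excess J L := by
  simp only [excess, geomProd, seqIdeal_append, List.map_append, List.prod_append, sup_assoc]
  ring

theorem excess_cons (J : Ideal P) (p : P × ℕ) (L : List (P × ℕ))
    (hp : p.1 ∈ maximalIdeal P ^ p.2) (hs : 0 < p.2) :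
    excess J (p :: L) =
      geom p.2 * (defectSeries J p.1 p.2 + excess (J ⊔ Ideal.span {p.1}) L) := by
  have h := lengthSeries_sup_span J hp
  have hg := geom_mul hs
  simp only [excess, geomProd, seqIdeal_cons, List.map_cons, List.prod_cons, ← sup_assoc]
  rw [h]
  linear_combination lengthSeries J * hg

theorem excess_nonneg (J : Ideal P) {L : List (P × ℕ)} (hL : HasOrders L) :
    IsNonneg (excess J L) := by
  induction L generalizing J with
  | nil => simpa [excess, geomProd] using IsNonneg.zero
  | cons p L ih =>
    obtain ⟨⟨hp, hs⟩, hL⟩ := HasOrders.cons.1 hL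
    rw [excess_cons J p L hp hs]
    exact (geom_nonneg _).mul ((defectSeries_nonneg J hp).add (ih _ hL))

/-- Strictness of a sequence can be read off from the lengths of the quotients by the ideal that it
generates. In particular it does not depend on the order of the sequence. -/
theorem strictSeq_iff_excess_eq_zero (J : Ideal P) {L : List (P × ℕ)} (hL : HasOrders L) :
    StrictSeq J L ↔ excess J L = 0 := by
  induction L generalizing J with
  | nil => simp [StrictSeq, excess, geomProd]
  | cons p L ih =>
    obtain ⟨⟨hp, hs⟩, hL⟩ := HasOrders.cons.1 hL
    rw [excess_cons J p L hp hs, StrictSeq, ih _ hL, ← defectSeries_eq_zero_iff J hp]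
    constructor
    · rintro ⟨h1, h2⟩
      rw [h1, h2, add_zero, mul_zero]
    · intro h
      have h0 := eq_zero_of_geom_mul_eq_zero hs h
      have h1 := defectSeries_nonneg J hp
      have h2 := excess_nonneg (J ⊔ Ideal.span {p.1}) hL
      exact ⟨h1.eq_zero_of_add_eq_zero h2 h0,
        h2.eq_zero_of_add_eq_zero h1 (by rw [add_comm]; exact h0)⟩

theorem StrictSeq.perm {J : Ideal P} {L M : List (P × ℕ)} (hL : HasOrders L) (h : L.Perm M)
    (hs : StrictSeq J L) : StrictSeq J M := by
  rw [strictSeq_iff_excess_eq_zero J hL] at hs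
  rw [strictSeq_iff_excess_eq_zero J (hL.perm h), ← hs, excess, excess, seqIdeal_perm h,
    geomProd, geomProd, (h.map _).prod_eq]

end Strict

section Leading

variable {P : Type*} [CommRing P] [IsLocalRing P]

/-- The ideal `∑ yᵢ 𝔪ⁿ⁻ˢⁱ`, where `𝔪ⁿ⁻ˢ` is the unit ideal if `n < s`. Modulo `𝔪ⁿ⁺¹` it is the
component of degree `n` of the ideal generated by the leading forms of the `yᵢ`. -/
def leadingIdeal : List (P × ℕ) → ℕ → Ideal P
  | [], _ => ⊥
  | p :: L, n => Ideal.span {p.1} * maximalIdeal P ^ (n - p.2) ⊔ leadingIdeal L n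

theorem leadingIdeal_le_seqIdeal (L : List (P × ℕ)) (n : ℕ) : leadingIdeal L n ≤ seqIdeal L := by
  induction L with
  | nil => simp [leadingIdeal]
  | cons p L ih => rw [seqIdeal_cons]; exact sup_le_sup Ideal.mul_le_left ih

theorem leadingIdeal_le_pow {L : List (P × ℕ)} (hL : HasOrders L) (n : ℕ) :
    leadingIdeal L n ≤ maximalIdeal P ^ n := by
  induction L with
  | nil => simp [leadingIdeal]
  | cons p L ih =>
    obtain ⟨⟨hp, -⟩, hL⟩ := HasOrders.cons.1 hL
    refine sup_le ?_ (ih hL)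
    have h1 : Ideal.span {p.1} ≤ maximalIdeal P ^ p.2 := by
      rwa [Ideal.span_singleton_le_iff_mem]
    refine (Ideal.mul_mono_left h1).trans ?_
    rw [← pow_add]
    exact Ideal.pow_le_pow_right (by omega)

theorem maximalIdeal_mul_leadingIdeal_le (L : List (P × ℕ)) (n : ℕ) :
    maximalIdeal P * leadingIdeal L n ≤ leadingIdeal L (n + 1) := by
  induction L with
  | nil => simp [leadingIdeal]
  | cons p L ih =>
    rw [leadingIdeal, Ideal.mul_sup]
    refine sup_le_sup ?_ ih
    rw [mul_left_comm, ← pow_succ']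
    exact Ideal.mul_mono_right (Ideal.pow_le_pow_right (by omega))

/-- The leading forms of a strict sequence generate the ideal of all leading forms of the ideal
generated by the sequence. -/
theorem StrictSeq.inf_le {J : Ideal P} {L : List (P × ℕ)} (hL : HasOrders L) (h : StrictSeq J L)
    (n : ℕ) : (J ⊔ seqIdeal L) ⊓ (J ⊔ maximalIdeal P ^ n) ≤ J ⊔ leadingIdeal L n := by
  induction L generalizing J with
  | nil => simp
  | cons p L ih =>
    obtain ⟨⟨hp, -⟩, hL'⟩ := HasOrders.cons.1 hL
    obtain ⟨h1, h2⟩ := h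
    rintro e ⟨he1, he2⟩
    have he := ih hL' h2 ⟨by rwa [seqIdeal_cons, ← sup_assoc] at he1,
      (sup_le_sup_right le_sup_left _ : J ⊔ _ ≤ _) he2⟩
    obtain ⟨v, hv, w, hw, rfl⟩ := Submodule.mem_sup.1 he
    obtain ⟨j, hj, u, hu, rfl⟩ := Submodule.mem_sup.1 hv
    obtain ⟨z, rfl⟩ := Ideal.mem_span_singleton.1 hu
    have hw' := leadingIdeal_le_pow hL' n hw
    have hz : p.1 * z ∈ J ⊔ maximalIdeal P ^ n := by
      have : p.1 * z = (j + p.1 * z + w) - j - w := by ring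
      rw [this]
      exact sub_mem (sub_mem he2 (Ideal.mem_sup_left hj)) (Ideal.mem_sup_right hw')
    have hz' : z ∈ J ⊔ maximalIdeal P ^ (n - p.2) := by
      by_cases hn : p.2 ≤ n
      · exact h1 _ _ (by rwa [Nat.sub_add_cancel hn])
      · rw [Nat.sub_eq_zero_of_le (by omega)]; simp
    obtain ⟨j', hj', z', hz'', rfl⟩ := Submodule.mem_sup.1 hz'
    have e1 : j + p.1 * (j' + z') + w = (j + p.1 * j') + (p.1 * z' + w) := by ring
    rw [e1]
    exact Submodule.add_mem_sup (add_mem hj (J.mul_mem_left _ hj')) (Submodule.add_mem_sup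
      (Ideal.mul_mem_mul (Ideal.mem_span_singleton_self _) hz'') hw)

end Leading

/-! ### Independent families and colengths -/

section Independent

variable {P : Type*} [CommRing P] [IsLocalRing P]

/-- The family `e` is linearly independent modulo `K` over the residue field: only combinations
with coefficients in the maximal ideal lie in `K`. -/
def IndepMod (K : Ideal P) {ι : Type*} [Fintype ι] (e : ι → P) : Prop :=
  ∀ c : ι → P, ∑ i, c i * e i ∈ K → ∀ i, c i ∈ maximalIdeal P

variable [IsNoetherianRing P]

/-- A subspace containing `r` independent vectors has dimension at least `r`, in terms of colengths.
-/
theorem IndepMod.colength_add_card_le {K I : Ideal P} {n : ℕ} (hK : maximalIdeal P ^ n ≤ K)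
    {ι : Type*} [Fintype ι] {e : ι → P} (h : IndepMod K e) (hKI : K ≤ I) (he : ∀ i, e i ∈ I) :
    colength I + Fintype.card ι ≤ colength K := by
  classical
  have key : ∀ s : Finset ι, colength (K ⊔ Ideal.span (e '' s)) + s.card ≤ colength K := by
    intro s
    induction s using Finset.induction_on with
    | empty => simp
    | insert i s hi ih =>
      have hlt : K ⊔ Ideal.span (e '' s) < K ⊔ Ideal.span (e '' ↑(insert i s)) := by
        refine SetLike.lt_iff_le_and_exists.2 ⟨sup_le_sup_left (Ideal.span_mono
          (Set.image_mono (by simp))) _, e i,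
          Ideal.mem_sup_right (Ideal.subset_span ⟨i, by simp, rfl⟩), fun hmem => ?_⟩
        obtain ⟨k, hk, v, hv, hkv⟩ := Submodule.mem_sup.1 hmem
        obtain ⟨c, rfl⟩ := (Submodule.mem_span_image_finset_iff_exists_fun' P).1 hv
        have h1 := h (fun j => if j = i then 1 else if j ∈ s then -c j else 0) (by
          have : ∑ j, (if j = i then 1 else if j ∈ s then -c j else 0) * e j = k := by
            have h2 : ∀ j, (if j = i then 1 else if j ∈ s then -c j else 0) * e j =
                (if j = i then e j else 0) - (if j ∈ s then c j * e j else 0) := by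
              intro j
              by_cases hj : j = i
              · subst hj; simp [hi]
              · by_cases hjs : j ∈ s <;> simp [hj, hjs]
            simp_rw [h2, Finset.sum_sub_distrib, Finset.sum_ite_mem, Finset.univ_inter]
            rw [Finset.sum_ite_eq' Finset.univ i, if_pos (Finset.mem_univ _), ← hkv]
            simp
          rwa [this]) i
        rw [if_pos rfl] at h1
        exact (maximalIdeal.isMaximal P).ne_top ((Ideal.eq_top_iff_one _).2 h1)
      have := colength_strictMono (hK.trans le_sup_left) hlt
      rw [Finset.card_insert_of_notMem hi]
      omega
  have h1 := key Finset.univ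
  have h2 : K ⊔ Ideal.span (e '' ↑(Finset.univ : Finset ι)) ≤ I := by
    refine sup_le hKI (Ideal.span_le.2 ?_)
    rintro _ ⟨i, -, rfl⟩
    exact he i
  have := colength_mono (hK.trans le_sup_left) h2
  rw [Finset.card_univ] at h1
  omega

theorem colength_sup_span_of_maximalIdeal_mul {K : Ideal P} {n : ℕ} (hK : maximalIdeal P ^ n ≤ K)
    {y : P} (hy : y ∉ K) (h : ∀ c ∈ maximalIdeal P, c * y ∈ K) :
    colength K = colength (K ⊔ Ideal.span {y}) + 1 := by
  have h1 : colonElem K y = maximalIdeal P := by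
    refine le_antisymm (le_maximalIdeal fun e => hy ?_) fun c hc => ?_
    · have : (1 : P) ∈ colonElem K y := e ▸ Submodule.mem_top
      simpa [mem_colonElem] using this
    · rw [mem_colonElem, mul_comm]; exact h c hc
  rw [colength_eq_add hK y, h1, colength_maximalIdeal, add_comm]

/-- A basis of the vector space `I / K`. -/
theorem exists_indepMod {K I : Ideal P} {n : ℕ} (hK : maximalIdeal P ^ n ≤ K) (hKI : K ≤ I)
    (hI : maximalIdeal P * I ≤ K) {r : ℕ} (hr : colength I + r = colength K) :
    ∃ e : Fin r → P, (∀ i, e i ∈ I) ∧ IndepMod K e := by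
  induction r generalizing K with
  | zero => exact ⟨Fin.elim0, fun i => i.elim0, fun c _ i => i.elim0⟩
  | succ r ih =>
    have hne : ∃ y ∈ I, y ∉ K := by
      by_contra! hle
      have : I = K := le_antisymm hle hKI
      subst this
      omega
    obtain ⟨y, hyI, hyK⟩ := hne
    have h1 := colength_sup_span_of_maximalIdeal_mul hK hyK
      fun c hc => hI (Ideal.mul_mem_mul hc hyI)
    obtain ⟨e, heI, he⟩ := ih (K := K ⊔ Ideal.span {y}) (hK.trans le_sup_left)
      (sup_le hKI (by rwa [Ideal.span_singleton_le_iff_mem])) (hI.trans le_sup_left) (by omega)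
    refine ⟨Fin.cons y e, fun i => Fin.cases hyI heI i, fun c hc => ?_⟩
    rw [Fin.sum_univ_succ] at hc
    simp only [Fin.cons_zero, Fin.cons_succ] at hc
    have h2 : ∀ i, c (Fin.succ i) ∈ maximalIdeal P := by
      refine he (fun i => c i.succ) ?_
      have : ∑ i, c (Fin.succ i) * e i =
          (c 0 * y + ∑ i, c (Fin.succ i) * e i) + (-c 0) * y := by ring
      rw [this]
      exact add_mem (Ideal.mem_sup_left hc)
        (Ideal.mem_sup_right (Ideal.mul_mem_left _ _ (Ideal.mem_span_singleton_self y)))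
    refine fun i => Fin.cases ?_ h2 i
    by_contra h0
    have hu : IsUnit (c 0) := by simpa [mem_maximalIdeal] using h0
    have h3 : ∑ i, c (Fin.succ i) * e i ∈ K :=
      sum_mem fun i _ => hI (Ideal.mul_mem_mul (h2 i) (heI i))
    have h4 : c 0 * y ∈ K := by
      have : c 0 * y = (c 0 * y + ∑ i, c (Fin.succ i) * e i) - ∑ i, c (Fin.succ i) * e i := by ring
      rw [this]; exact sub_mem hc h3
    exact hyK ((Ideal.unit_mul_mem_iff_mem K hu).1 h4)

end Independent

/-! ### Regular systems of parameters -/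

section RegularParameters

variable {P : Type*} [CommRing P] [IsLocalRing P] [IsNoetherianRing P]

/-- Krull's height theorem: fewer than `dim P` elements do not generate an `𝔪`-primary ideal. -/
theorem not_pow_le_span_of_card_lt {d : ℕ} (hd : ringKrullDim P = d) (s : Finset P)
    (hs : s.card < d) (hsm : Ideal.span (s : Set P) ≤ maximalIdeal P) (n : ℕ) :
    ¬ maximalIdeal P ^ n ≤ Ideal.span (s : Set P) := by
  intro hn
  have hmin : maximalIdeal P ∈ (Ideal.span (s : Set P)).minimalPrimes :=
    ⟨⟨(maximalIdeal.isMaximal P).isPrime, hsm⟩, fun q hq _ => by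
      have := hq.1
      exact Ideal.IsPrime.le_of_pow_le (hn.trans hq.2)⟩
  have h1 := Ideal.height_le_card_of_mem_minimalPrimes_span_finset hmin
  rw [← maximalIdeal_height_eq_ringKrullDim] at hd
  have h2 : (maximalIdeal P).height = d := by exact_mod_cast hd
  rw [h2] at h1
  exact absurd (by exact_mod_cast h1) (not_le.2 hs)

omit [IsLocalRing P] [IsNoetherianRing P] in
theorem sup_span_singleton_pow_le (J : Ideal P) (x : P) (n : ℕ) :
    (J ⊔ Ideal.span {x}) ^ n ≤ J ⊔ Ideal.span {x ^ n} := by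
  induction n with
  | zero => simp
  | succ n ih =>
    rw [pow_succ]
    refine (Ideal.mul_mono_left ih).trans ?_
    rw [Ideal.sup_mul, Ideal.mul_sup (Ideal.span {x ^ n}),
      Ideal.span_singleton_mul_span_singleton, ← pow_succ]
    exact sup_le (Ideal.mul_le_left.trans le_sup_left) (sup_le_sup_right Ideal.mul_le_right _)

omit [IsLocalRing P] [IsNoetherianRing P] in
theorem eval_mul_of_isHomogeneous {σ : Type*} {F : MvPolynomial σ P} {n : ℕ}
    (hF : F.IsHomogeneous n) (r : P) (y : σ → P) :
    MvPolynomial.eval (fun i => r * y i) F = r ^ n * MvPolynomial.eval y F := by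
  rw [MvPolynomial.eval_eq, MvPolynomial.eval_eq, Finset.mul_sum]
  refine Finset.sum_congr rfl fun m hm => ?_
  have hd := hF (MvPolynomial.mem_support_iff.1 hm)
  simp_rw [mul_pow, Finset.prod_mul_distrib, Finset.prod_pow_eq_pow_sum]
  rw [Finsupp.weight_apply] at hd
  simp only [Pi.one_apply, smul_eq_mul, mul_one] at hd
  rw [Finsupp.sum] at hd
  rw [hd]
  ring

omit [IsLocalRing P] [IsNoetherianRing P] in
theorem eval_sub_eval_mem {σ : Type*} (F : MvPolynomial σ P) (J : Ideal P) {y y' : σ → P}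
    (h : ∀ i, y i - y' i ∈ J) : MvPolynomial.eval y F - MvPolynomial.eval y' F ∈ J := by
  rw [← Ideal.Quotient.mk_eq_mk_iff_sub_mem]
  change Ideal.Quotient.mk J (MvPolynomial.eval₂ (RingHom.id P) y F) =
    Ideal.Quotient.mk J (MvPolynomial.eval₂ (RingHom.id P) y' F)
  rw [MvPolynomial.eval₂_comp_left, MvPolynomial.eval₂_comp_left]
  congr 1
  ext i
  exact (Ideal.Quotient.mk_eq_mk_iff_sub_mem _ _).2 (h i)

/-- A regular system of parameters is quasi-regular. If a form of degree `n` with a unit coefficient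
had a value in `𝔪ⁿ⁺¹`, then after a linear change of coordinates it would contain the `n`-th power
of a variable `x`; so a power of `x`, hence a power of `𝔪`, would be in the ideal generated by the
other `d - 1` coordinates, against Krull's height theorem. -/
theorem coeff_mem_of_eval_mem [Infinite (ResidueField P)] {d : ℕ} (hd : ringKrullDim P = d)
    {x : Fin d → P} (hx : Ideal.span (Set.range x) = maximalIdeal P) {n : ℕ}
    {F : MvPolynomial (Fin d) P} (hF : F.IsHomogeneous n)
    (h : MvPolynomial.eval x F ∈ maximalIdeal P ^ (n + 1)) (m : Fin d →₀ ℕ) :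
    F.coeff m ∈ maximalIdeal P := by
  classical
  by_contra hm
  have hFb : MvPolynomial.map (residue P) F ≠ 0 := fun h0 => hm <| by
    have := congrArg (MvPolynomial.coeff m) h0
    rwa [MvPolynomial.coeff_map, MvPolynomial.coeff_zero, residue_eq_zero_iff] at this
  obtain ⟨c, hc⟩ : ∃ c, MvPolynomial.eval c (MvPolynomial.map (residue P) F) ≠ 0 := by
    by_contra! h0
    exact hFb (MvPolynomial.funext fun c => by rw [h0, map_zero])
  choose C hC using fun i => residue_surjective (c i)
  obtain rfl : (fun i => residue P (C i)) = c := funext hC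
  have hu : IsUnit (MvPolynomial.eval C F) := by
    rw [← residue_ne_zero_iff_isUnit]
    convert hc using 1
    rw [MvPolynomial.eval_map]
    exact MvPolynomial.eval₂_comp_left (residue P) (RingHom.id P) C F
  have hxm : ∀ i, x i ∈ maximalIdeal P := fun i => hx ▸ Ideal.subset_span ⟨i, rfl⟩
  have hj : ∃ j, IsUnit (C j) := by
    by_contra! hj
    have h1 := eval_sub_eval_mem F (maximalIdeal P) (y := C) (y' := x)
      fun i => sub_mem ((mem_maximalIdeal _).2 (hj i)) (hxm i)
    have h2 := Ideal.pow_le_self (Nat.succ_ne_zero n) h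
    have h3 := add_mem h1 h2
    rw [sub_add_cancel] at h3
    exact (mem_maximalIdeal _).1 h3 hu
  obtain ⟨j, hj⟩ := hj
  obtain ⟨v, hv⟩ := hj.exists_left_inv
  have hvu : IsUnit v := IsUnit.of_mul_eq_one _ hv
  have hu' : IsUnit (MvPolynomial.eval (fun i => v * C i) F) := by
    rw [eval_mul_of_isHomogeneous hF]
    exact (hvu.pow n).mul hu
  let s : Finset P := (Finset.univ.erase j).image fun i => x i - v * C i * x j
  let J := Ideal.span (s : Set P)
  have hyJ : ∀ i, x i - v * C i * x j ∈ J := by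
    intro i
    by_cases hij : i = j
    · subst hij
      rw [hv]; simp
    · exact Ideal.subset_span (Finset.mem_coe.2 (Finset.mem_image.2 ⟨i, by simp [hij], rfl⟩))
  have h1 : x j ^ n ∈ J ⊔ maximalIdeal P ^ (n + 1) := by
    have h2 := eval_sub_eval_mem F J (y := x) (y' := fun i => x j * (v * C i))
      fun i => by rw [mul_comm (x j)]; exact hyJ i
    rw [eval_mul_of_isHomogeneous hF] at h2
    have h3 := sub_mem (Ideal.mem_sup_right h : _ ∈ J ⊔ _) (Ideal.mem_sup_left h2)
    rw [sub_sub_cancel] at h3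
    rw [mul_comm] at h3
    exact (Ideal.unit_mul_mem_iff_mem _ hu').1 h3
  have hle : maximalIdeal P ≤ J ⊔ Ideal.span {x j} := by
    rw [← hx, Ideal.span_le]
    rintro _ ⟨i, rfl⟩
    have : x i = (x i - v * C i * x j) + v * C i * x j := by ring
    rw [this]
    exact add_mem (Ideal.mem_sup_left (hyJ i)) (Ideal.mem_sup_right
      (Ideal.mul_mem_left _ _ (Ideal.mem_span_singleton_self _)))
  have hpow : maximalIdeal P ^ n ≤ J ⊔ maximalIdeal P • maximalIdeal P ^ n := by
    rw [smul_eq_mul, ← pow_succ']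
    refine (Ideal.pow_right_mono hle n).trans ((sup_span_singleton_pow_le J _ n).trans ?_)
    exact sup_le le_sup_left (by rwa [Ideal.span_singleton_le_iff_mem])
  have hJ : maximalIdeal P ^ n ≤ J :=
    Submodule.le_of_le_smul_of_le_jacobson_bot (IsNoetherian.noetherian _)
      (maximalIdeal_le_jacobson _) hpow
  refine not_pow_le_span_of_card_lt hd s ?_ ?_ n hJ
  · refine Finset.card_image_le.trans_lt ?_
    rw [Finset.card_erase_of_mem (Finset.mem_univ _), Finset.card_univ, Fintype.card_fin]
    have := j.2
    omega
  · refine Ideal.span_le.2 fun y hy => ?_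
    obtain ⟨i, -, rfl⟩ := Finset.mem_image.1 (Finset.mem_coe.1 hy)
    exact sub_mem (hxm i) (Ideal.mul_mem_left _ _ (hxm j))

open PowerSeries in
/-- The number of monomials of degree `n` in `d` variables. -/
theorem coeff_geom_one_pow (d n : ℕ) :
    coeff n (geom 1 ^ d) = ((Finset.univ : Finset (Fin d)).finsuppAntidiag n).card := by
  have : geom 1 ^ d = ∏ _i : Fin d, geom 1 := by simp
  rw [this, PowerSeries.coeff_prod]
  simp [geom]

open PowerSeries in
/-- The monomials of degree `n` in a regular system of parameters are linearly independent modulo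
`𝔪ⁿ⁺¹`. -/
theorem coeff_geom_one_pow_add_le [Infinite (ResidueField P)] {d : ℕ} (hd : ringKrullDim P = d)
    {x : Fin d → P} (hx : Ideal.span (Set.range x) = maximalIdeal P) (n : ℕ) :
    coeff n (geom 1 ^ d) + colength (maximalIdeal P ^ n) ≤ colength (maximalIdeal P ^ (n + 1)) := by
  classical
  let A := (Finset.univ : Finset (Fin d)).finsuppAntidiag n
  have hxm : ∀ i, x i ∈ maximalIdeal P := fun i => hx ▸ Ideal.subset_span ⟨i, rfl⟩
  have hA : ∀ m ∈ A, ∑ i, m i = n := fun m hm => by simpa [A] using hm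
  let e : A → P := fun m => ∏ i, x i ^ m.1 i
  have he : ∀ m, e m ∈ maximalIdeal P ^ n := fun m => by
    rw [← hA m.1 m.2, ← Finset.prod_pow_eq_pow_sum]
    exact Ideal.prod_mem_prod fun i _ => Ideal.pow_mem_pow (hxm i) _
  have hind : IndepMod (maximalIdeal P ^ (n + 1)) e := by
    intro c hc m
    let F : MvPolynomial (Fin d) P := ∑ m : A, MvPolynomial.monomial m.1 (c m)
    have hF : F.IsHomogeneous n := by
      refine MvPolynomial.IsHomogeneous.sum _ _ _ fun m _ =>
        MvPolynomial.isHomogeneous_monomial _ ?_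
      rw [Finsupp.degree_eq_sum]
      exact hA m.1 m.2
    have h1 := coeff_mem_of_eval_mem hd hx hF (by
      convert hc using 1
      rw [map_sum]
      refine Finset.sum_congr rfl fun m _ => ?_
      rw [MvPolynomial.eval_monomial, Finsupp.prod_fintype]
      intro i
      simp) m.1
    rw [MvPolynomial.coeff_sum] at h1
    simp only [MvPolynomial.coeff_monomial] at h1
    rw [Finset.sum_eq_single m (fun b _ hb => if_neg fun h => hb (Subtype.ext h))
      (fun h => absurd (Finset.mem_univ _) h), if_pos rfl] at h1
    exact h1
  have h1 := hind.colength_add_card_le le_rfl (Ideal.pow_le_pow_right (Nat.le_succ n)) he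
  rw [coeff_geom_one_pow]
  rw [Fintype.card_coe] at h1
  have : A.card = ((Finset.univ : Finset (Fin d)).finsuppAntidiag n).card := rfl
  omega

omit [CommRing P] [IsLocalRing P] [IsNoetherianRing P] in
theorem geomProd_of_forall_eq_one {L : List (P × ℕ)} (h : ∀ p ∈ L, p.2 = 1) :
    geomProd L = geom 1 ^ L.length := by
  induction L with
  | nil => simp [geomProd]
  | cons p L ih =>
    have h1 := ih fun q hq => h q (List.mem_cons_of_mem _ hq)
    rw [geomProd] at h1 ⊢
    rw [List.map_cons, List.prod_cons, h1, h p (List.mem_cons_self), List.length_cons, pow_succ']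

omit [IsNoetherianRing P] in
open PowerSeries in
theorem lengthSeries_maximalIdeal : lengthSeries (maximalIdeal P) = X * geom 1 := by
  ext n
  rw [lengthSeries, coeff_mk, ← pow_one X, coeff_X_pow_mul', geom, coeff_mk]
  split_ifs with h1 h2
  · rw [sup_eq_left.2 (Ideal.pow_le_self (by omega)), colength_maximalIdeal]; rfl
  · simp at h2
  · have : n = 0 := by omega
    subst this
    simp [colength_top]

/-- In a regular local ring, any `d = dim P` generators of the maximal ideal are a strict
sequence. -/
theorem strictSeq_of_seqIdeal_eq [Infinite (ResidueField P)] {L : List (P × ℕ)}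
    (hd : ringKrullDim P = L.length) (hL : ∀ p ∈ L, p.2 = 1)
    (hx : seqIdeal L = maximalIdeal P) : StrictSeq ⊥ L := by
  have hO : HasOrders L := fun p hp => by
    rw [hL p hp, pow_one, ← hx]
    exact ⟨Ideal.subset_span (List.mem_map_of_mem hp), one_pos⟩
  have hspan : Ideal.span (Set.range fun i : Fin L.length => (L.get i).1) = maximalIdeal P := by
    rw [← hx, seqIdeal, Ideal.ofList]
    congr 1
    ext y
    simp only [Set.mem_range, Set.mem_ofPred_eq, List.mem_map]
    constructor
    · rintro ⟨i, rfl⟩; exact ⟨_, L.get_mem i, rfl⟩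
    · rintro ⟨p, hp, rfl⟩
      obtain ⟨i, rfl⟩ := List.get_of_mem hp
      exact ⟨i, rfl⟩
  rw [strictSeq_iff_excess_eq_zero ⊥ hO]
  have h1 := excess_nonneg (⊥ : Ideal P) hO
  have hg := geom_mul one_pos
  -- the coefficients of `(1 - z) * excess` are nonpositive by the count of monomials
  have h2 : IsNonneg (-((1 - PowerSeries.X ^ 1) * excess ⊥ L)) := by
    have e1 : -((1 - PowerSeries.X ^ 1) * excess ⊥ L) =
        (1 - PowerSeries.X ^ 1) * lengthSeries (⊥ : Ideal P) -
          PowerSeries.X ^ 1 * geom 1 ^ L.length := by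
      rw [excess, bot_sup_eq, hx, lengthSeries_maximalIdeal, geomProd_of_forall_eq_one hL]
      linear_combination (-PowerSeries.X * geom 1 ^ L.length) * hg
    intro n
    rw [e1, sub_mul, one_mul, map_sub, map_sub, PowerSeries.coeff_X_pow_mul',
      PowerSeries.coeff_X_pow_mul']
    simp only [lengthSeries, PowerSeries.coeff_mk, bot_sup_eq]
    rcases n with _ | n
    · simp
    · have := coeff_geom_one_pow_add_le hd hspan n
      simp only [Nat.le_add_left, if_true, Nat.add_sub_cancel]
      omega
  have h3 : IsNonneg (-excess ⊥ L) := by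
    have : -excess ⊥ L = geom 1 * (-((1 - PowerSeries.X ^ 1) * excess ⊥ L)) := by
      linear_combination (excess ⊥ L) * hg
    rw [this]
    exact (geom_nonneg 1).mul h2
  exact h1.eq_zero_of_add_eq_zero h3 (by ring)

end RegularParameters

/-! ### Socles and generic linear elements -/

section Socle

variable {P : Type*} [CommRing P] [IsLocalRing P]

/-- The associated graded ring of `P / J` has no nonzero homogeneous element annihilated by its
irrelevant ideal. -/
def SocleFree (J : Ideal P) : Prop :=
  ∀ t u, u ∈ maximalIdeal P ^ t → (∀ x ∈ maximalIdeal P, x * u ∈ J ⊔ maximalIdeal P ^ (t + 2)) →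
    u ∈ J ⊔ maximalIdeal P ^ (t + 1)

/-- A strict linear element, being a nonzerodivisor on the associated graded ring, annihilates no
nonzero element, so the socle vanishes. -/
theorem IsStrict.socleFree {J : Ideal P} {x : P} (hx : x ∈ maximalIdeal P)
    (h : IsStrict J x 1) : SocleFree J :=
  fun t u _ hxu => h (t + 1) u (hxu x hx)

theorem mul_mem_sup_pow {J : Ideal P} {y z : P} {s n : ℕ} (hy : y ∈ maximalIdeal P ^ s)
    (hz : z ∈ J ⊔ maximalIdeal P ^ n) : y * z ∈ J ⊔ maximalIdeal P ^ (n + s) :=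
  sup_pow_le_colonElem J hy n hz

/-- The vanishing of the socle does not depend on the strict element that one divides by: for
a socle element `u` modulo `g`, write `x * u = g * v` in the associated graded ring of `P / J`; then
`v` is in the socle modulo `x`. -/
theorem SocleFree.exchange {J : Ideal P} {x g : P} {s : ℕ} (hx : x ∈ maximalIdeal P)
    (hxs : IsStrict J x 1) (hg : g ∈ maximalIdeal P ^ s) (hgs : IsStrict J g s)
    (h : SocleFree (J ⊔ Ideal.span {x})) : SocleFree (J ⊔ Ideal.span {g}) := by
  intro t u hu hmu
  by_cases hts : t + 1 < s
  · -- the order of `g` is so large that dividing by `g` does not affect the degrees involved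
    have hle : Ideal.span {g} ≤ maximalIdeal P ^ (t + 2) := by
      rw [Ideal.span_singleton_le_iff_mem]
      exact Ideal.pow_le_pow_right (by omega) hg
    have h1 : x * u ∈ J ⊔ maximalIdeal P ^ (t + 1 + 1) := by
      have := hmu x hx
      rwa [sup_assoc, sup_eq_right.2 hle] at this
    exact (sup_le_sup_right le_sup_left _ : J ⊔ _ ≤ _) (hxs _ _ h1)
  obtain ⟨t', ht'⟩ : ∃ t', t + 1 = t' + s := ⟨t + 1 - s, by omega⟩
  have hx1 : x ∈ maximalIdeal P ^ 1 := by rwa [pow_one]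
  have key : ∀ c ∈ maximalIdeal P,
      ∃ v ∈ maximalIdeal P ^ t', c * u - g * v ∈ J ⊔ maximalIdeal P ^ (t + 2) := by
    intro c hc
    have h1 := hmu c hc
    rw [sup_right_comm] at h1
    obtain ⟨a, ha, b, hb, hab⟩ := Submodule.mem_sup.1 h1
    obtain ⟨v, rfl⟩ := Ideal.mem_span_singleton.1 hb
    have hcu : c * u ∈ maximalIdeal P ^ (t + 1) := by
      rw [pow_succ']; exact Ideal.mul_mem_mul hc hu
    have h2 : g * v ∈ J ⊔ maximalIdeal P ^ (t' + s) := by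
      rw [← ht']
      have : g * v = c * u - a := by rw [← hab]; ring
      rw [this]
      exact sub_mem (Ideal.mem_sup_right hcu)
        ((sup_le_sup_left (Ideal.pow_le_pow_right (by omega)) _ : _ ≤ J ⊔ _) ha)
    obtain ⟨j, hj, v', hv', rfl⟩ := Submodule.mem_sup.1 (hgs _ _ h2)
    refine ⟨v', hv', ?_⟩
    have : c * u - g * v' = a + g * j := by rw [← hab]; ring
    rw [this]
    exact add_mem ha (Ideal.mem_sup_left (J.mul_mem_left _ hj))
  obtain ⟨v, hv, hxv⟩ := key x hx
  have h1 : v ∈ J ⊔ Ideal.span {x} ⊔ maximalIdeal P ^ (t' + 1) := by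
    refine h t' v hv fun c hc => ?_
    obtain ⟨w, -, hw⟩ := key c hc
    have h2 : g * (c * v - x * w) ∈ J ⊔ maximalIdeal P ^ (t' + 2 + s) := by
      have e : g * (c * v - x * w) = x * (c * u - g * w) - c * (x * u - g * v) := by ring
      have hc1 : c ∈ maximalIdeal P ^ 1 := by rwa [pow_one]
      have e' : t' + 2 + s = t + 2 + 1 := by omega
      rw [e, e']
      exact sub_mem (mul_mem_sup_pow hx1 hw) (mul_mem_sup_pow hc1 hxv)
    have h3 := hgs _ _ h2
    have e : c * v = (c * v - x * w) + w * x := by ring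
    rw [e, sup_right_comm]
    exact add_mem (Ideal.mem_sup_left h3)
      (Ideal.mem_sup_right (Ideal.mul_mem_left _ _ (Ideal.mem_span_singleton_self x)))
  rw [sup_right_comm] at h1
  obtain ⟨a, ha, b, hb, rfl⟩ := Submodule.mem_sup.1 h1
  obtain ⟨v', rfl⟩ := Ideal.mem_span_singleton.1 hb
  have h2 : x * (u - g * v') ∈ J ⊔ maximalIdeal P ^ (t + 1 + 1) := by
    have e : x * (u - g * v') = (x * u - g * (a + x * v')) + g * a := by ring
    rw [e]
    refine add_mem hxv ?_
    have := mul_mem_sup_pow hg ha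
    rwa [show t' + 1 + s = t + 1 + 1 by omega] at this
  have h3 := hxs _ _ h2
  have e : u = (u - g * v') + v' * g := by ring
  rw [e, sup_right_comm]
  exact add_mem (Ideal.mem_sup_left h3)
    (Ideal.mem_sup_right (Ideal.mul_mem_left _ _ (Ideal.mem_span_singleton_self g)))

/-- The ideal of the Rees algebra of `𝔪` whose quotient is the associated graded ring of `P / J`. -/
def reesInitialIdeal (J : Ideal P) : Ideal (reesAlgebra (maximalIdeal P)) where
  carrier := {f | ∀ n, (f : Polynomial P).coeff n ∈ J ⊔ maximalIdeal P ^ (n + 1)}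
  add_mem' {f g} hf hg n := by
    simp only [Subalgebra.coe_add, Polynomial.coeff_add]
    exact add_mem (hf n) (hg n)
  zero_mem' n := by simp
  smul_mem' f g hg n := by
    simp only [smul_eq_mul, Subalgebra.coe_mul, Polynomial.coeff_mul]
    refine sum_mem fun ij hij => ?_
    have h1 := mul_mem_sup_pow ((mem_reesAlgebra_iff _ _).1 f.2 ij.1) (hg ij.2)
    have h2 : ij.1 + ij.2 = n := by simpa using hij
    rwa [show ij.2 + 1 + ij.1 = n + 1 by omega] at h1

/-- An element of `𝔪` as an element of degree one of the Rees algebra. -/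
noncomputable def reesLinear (P : Type*) [CommRing P] [IsLocalRing P] :
    maximalIdeal P →ₗ[P] reesAlgebra (maximalIdeal P) where
  toFun x := ⟨Polynomial.monomial 1 (x : P), reesAlgebra.monomial_mem.2 (by simp)⟩
  map_add' x y := Subtype.ext (by simp)
  map_smul' c x := Subtype.ext (by simp [Polynomial.smul_monomial])

/-- The failure of strictness is witnessed by an element of exact order. -/
theorem exists_of_not_isStrict {J : Ideal P} {y : P} {s : ℕ} (h : ¬ IsStrict J y s) :
    ∃ t u, u ∈ maximalIdeal P ^ t ∧ u ∉ J ⊔ maximalIdeal P ^ (t + 1) ∧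
      y * u ∈ J ⊔ maximalIdeal P ^ (t + 1 + s) := by
  classical
  unfold IsStrict at h
  push Not at h
  obtain ⟨n, z, hxz, hz⟩ := h
  have hex : ∃ m, z ∉ J ⊔ maximalIdeal P ^ m := ⟨n, hz⟩
  have hm := Nat.find_spec hex
  have hmn : Nat.find hex ≤ n := Nat.find_min' hex hz
  obtain ⟨t, ht⟩ : ∃ t, Nat.find hex = t + 1 := by
    refine Nat.exists_eq_succ_of_ne_zero fun h0 => hm ?_
    rw [h0]; simp
  have hzt : z ∈ J ⊔ maximalIdeal P ^ t := by
    have := Nat.find_min hex (m := t) (by omega)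
    simpa using this
  rw [ht] at hm hmn
  obtain ⟨j, hj, u, hu, rfl⟩ := Submodule.mem_sup.1 hzt
  refine ⟨t, u, hu, fun h => hm (add_mem (Ideal.mem_sup_left hj) h), ?_⟩
  have e : y * u = y * (j + u) - y * j := by ring
  rw [e]
  exact sub_mem ((sup_le_sup_left (Ideal.pow_le_pow_right (by omega)) _ : _ ≤ J ⊔ _) hxz)
    (Ideal.mem_sup_left (J.mul_mem_left _ hj))

/-- A linear element which is not strict is a zero divisor modulo `reesInitialIdeal J`. -/
theorem exists_reesLinear_mul_mem {J : Ideal P} {x : maximalIdeal P}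
    (h : ¬ IsStrict J (x : P) 1) :
    ∃ f : reesAlgebra (maximalIdeal P), f ∉ reesInitialIdeal J ∧
      reesLinear P x * f ∈ reesInitialIdeal J := by
  obtain ⟨t, u, hu, hu', hxu⟩ := exists_of_not_isStrict h
  refine ⟨⟨Polynomial.monomial t u, reesAlgebra.monomial_mem.2 hu⟩, fun hK => hu' ?_, fun n => ?_⟩
  · simpa only [Polynomial.coeff_monomial_same] using hK t
  · simp only [Subalgebra.coe_mul, reesLinear, LinearMap.coe_mk, AddHom.coe_mk,
      Polynomial.monomial_mul_monomial, Polynomial.coeff_monomial]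
    split_ifs with hn
    · rwa [← hn, add_comm 1 t]
    · exact zero_mem _

/-- Over an infinite residue field, a module is not a union of finitely many proper submodules. -/
theorem exists_eq_top_of_cover [Infinite (ResidueField P)] {M ι : Type*} [AddCommGroup M]
    [Module P M] {W : ι → Submodule P M} {s : Finset ι} (h : ⋃ i ∈ s, (W i : Set M) = Set.univ) :
    ∃ i ∈ s, W i = ⊤ := by
  obtain ⟨i, hi, hfin⟩ := Submodule.exists_finiteIndex_of_cover h
  refine ⟨i, hi, ?_⟩
  by_contra hne
  obtain ⟨y, hy⟩ : ∃ y, y ∉ W i := by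
    by_contra! hall
    exact hne (eq_top_iff.2 fun y _ => hall y)
  have : Finite (M ⧸ W i) := AddSubgroup.finite_quotient_of_finiteIndex
  choose l hl using residue_surjective (R := P)
  refine not_injective_infinite_finite (fun c => (W i).mkQ (l c • y)) fun c c' hcc => ?_
  by_contra hne'
  have h1 : l c • y - l c' • y ∈ W i := (Submodule.Quotient.eq _).1 hcc
  rw [← sub_smul] at h1
  have hu : IsUnit (l c - l c') := by
    rw [← residue_ne_zero_iff_isUnit, map_sub, hl, hl]
    exact sub_ne_zero.2 hne'
  exact hy ((Submodule.smul_mem_iff_of_isUnit (W i) hu).1 h1)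

/-- The zero divisors modulo an ideal of a noetherian ring lie in finitely many annihilators. -/
theorem exists_finset_annihilators {S : Type*} [CommRing S] [IsNoetherianRing S] (K : Ideal S) :
    ∃ T : Finset (Ideal S), (∀ s f, f ∉ K → s * f ∈ K → ∃ q ∈ T, s ∈ q) ∧
      ∀ q ∈ T, ∃ f, f ∉ K ∧ ∀ s ∈ q, s * f ∈ K := by
  have hfin : (associatedPrimes S (S ⧸ K)).Finite := associatedPrimes.finite S (S ⧸ K)
  refine ⟨hfin.toFinset, fun s f hf hsf => ?_, fun q hq => ?_⟩
  · have h1 : s ∈ ⋃ p ∈ associatedPrimes S (S ⧸ K), (p : Set S) := by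
      rw [biUnion_associatedPrimes_eq_zero_divisors]
      exact ⟨Submodule.Quotient.mk f, fun h0 => hf ((Submodule.Quotient.mk_eq_zero _).1 h0),
        (Submodule.Quotient.mk_eq_zero _).2 hsf⟩
    simp only [Set.mem_iUnion] at h1
    obtain ⟨q, hq, hsq⟩ := h1
    exact ⟨q, by simpa using hq, hsq⟩
  · rw [Set.Finite.mem_toFinset] at hq
    obtain ⟨hprime, m, hm⟩ := isAssociatedPrime_iff.1 hq
    obtain ⟨f, rfl⟩ := Submodule.Quotient.mk_surjective _ m
    refine ⟨f, fun hf => hprime.ne_top ((Ideal.eq_top_iff_one _).2 ?_), fun s hs => ?_⟩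
    · rw [hm, Submodule.mem_colon_singleton, one_smul, Submodule.mem_bot]
      exact (Submodule.Quotient.mk_eq_zero _).2 hf
    · rw [hm, Submodule.mem_colon_singleton] at hs
      exact (Submodule.Quotient.mk_eq_zero _).1 ((Submodule.mem_bot S).1 hs)

/-- Prime avoidance: if the socle vanishes, a general linear element is strict. -/
theorem SocleFree.exists_isStrict [IsNoetherianRing P] [Infinite (ResidueField P)] {J : Ideal P}
    (h : SocleFree J) : ∃ x ∈ maximalIdeal P, IsStrict J x 1 := by
  by_contra! hx
  obtain ⟨T, hT1, hT2⟩ := exists_finset_annihilators (reesInitialIdeal J)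
  obtain ⟨q, hq, hqtop⟩ := exists_eq_top_of_cover
    (W := fun q : Ideal (reesAlgebra (maximalIdeal P)) =>
      (q.restrictScalars P).comap (reesLinear P)) (s := T) <| by
    refine Set.eq_univ_of_forall fun x => ?_
    obtain ⟨f, hf, hxf⟩ := exists_reesLinear_mul_mem (hx x x.2)
    simp only [Set.mem_iUnion]
    obtain ⟨q, hq, hxq⟩ := hT1 _ f hf hxf
    exact ⟨q, hq, hxq⟩
  obtain ⟨f, hf, hkill⟩ := hT2 q hq
  refine hf fun n => h n _ ((mem_reesAlgebra_iff _ _).1 f.2 n) fun x hxm => ?_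
  have hxq : reesLinear P ⟨x, hxm⟩ ∈ q := by
    have : (⟨x, hxm⟩ : maximalIdeal P) ∈ (q.restrictScalars P).comap (reesLinear P) :=
      hqtop ▸ Submodule.mem_top
    exact this
  have h1 := hkill _ hxq (1 + n)
  simp only [reesLinear, LinearMap.coe_mk, AddHom.coe_mk, Subalgebra.coe_mul,
    Polynomial.coeff_monomial_mul, add_comm 1 n] at h1
  exact h1

end Socle

section Extension

variable {P : Type*} [CommRing P] [IsLocalRing P]

/-- Steinitz exchange in `𝔪 / 𝔪²`. -/
theorem exists_exchange {A : Ideal P} {Y : List (P × ℕ)} (hY : ∀ p ∈ Y, p.1 ∈ maximalIdeal P)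
    {x : P} (hx : x ∈ A ⊔ seqIdeal Y) (hxA : x ∉ A ⊔ maximalIdeal P ^ 2) :
    ∃ Y₁ y Y₂, Y = Y₁ ++ y :: Y₂ ∧ y.1 ∈ A ⊔ Ideal.span {x} ⊔ seqIdeal (Y₁ ++ Y₂) := by
  induction Y generalizing x with
  | nil => exact absurd (Ideal.mem_sup_left (by simpa using hx)) hxA
  | cons y Y ih =>
    rw [seqIdeal_cons, sup_left_comm] at hx
    obtain ⟨v, hv, x', hx', rfl⟩ := Submodule.mem_sup.1 hx
    obtain ⟨b, rfl⟩ := Ideal.mem_span_singleton'.1 hv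
    by_cases hb : IsUnit b
    · refine ⟨[], y, Y, rfl, (Ideal.unit_mul_mem_iff_mem _ hb).1 ?_⟩
      have h1 : b * y.1 + x' ∈ A ⊔ Ideal.span {b * y.1 + x'} ⊔ seqIdeal Y :=
        Ideal.mem_sup_left (Ideal.mem_sup_right (Ideal.mem_span_singleton_self _))
      have h2 := sub_mem h1 ((sup_le_sup_right le_sup_left _ : A ⊔ seqIdeal Y ≤ _) hx')
      rwa [add_sub_cancel_right] at h2
    · have hby : b * y.1 ∈ maximalIdeal P ^ 2 := by
        rw [pow_two]
        exact Ideal.mul_mem_mul ((mem_maximalIdeal _).2 hb) (hY y List.mem_cons_self)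
      obtain ⟨Y₁, z, Y₂, rfl, hz⟩ := ih (fun p hp => hY p (List.mem_cons_of_mem _ hp)) hx'
        fun h => hxA (add_mem (Ideal.mem_sup_right hby) h)
      refine ⟨y :: Y₁, z, Y₂, rfl, ?_⟩
      have hle : A ⊔ Ideal.span {x'} ⊔ seqIdeal (Y₁ ++ Y₂) ≤
          A ⊔ Ideal.span {b * y.1 + x'} ⊔ seqIdeal (y :: Y₁ ++ Y₂) := by
        rw [List.cons_append, seqIdeal_cons]
        refine sup_le (sup_le (le_sup_left.trans le_sup_left) ?_)
          (le_sup_right.trans le_sup_right)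
        rw [Ideal.span_singleton_le_iff_mem]
        have h1 : b * y.1 + x' ∈ A ⊔ Ideal.span {b * y.1 + x'} ⊔
            (Ideal.span {y.1} ⊔ seqIdeal (Y₁ ++ Y₂)) :=
          Ideal.mem_sup_left (Ideal.mem_sup_right (Ideal.mem_span_singleton_self _))
        have h2 := sub_mem h1 (Ideal.mem_sup_right (Ideal.mem_sup_left
            (Ideal.mul_mem_left _ b (Ideal.mem_span_singleton_self _))))
        rwa [add_sub_cancel_left] at h2
      exact hle hz

/-- The elements of the list are part of a regular system of parameters. -/
def Extends (X : List (P × ℕ)) (d : ℕ) : Prop :=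
  ∃ Y : List (P × ℕ), (∀ p ∈ X ++ Y, p.2 = 1) ∧ (X ++ Y).length = d ∧
    seqIdeal (X ++ Y) = maximalIdeal P

/-- By Steinitz exchange, part of a regular system of parameters can be enlarged by any element of
`𝔪` which is independent of it modulo `𝔪²`. -/
theorem Extends.cons {X : List (P × ℕ)} {d : ℕ} (h : Extends X d) {x : P}
    (hx : x ∈ maximalIdeal P) (hxX : x ∉ seqIdeal X ⊔ maximalIdeal P ^ 2) :
    Extends ((x, 1) :: X) d := by
  obtain ⟨Y, h1, h2, h3⟩ := h
  have hmem : ∀ p ∈ X ++ Y, p.1 ∈ maximalIdeal P := fun p hp =>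
    h3 ▸ Ideal.subset_span (List.mem_map_of_mem hp)
  obtain ⟨Y₁, y, Y₂, rfl, hy⟩ := exists_exchange (A := seqIdeal X) (Y := Y)
    (fun p hp => hmem p (List.mem_append_right _ hp)) (by rwa [← seqIdeal_append, h3]) hxX
  refine ⟨Y₁ ++ Y₂, ?_, ?_, le_antisymm ?_ ?_⟩
  · intro p hp
    simp only [List.cons_append, List.mem_cons, List.mem_append] at hp
    rcases hp with rfl | hp | hp | hp
    · rfl
    all_goals exact h1 p (by simp [hp])
  · simp only [List.length_append, List.length_cons] at h2 ⊢
    omega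
  · rw [List.cons_append, seqIdeal_cons]
    refine sup_le (by rwa [Ideal.span_singleton_le_iff_mem]) (Ideal.span_le.2 ?_)
    intro z hz
    obtain ⟨p, hp, rfl⟩ := List.mem_map.1 hz
    refine hmem p ?_
    simp only [List.mem_append, List.mem_cons] at hp ⊢
    tauto
  · rw [← h3]
    simp only [List.cons_append, seqIdeal_cons, seqIdeal_append] at hy ⊢
    refine sup_le (le_sup_left.trans le_sup_right) (sup_le ?_ (sup_le ?_ ?_))
    · exact le_sup_left.trans (le_sup_right.trans le_sup_right)
    · rw [Ideal.span_singleton_le_iff_mem]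
      convert hy using 1
      ac_rfl
    · exact le_sup_right.trans (le_sup_right.trans le_sup_right)

variable [IsNoetherianRing P] [Infinite (ResidueField P)]

/-- The associated graded ring of the quotient by a strict sequence of length less than `d` has zero
socle if the sequence starts with part of a regular system of parameters. The elements `G` after
these are removed one at a time: by induction, without the last one there is a strict linear
element, and `SocleFree.exchange` replaces the last element by this linear one, which joins the
system of parameters. -/
theorem socleFree_of_extends {d : ℕ} (hd : ringKrullDim P = d) {X : List (P × ℕ)}
    (hX : Extends X d) {G : List (P × ℕ)} (hO : HasOrders (X ++ G)) (hs : StrictSeq ⊥ (X ++ G))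
    (hlen : (X ++ G).length < d) : SocleFree (seqIdeal (X ++ G)) := by
  induction G using List.reverseRecOn generalizing X with
  | nil =>
    obtain ⟨Y, h1, h2, h3⟩ := hX
    rw [List.append_nil] at hlen ⊢
    have hst := strictSeq_of_seqIdeal_eq (by rw [h2]; exact hd) h1 h3
    rcases Y with _ | ⟨y, Y⟩
    · rw [List.append_nil] at h2; omega
    · rw [strictSeq_append, bot_sup_eq] at hst
      have hy := hst.2.1
      rw [h1 y (by simp)] at hy
      exact hy.socleFree (h3 ▸ Ideal.subset_span (List.mem_map_of_mem (by simp)))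
  | append_singleton G g ih =>
    rw [← List.append_assoc] at hO hs hlen ⊢
    obtain ⟨hO1, hO2⟩ := HasOrders.append.1 hO
    obtain ⟨hs1, hs2, -⟩ := strictSeq_append.1 hs
    rw [bot_sup_eq] at hs2
    have hlen' : (X ++ G).length + 1 < d := by simpa [add_assoc] using hlen
    obtain ⟨x, hx, hxs⟩ := (ih hX hO1 hs1 (by omega)).exists_isStrict
    have hJ : seqIdeal (X ++ G) ≤ maximalIdeal P := Ideal.span_le.2 fun z hz => by
      obtain ⟨p, hp, rfl⟩ := List.mem_map.1 hz
      exact Ideal.pow_le_self (hO1 p hp).2.ne' (hO1 p hp).1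
    have hX' : Extends ((x, 1) :: X) d := by
      refine hX.cons hx fun hmem => ?_
      have h1 : x * 1 ∈ seqIdeal (X ++ G) ⊔ maximalIdeal P ^ (1 + 1) := by
        rw [mul_one]
        refine (sup_le_sup_right ?_ _ : seqIdeal X ⊔ _ ≤ _) hmem
        rw [seqIdeal_append]; exact le_sup_left
      have h2 := hxs 1 1 h1
      rw [pow_one, sup_eq_right.2 hJ] at h2
      exact (maximalIdeal.isMaximal P).ne_top ((Ideal.eq_top_iff_one _).2 h2)
    have hO' : HasOrders ((X ++ G) ++ [(x, 1)]) := by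
      refine HasOrders.append.2 ⟨hO1, fun p hp => ?_⟩
      rw [List.mem_singleton] at hp
      subst hp
      exact ⟨by simpa using hx, one_pos⟩
    have hs' : StrictSeq ⊥ ((X ++ G) ++ [(x, 1)]) := by
      refine strictSeq_append.2 ⟨hs1, ?_⟩
      rw [bot_sup_eq]
      exact ⟨hxs, trivial⟩
    have hperm : ((X ++ G) ++ [(x, 1)]).Perm (((x, 1) :: X) ++ G) := List.perm_append_singleton _ _
    have h1 := ih hX' (hO'.perm hperm) (hs'.perm hO' hperm) (by simpa using hlen')
    rw [← seqIdeal_perm hperm, seqIdeal_append (X ++ G)] at h1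
    rw [seqIdeal_append (X ++ G)]
    simp only [seqIdeal_cons, seqIdeal_nil, sup_bot_eq] at h1 ⊢
    exact h1.exchange hx hxs (hO2 g (by simp)).1 hs2

omit [Infinite (ResidueField P)] in
theorem extends_nil {d : ℕ} (hd : (maximalIdeal P).spanFinrank = d) :
    Extends ([] : List (P × ℕ)) d := by
  obtain ⟨s, hs, hspan⟩ := (IsNoetherian.noetherian
    (maximalIdeal P)).exists_span_finset_card_eq_spanFinrank
  refine ⟨s.toList.map fun x => (x, 1), ?_, ?_, ?_⟩
  · intro p hp
    simp only [List.nil_append, List.mem_map] at hp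
    obtain ⟨_, -, rfl⟩ := hp
    rfl
  · simp [hs, hd]
  · rw [← hspan, List.nil_append, seqIdeal, Ideal.ofList, List.map_map]
    congr 1
    ext
    simp

/-- A strict sequence in a regular local ring extends, by linear elements, to one of maximal
length: its quotient has a Cohen–Macaulay associated graded ring. -/
theorem StrictSeq.exists_append {d : ℕ} (hd : ringKrullDim P = d)
    (hd' : (maximalIdeal P).spanFinrank = d) {G : List (P × ℕ)} (hO : HasOrders G)
    (hs : StrictSeq ⊥ G) {m : ℕ} (hm : G.length + m = d) :
    ∃ X : List (P × ℕ), X.length = m ∧ (∀ p ∈ X, p.2 = 1) ∧ HasOrders (G ++ X) ∧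
      StrictSeq ⊥ (G ++ X) := by
  induction m generalizing G with
  | zero => exact ⟨[], rfl, by simp, by simpa using hO, by simpa using hs⟩
  | succ m ih =>
    have hSF : SocleFree (seqIdeal G) :=
      socleFree_of_extends hd (extends_nil hd') (G := G) hO hs (by simp; omega)
    obtain ⟨x, hx, hxs⟩ := hSF.exists_isStrict
    obtain ⟨X, h1, h2, h3, h4⟩ := ih (G := G ++ [(x, 1)])
      (HasOrders.append.2 ⟨hO, fun p hp => by
        rw [List.mem_singleton] at hp
        subst hp
        exact ⟨by simpa using hx, one_pos⟩⟩)
      (strictSeq_append.2 ⟨hs, by rw [bot_sup_eq]; exact ⟨hxs, trivial⟩⟩)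
      (by simp; omega)
    refine ⟨(x, 1) :: X, by simp [h1], ?_, by simpa using h3, by simpa using h4⟩
    intro p hp
    rcases List.mem_cons.1 hp with rfl | hp
    · rfl
    · exact h2 p hp

end Extension

/-! ### Growth of the defect and multiplicities -/

section Growth

open PowerSeries

variable {P : Type*} [CommRing P] [IsLocalRing P] [IsNoetherianRing P]

/-- The Pascal recursion for the number of monomials of degree `b` in `m + 1` variables. -/
theorem coeff_geom_one_pow_succ (m b : ℕ) :
    coeff b (geom 1 ^ (m + 1)) =
      coeff b (geom 1 ^ m) + if 1 ≤ b then coeff (b - 1) (geom 1 ^ (m + 1)) else 0 := by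
  have h : geom 1 ^ (m + 1) = geom 1 ^ m + X ^ 1 * geom 1 ^ (m + 1) := by
    linear_combination (geom 1 ^ m) * geom_mul one_pos
  conv_lhs => rw [h]
  rw [map_add, coeff_X_pow_mul']

/-- The multiples of a nonzero element of degree `t` of the associated graded ring of `P / J` grow
at least like a polynomial ring in as many variables as there are elements in a strict sequence of
linear elements. -/
theorem coeff_geom_one_pow_add_colength_le {X : List (P × ℕ)} (hX : ∀ p ∈ X, p.2 = 1)
    (hO : HasOrders X) {J : Ideal P} (hs : StrictSeq J X) {t : ℕ} {u : P}
    (hu : u ∈ maximalIdeal P ^ t) (hu' : u ∉ J ⊔ maximalIdeal P ^ (t + 1)) (b : ℕ) :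
    coeff b (geom 1 ^ X.length) +
        colength (J ⊔ maximalIdeal P ^ (b + t + 1) ⊔ Ideal.span {u} * maximalIdeal P ^ b) ≤
      colength (J ⊔ maximalIdeal P ^ (b + t + 1)) := by
  induction X generalizing J t u b with
  | nil =>
    rw [List.length_nil, pow_zero, coeff_one]
    split_ifs with hb
    · subst hb
      have hlt : J ⊔ maximalIdeal P ^ (0 + t + 1) <
          J ⊔ maximalIdeal P ^ (0 + t + 1) ⊔ Ideal.span {u} * maximalIdeal P ^ 0 := by
        refine SetLike.lt_iff_le_and_exists.2 ⟨le_sup_left, u, Ideal.mem_sup_right ?_, ?_⟩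
        · simp [Ideal.mem_span_singleton_self u]
        · rwa [zero_add]
      have := colength_strictMono le_sup_right hlt
      omega
    · have := colength_mono (le_sup_right : maximalIdeal P ^ (b + t + 1) ≤
        J ⊔ maximalIdeal P ^ (b + t + 1))
          (le_sup_left : _ ≤ _ ⊔ Ideal.span {u} * maximalIdeal P ^ b)
      omega
  | cons p X ih =>
    obtain ⟨x, s⟩ := p
    obtain rfl : s = 1 := hX (x, s) List.mem_cons_self
    obtain ⟨⟨hx, -⟩, hO'⟩ := HasOrders.cons.1 hO
    obtain ⟨hxs, hs'⟩ := hs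
    have hX' : ∀ p ∈ X, p.2 = 1 := fun p hp => hX p (List.mem_cons_of_mem _ hp)
    simp only [pow_one] at hx hxs hs'
    have hcolon : ∀ n, colonElem (J ⊔ maximalIdeal P ^ (n + 1)) x = J ⊔ maximalIdeal P ^ n :=
      fun n => le_antisymm (fun z hz => hxs n z hz)
        (sup_pow_le_colonElem J (by rwa [pow_one]) n)
    -- If `u` stays nonzero in the same degree modulo `x`, induct on the degree `b`.
    have hmain : ∀ t u, u ∈ maximalIdeal P ^ t → u ∉ J ⊔ Ideal.span {x} ⊔ maximalIdeal P ^ (t + 1) →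
        ∀ b, coeff b (geom 1 ^ (X.length + 1)) +
          colength (J ⊔ maximalIdeal P ^ (b + t + 1) ⊔ Ideal.span {u} * maximalIdeal P ^ b) ≤
            colength (J ⊔ maximalIdeal P ^ (b + t + 1)) := by
      intro t u hu hu' b
      have h2 : ∀ b, _ := fun b =>
        colength_eq_add (le_sup_right : _ ≤ J ⊔ maximalIdeal P ^ (b + t + 1)) x
      have h3 : ∀ b, _ := fun b => colength_eq_add (le_sup_right.trans le_sup_left :
        _ ≤ J ⊔ maximalIdeal P ^ (b + t + 1) ⊔ Ideal.span {u} * maximalIdeal P ^ b) x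
      have e3 : ∀ b, J ⊔ maximalIdeal P ^ (b + t + 1) ⊔ Ideal.span {u} * maximalIdeal P ^ b ⊔
          Ideal.span {x} = J ⊔ Ideal.span {x} ⊔ maximalIdeal P ^ (b + t + 1) ⊔
            Ideal.span {u} * maximalIdeal P ^ b := fun b => by ac_rfl
      simp only [hcolon, sup_right_comm J _ (Ideal.span {x})] at h2
      simp only [e3] at h3
      induction b with
      | zero =>
        have h1 := ih hX' hO' hs' hu hu' 0
        have hle : J ⊔ maximalIdeal P ^ (0 + t) ≤ colonElem (J ⊔ maximalIdeal P ^ (0 + t + 1) ⊔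
            Ideal.span {u} * maximalIdeal P ^ 0) x := by
          rw [← hcolon]
          exact Submodule.comap_mono le_sup_left
        have h5 := colength_mono le_sup_right hle
        have h4 := coeff_geom_one_pow_succ X.length 0
        rw [if_neg (by omega)] at h4
        have h2 := h2 0
        have h3 := h3 0
        omega
      | succ b ihb =>
        have h1 := ih hX' hO' hs' hu hu' (b + 1)
        have hle : J ⊔ maximalIdeal P ^ (b + t + 1) ⊔ Ideal.span {u} * maximalIdeal P ^ b ≤
            colonElem (J ⊔ maximalIdeal P ^ (b + 1 + t + 1) ⊔
              Ideal.span {u} * maximalIdeal P ^ (b + 1)) x := by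
          have hu1 : Ideal.span {u} * maximalIdeal P ^ (b + 1) =
              maximalIdeal P * (Ideal.span {u} * maximalIdeal P ^ b) := by
            rw [pow_succ', mul_left_comm]
          refine sup_le ?_ fun z hz => ?_
          · rw [show b + t + 1 = b + 1 + t by omega, ← hcolon]
            exact Submodule.comap_mono le_sup_left
          · rw [mem_colonElem, hu1]
            exact Ideal.mem_sup_right (Ideal.mul_mem_mul hx hz)
        have h5 := colength_mono (le_sup_right.trans le_sup_left :
          maximalIdeal P ^ (b + t + 1) ≤ _) hle
        have h2 := h2 (b + 1)
        have h3 := h3 (b + 1)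
        have h4 := coeff_geom_one_pow_succ X.length (b + 1)
        rw [if_pos (by omega), Nat.add_sub_cancel] at h4
        simp only [show b + 1 + t = b + t + 1 by omega] at h1 h2 h3 h5 ⊢
        omega
    -- Otherwise `u` is, in its degree, a multiple of `x`; as `x` is strict, divide by it.
    induction t generalizing u b with
    | zero =>
      refine hmain 0 u hu (fun h => hu' ?_) b
      have hx1 : Ideal.span {x} ≤ maximalIdeal P ^ (0 + 1) := by
        rwa [Ideal.span_singleton_le_iff_mem, zero_add, pow_one]
      rwa [sup_assoc, sup_eq_right.2 hx1] at h
    | succ t iht =>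
      by_cases hux : u ∈ J ⊔ Ideal.span {x} ⊔ maximalIdeal P ^ (t + 1 + 1)
      · rw [sup_right_comm] at hux
        obtain ⟨a, ha, v, hv, rfl⟩ := Submodule.mem_sup.1 hux
        obtain ⟨u₀, rfl⟩ := Ideal.mem_span_singleton.1 hv
        have h1 : x * u₀ ∈ J ⊔ maximalIdeal P ^ (t + 1) := by
          have := sub_mem (Ideal.mem_sup_right hu : _ ∈ J ⊔ _)
            ((sup_le_sup_left (Ideal.pow_le_pow_right (by omega)) _ : _ ≤ J ⊔ _) ha)
          rwa [add_sub_cancel_left] at this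
        obtain ⟨j, hj, u', hu'', rfl⟩ := Submodule.mem_sup.1 (hxs _ _ h1)
        have hsub : a + x * j ∈ J ⊔ maximalIdeal P ^ (t + 1 + 1) :=
          add_mem ha (Ideal.mem_sup_left (J.mul_mem_left _ hj))
        have hu₁ : u' ∉ J ⊔ maximalIdeal P ^ (t + 1) := fun h => hu' (by
          have e : a + x * (j + u') = (a + x * j) + x * u' := by ring
          rw [e]
          exact add_mem hsub (mul_mem_sup_pow (by rwa [pow_one]) h))
        have h2 := iht hu'' hu₁ b
        have h3 := colength_eq_add (le_sup_right : _ ≤ J ⊔ maximalIdeal P ^ (b + (t + 1) + 1)) x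
        have h4 := colength_eq_add (le_sup_right.trans le_sup_left :
          _ ≤ J ⊔ maximalIdeal P ^ (b + (t + 1) + 1) ⊔
            Ideal.span {a + x * (j + u')} * maximalIdeal P ^ b) x
        rw [hcolon] at h3
        have h5 := colength_mono (le_sup_right.trans le_sup_left :
            maximalIdeal P ^ (b + (t + 1) + 1) ≤
              J ⊔ maximalIdeal P ^ (b + (t + 1) + 1) ⊔ Ideal.span {x})
          (sup_le_sup_right le_sup_left (Ideal.span {x}) : _ ≤ J ⊔
            maximalIdeal P ^ (b + (t + 1) + 1) ⊔
              Ideal.span {a + x * (j + u')} * maximalIdeal P ^ b ⊔ Ideal.span {x})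
        have hle : J ⊔ maximalIdeal P ^ (b + t + 1) ⊔ Ideal.span {u'} * maximalIdeal P ^ b ≤
            colonElem (J ⊔ maximalIdeal P ^ (b + (t + 1) + 1) ⊔
              Ideal.span {a + x * (j + u')} * maximalIdeal P ^ b) x := by
          refine sup_le ?_ fun z hz => ?_
          · rw [show b + t + 1 = b + (t + 1) by omega, ← hcolon]
            exact Submodule.comap_mono le_sup_left
          · obtain ⟨c, hc, rfl⟩ := Ideal.mem_span_singleton_mul.1 hz
            have e : x * (u' * c) = (a + x * (j + u')) * c - c * (a + x * j) := by ring
            rw [mem_colonElem, e]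
            refine sub_mem (Ideal.mem_sup_right (Ideal.mul_mem_mul
              (Ideal.mem_span_singleton_self _) hc)) (Ideal.mem_sup_left ?_)
            have := mul_mem_sup_pow hc hsub
            rwa [show t + 1 + 1 + b = b + (t + 1) + 1 by omega] at this
        have h6 := colength_mono (le_sup_right.trans le_sup_left :
          maximalIdeal P ^ (b + t + 1) ≤ _) hle
        rw [List.length_cons] at h2 ⊢
        rw [show b + (t + 1) = b + t + 1 by omega] at *
        omega
      · exact hmain (t + 1) u hu hux b

/-- If `g` is not strict modulo `J`, the defect grows as fast as the dimension allows. -/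
theorem defectSeries_sub_nonneg {X : List (P × ℕ)} (hX : ∀ p ∈ X, p.2 = 1)
    (hO : HasOrders X) {J : Ideal P} (hs : StrictSeq J X) {g : P} {s : ℕ}
    (hg : g ∈ maximalIdeal P ^ s) (hgs : ¬ IsStrict J g s) :
    ∃ t, IsNonneg (defectSeries J g s - PowerSeries.X ^ t * geom 1 ^ X.length) := by
  obtain ⟨t, u, hu, hu', hgu⟩ := exists_of_not_isStrict hgs
  refine ⟨t + 1 + s, fun n => ?_⟩
  rw [map_sub, coeff_X_pow_mul']
  split_ifs with hn
  · obtain ⟨b, rfl⟩ := Nat.exists_eq_add_of_le' hn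
    rw [Nat.add_sub_cancel, defectSeries, coeff_mk, if_pos (by omega),
      show b + (t + 1 + s) - s = b + t + 1 by omega]
    have h1 := coeff_geom_one_pow_add_colength_le hX hO hs hu hu' b
    have hle : J ⊔ maximalIdeal P ^ (b + t + 1) ⊔ Ideal.span {u} * maximalIdeal P ^ b ≤
        colonElem (J ⊔ maximalIdeal P ^ (b + (t + 1 + s))) g := by
      refine sup_le ?_ fun z hz => ?_
      · have := sup_pow_le_colonElem J hg (b + t + 1)
        rwa [show b + t + 1 + s = b + (t + 1 + s) by omega] at this
      · obtain ⟨c, hc, rfl⟩ := Ideal.mem_span_singleton_mul.1 hz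
        have e : g * (u * c) = c * (g * u) := by ring
        rw [mem_colonElem, e]
        have := mul_mem_sup_pow hc hgu
        rwa [show t + 1 + s + b = b + (t + 1 + s) by omega] at this
    have h2 := colength_mono (le_sup_right.trans le_sup_left :
      maximalIdeal P ^ (b + t + 1) ≤ _) hle
    omega
  · rw [sub_zero]
    exact defectSeries_nonneg J hg n

end Growth

section Multiplicity

open PowerSeries

theorem geom_one_eq : geom 1 = PowerSeries.mk 1 := by
  ext n; simp [geom]

/-- A power series with a pole of order `d` at `1` does not dominate one with a pole of order
`d + 1`. -/
theorem not_isNonneg_sub (w : Polynomial ℤ) (t d : ℕ) :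
    ¬ IsNonneg ((w : PowerSeries ℤ) * geom 1 ^ d - X ^ t * geom 1 ^ (d + 1)) := by
  intro h
  rcases d with _ | d
  · have h1 := h (w.natDegree + 1 + t)
    rw [pow_zero, mul_one, map_sub, coeff_X_pow_mul', if_pos (by omega), Polynomial.coeff_coe,
      Polynomial.coeff_eq_zero_of_natDegree_lt (by omega), zero_add, pow_one, geom, coeff_mk,
      if_pos (one_dvd _)] at h1
    omega
  rw [geom_one_eq] at h
  let K : ℕ := ∑ i ∈ w.support, (w.coeff i).natAbs
  have hbound : ∀ n, coeff n ((w : PowerSeries ℤ) * (PowerSeries.mk 1 : PowerSeries ℤ) ^ (d + 1)) ≤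
      K * (d + n).choose d := by
    intro n
    have hw : (w : PowerSeries ℤ) = ∑ i ∈ w.support, PowerSeries.C (w.coeff i) * X ^ i := by
      ext m
      simp only [Polynomial.coeff_coe, map_sum, coeff_C_mul, coeff_X_pow]
      simp
    rw [hw, Finset.sum_mul, map_sum]
    push_cast [K]
    rw [Finset.sum_mul]
    refine Finset.sum_le_sum fun i _ => ?_
    rw [mul_assoc, coeff_C_mul, coeff_X_pow_mul', mk_one_pow_eq_mk_choose_add]
    split_ifs with hi
    · rw [coeff_mk]
      refine mul_le_mul (le_abs_self _) ?_ (by positivity) (by positivity)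
      exact_mod_cast Nat.choose_le_choose d (by omega)
    · rw [mul_zero]; positivity
  have h1 : ∀ N, (d + 1 + N).choose (d + 1) ≤ K * (d + (N + t)).choose d := by
    intro N
    have h2 := h (N + t)
    have h3 := hbound (N + t)
    rw [map_sub, coeff_X_pow_mul', if_pos (Nat.le_add_left _ _), Nat.add_sub_cancel,
      mk_one_pow_eq_mk_choose_add ℤ (d + 1), coeff_mk] at h2
    have h4 : ((d + 1 + N).choose (d + 1) : ℤ) ≤ K * (d + (N + t)).choose d := by omega
    exact_mod_cast h4
  let N := K * (d + 1) * (d + t + 1) ^ d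
  have h2 : (N + 1) ^ (d + 1) ≤ (d + 1 + N).choose (d + 1) * (d + 1).factorial := by
    have := Nat.pow_sub_le_descFactorial (d + 1 + N) (d + 1)
    rw [Nat.descFactorial_eq_factorial_mul_choose, mul_comm] at this
    rwa [show d + 1 + N + 1 - (d + 1) = N + 1 by omega] at this
  have h3 : (d + (N + t)).choose d * d.factorial ≤ (d + (N + t)) ^ d := by
    have := Nat.descFactorial_le_pow (d + (N + t)) d
    rwa [Nat.descFactorial_eq_factorial_mul_choose, mul_comm] at this
  have h4 : d + (N + t) ≤ (d + t + 1) * (N + 1) := by nlinarith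
  have h5 : (N + 1) ^ (d + 1) ≤ N * (N + 1) ^ d := by
    calc (N + 1) ^ (d + 1) ≤ (d + 1 + N).choose (d + 1) * (d + 1).factorial := h2
      _ ≤ K * (d + (N + t)).choose d * (d + 1).factorial := Nat.mul_le_mul_right _ (h1 N)
      _ = K * (d + 1) * ((d + (N + t)).choose d * d.factorial) := by
          rw [Nat.factorial_succ]; ring
      _ ≤ K * (d + 1) * ((d + t + 1) * (N + 1)) ^ d :=
          Nat.mul_le_mul_left _ (h3.trans (Nat.pow_le_pow_left h4 d))
      _ = N * (N + 1) ^ d := by rw [mul_pow]; ring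
  rw [pow_succ'] at h5
  have := Nat.le_of_mul_le_mul_right h5 (by positivity)
  omega

theorem one_add_X_mul_geom_two : (1 + X) * geom 2 = geom 1 := by
  have h1 := geom_mul one_pos
  have h2 := geom_mul two_pos
  linear_combination (geom 1) * h2 - (1 + X) * geom 2 * h1

theorem isNonneg_one_add_X_pow_sub_one (a : ℕ) :
    IsNonneg ((1 + X : PowerSeries ℤ) ^ a - 1) := by
  induction a with
  | zero => simpa using IsNonneg.zero
  | succ a ih =>
    have e : (1 + X : PowerSeries ℤ) ^ (a + 1) - 1 = ((1 + X) ^ a - 1) * (1 + X ^ 1) + X ^ 1 := by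
      ring
    rw [e]
    exact (ih.mul (IsNonneg.one.add (.X_pow 1))).add (.X_pow 1)

variable {P : Type*} [CommRing P] [IsLocalRing P]

omit [CommRing P] [IsLocalRing P] in
theorem geomProd_of_forall_eq_two {L : List (P × ℕ)} (h : ∀ p ∈ L, p.2 = 2) :
    geomProd L = geom 2 ^ L.length := by
  induction L with
  | nil => simp [geomProd]
  | cons p L ih =>
    have h1 := ih fun q hq => h q (List.mem_cons_of_mem _ hq)
    rw [geomProd] at h1 ⊢
    rw [List.map_cons, List.prod_cons, h1, h p (List.mem_cons_self), List.length_cons, pow_succ']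

/-- A sequence which is not strict has a first element which is not strict. -/
theorem exists_split_of_not_strictSeq {J : Ideal P} {L : List (P × ℕ)} (h : ¬ StrictSeq J L) :
    ∃ L₁ g L₂, L = L₁ ++ g :: L₂ ∧ StrictSeq J L₁ ∧ ¬ IsStrict (J ⊔ seqIdeal L₁) g.1 g.2 := by
  induction L generalizing J with
  | nil => exact absurd trivial h
  | cons p L ih =>
    by_cases hp : IsStrict J p.1 p.2
    · obtain ⟨L₁, g, L₂, rfl, h1, h2⟩ := ih fun h' => h ⟨hp, h'⟩
      exact ⟨p :: L₁, g, L₂, rfl, ⟨hp, h1⟩, by rwa [seqIdeal_cons, ← sup_assoc]⟩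
    · exact ⟨[], p, L, rfl, trivial, by simpa using hp⟩

variable [IsNoetherianRing P] [Infinite (ResidueField P)]

/-- The length series of a regular local ring of dimension `d` is that of a polynomial ring in `d`
variables. -/
theorem lengthSeries_bot {d : ℕ} (hd : ringKrullDim P = d)
    (hd' : (maximalIdeal P).spanFinrank = d) :
    lengthSeries (⊥ : Ideal P) = X * geom 1 ^ (d + 1) := by
  obtain ⟨Y, h1, h2, h3⟩ := extends_nil hd'
  rw [List.nil_append] at h1 h2 h3
  have hO : HasOrders Y := fun p hp => by
    rw [h1 p hp, pow_one, ← h3]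
    exact ⟨Ideal.subset_span (List.mem_map_of_mem hp), one_pos⟩
  have h4 := (strictSeq_iff_excess_eq_zero ⊥ hO).1
    (strictSeq_of_seqIdeal_eq (by rw [h2]; exact hd) h1 h3)
  rw [excess, bot_sup_eq, h3, lengthSeries_maximalIdeal, geomProd_of_forall_eq_one h1, h2] at h4
  linear_combination -h4

theorem StrictSeq.lengthSeries_eq {d : ℕ} (hd : ringKrullDim P = d)
    (hd' : (maximalIdeal P).spanFinrank = d) {G : List (P × ℕ)} (hO : HasOrders G)
    (hs : StrictSeq ⊥ G) : geomProd G * lengthSeries (seqIdeal G) = X * geom 1 ^ (d + 1) := by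
  have h := (strictSeq_iff_excess_eq_zero ⊥ hO).1 hs
  rw [excess, bot_sup_eq, lengthSeries_bot hd hd'] at h
  exact sub_eq_zero.1 h

/-- Elements of `𝔪²` whose quotient has the least possible multiplicity have leading forms of
degree two which are a regular sequence. If not, the excess has a pole of order `d + 1` at `z = 1`,
because the defect at the first element which is not strict grows as fast as possible; but the
multiplicity `2 ^ q` forces the poles of order `d + 1` to cancel. -/
theorem strictSeq_of_multiplicity {d : ℕ} (hd : ringKrullDim P = d)
    (hd' : (maximalIdeal P).spanFinrank = d) {G : List (P × ℕ)} (hO : HasOrders G)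
    (hG : ∀ p ∈ G, p.2 = 2) (hlen : G.length ≤ d) {h : Polynomial ℤ}
    (hh : lengthSeries (seqIdeal G) * (1 - X) ^ (d - G.length + 1) = X * (h : PowerSeries ℤ))
    (h1 : h.eval 1 = 2 ^ G.length) : StrictSeq ⊥ G := by
  by_contra hns
  obtain ⟨L₁, g, L₂, rfl, hs1, hg⟩ := exists_split_of_not_strictSeq hns
  obtain ⟨hO1, hO2⟩ := HasOrders.append.1 hO
  obtain ⟨⟨hgO, hgpos⟩, hO3⟩ := HasOrders.cons.1 hO2
  have hg2 : g.2 = 2 := hG g (by simp)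
  rw [bot_sup_eq] at hg
  simp only [List.length_append, List.length_cons] at hlen hh h1
  obtain ⟨Y, hY1, hY2, hYO, hYs⟩ := hs1.exists_append hd hd' hO1
    (m := d - L₁.length) (by omega)
  obtain ⟨t, ht⟩ := defectSeries_sub_nonneg hY2 (HasOrders.append.1 hYO).2
    (by simpa using (strictSeq_append.1 hYs).2) hgO hg
  have hq1 : geom 1 * (1 - X) = 1 := by simpa using geom_mul one_pos
  -- the multiplicity condition makes `h - (1 + z) ^ q` divisible by `1 - z`
  obtain ⟨w, hw⟩ : ∃ w : Polynomial ℤ,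
      h - (1 + Polynomial.X) ^ (L₁.length + (L₂.length + 1)) = (1 - Polynomial.X) * w := by
    have : (Polynomial.X - Polynomial.C 1) ∣
        h - (1 + Polynomial.X) ^ (L₁.length + (L₂.length + 1)) := by
      rw [Polynomial.dvd_iff_isRoot, Polynomial.IsRoot]
      simp [h1]
    obtain ⟨w, hw⟩ := this
    exact ⟨-w, by rw [hw, Polynomial.C_1]; ring⟩
  have hw' : (h : PowerSeries ℤ) - (1 + X) ^ (L₁.length + (L₂.length + 1)) =
      (1 - X) * (w : PowerSeries ℤ) := by
    have := congrArg (fun f : Polynomial ℤ => (f : PowerSeries ℤ)) hw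
    simpa using this
  -- the lower bound for the excess
  have hE := excess_append ⊥ L₁ (g :: L₂)
  rw [(strictSeq_iff_excess_eq_zero ⊥ hO1).1 hs1, add_zero, bot_sup_eq,
    excess_cons _ g L₂ hgO hgpos, hg2] at hE
  have hG1 := geomProd_of_forall_eq_two (L := L₁) fun p hp => hG p (by simp [hp])
  have hG2 := geomProd_of_forall_eq_two hG
  simp only [List.length_append, List.length_cons] at hG2
  have hE' := excess_nonneg (seqIdeal L₁ ⊔ Ideal.span {g.1}) hO3
  rw [hg2, hY1] at ht
  obtain ⟨m, hm⟩ := Nat.exists_eq_add_of_le hlen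
  rw [show d - (L₁.length + (L₂.length + 1)) + 1 = m + 1 by omega] at hh
  rw [show d - L₁.length = L₂.length + 1 + m by omega] at ht
  have h2 : ((1 + X) * geom 2) ^ (L₁.length + 1) = geom 1 ^ (L₁.length + 1) := by
    rw [one_add_X_mul_geom_two]
  have h3 : ((1 + X) * geom 2) ^ (L₁.length + (L₂.length + 1)) =
      geom 1 ^ (L₁.length + (L₂.length + 1)) := by
    rw [one_add_X_mul_geom_two]
  set D := defectSeries (seqIdeal L₁) g.1 2
  set E' := excess (seqIdeal L₁ ⊔ Ideal.span {g.1}) L₂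
  set Λ := lengthSeries (seqIdeal (L₁ ++ g :: L₂))
  have hpos := (((geom_nonneg 1).pow (L₁.length + 1)).mul
    ((((IsNonneg.one.add (.X_pow 1)).pow L₂.length).mul (ht.add hE')).add
      ((isNonneg_one_add_X_pow_sub_one L₂.length).mul
        ((IsNonneg.X_pow t).mul ((geom_nonneg 1).pow (L₂.length + 1 + m))))))
  -- the value of the excess given by the multiplicity
  have hΛ : Λ = X * (h : PowerSeries ℤ) * geom 1 ^ (m + 1) := by
    have : (geom 1 * (1 - X)) ^ (m + 1) = 1 := by rw [hq1, one_pow]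
    rw [mul_pow] at this
    linear_combination geom 1 ^ (m + 1) * hh - Λ * this
  rw [excess, hG1, hG2, bot_sup_eq, lengthSeries_bot hd hd'] at hE
  refine not_isNonneg_sub (Polynomial.X * w) t d ?_
  convert hpos using 1
  rw [Polynomial.coe_mul, Polynomial.coe_X, pow_one]
  have key : X * (w : PowerSeries ℤ) * geom 1 ^ d =
      (1 + X) ^ (L₁.length + (L₂.length + 1)) * (geom 2 ^ (L₁.length + (L₂.length + 1)) * Λ -
        X * geom 1 ^ (d + 1)) := by
    rw [hΛ, hm, mul_sub, ← mul_assoc, ← mul_pow, h3]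
    linear_combination (-X * geom 1 ^ (L₁.length + (L₂.length + 1) + m + 1)) * hw' -
      X * w * geom 1 ^ (L₁.length + (L₂.length + 1) + m) * hq1
  rw [key, hE, hm]
  rw [mul_pow] at h2
  linear_combination (1 + X) ^ L₂.length * (D + E') * h2

end Multiplicity

/-! ### The Hilbert series of a quotient -/

section Hilbert

variable {R : Type*} [CommRing R]

theorem length_grPiece_add (I : Ideal R) (j : ℕ) :
    Module.length R (R ⧸ I ^ (j + 1)) =
      Module.length R (GrPiece I j) + Module.length R (R ⧸ I ^ j) := by
  have hle : (I • ⊤ : Submodule R ↥(I ^ j)) ≤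
      Submodule.comap (I ^ j).subtype (I ^ (j + 1)) := by
    intro x hx
    rw [Submodule.mem_smul_top_iff] at hx
    rw [pow_succ']
    exact hx
  change _ = Module.length R (↥(I ^ j) ⧸ (I • ⊤ : Submodule R ↥(I ^ j))) + _
  refine Module.length_eq_add_of_exact (Submodule.mapQ _ (I ^ (j + 1)) (I ^ j).subtype hle)
    (Submodule.factor (Ideal.pow_le_pow_right (Nat.le_succ j))) ?_
    (Submodule.factor_surjective _) ?_
  · rw [← LinearMap.ker_eq_bot, Submodule.ker_mapQ, ← le_bot_iff, Submodule.map_le_iff_le_comap]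
    intro z hz
    refine (Submodule.Quotient.mk_eq_zero _).2 ?_
    rw [Submodule.mem_smul_top_iff]
    rw [pow_succ'] at hz
    exact hz
  · intro w
    obtain ⟨w, rfl⟩ := Submodule.Quotient.mk_surjective _ w
    constructor
    · intro h
      have h : w ∈ I ^ j := (Submodule.Quotient.mk_eq_zero _).1 h
      exact ⟨GrPiece.mk j w h, rfl⟩
    · rintro ⟨z, hz⟩
      induction z using GrPiece.ind with | h x hx => ?_
      rw [← hz]
      exact (Submodule.Quotient.mk_eq_zero _).2 hx

variable [IsLocalRing R]

instance isScalarTower_grPiece (I : Ideal R) (j : ℕ) : IsScalarTower R (R ⧸ I) (GrPiece I j) :=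
  inferInstanceAs (IsScalarTower R (R ⧸ I) (↥(I ^ j) ⧸ (I • ⊤ : Submodule R ↥(I ^ j))))

open PowerSeries in
theorem coeff_localHilbertSeries [IsNoetherianRing R] (j : ℕ) :
    coeff j (localHilbertSeries R) =
      colength (maximalIdeal R ^ (j + 1)) - colength (maximalIdeal R ^ j) := by
  have h1 := length_grPiece_add (maximalIdeal R) j
  have h2 : Module.length R (GrPiece (maximalIdeal R) j) =
      Module.length (R ⧸ maximalIdeal R) (GrPiece (maximalIdeal R) j) :=
    Module.length_eq_of_surjective (Ideal.Quotient.mk_surjective)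
  let : Field (R ⧸ maximalIdeal R) := Ideal.Quotient.field _
  have : Module.Finite R (GrPiece (maximalIdeal R) j) :=
    inferInstanceAs (Module.Finite R
      (↥(maximalIdeal R ^ j) ⧸ (maximalIdeal R • ⊤ : Submodule R ↥(maximalIdeal R ^ j))))
  have : Module.Finite (R ⧸ maximalIdeal R) (GrPiece (maximalIdeal R) j) :=
    Module.Finite.of_restrictScalars_finite R _ _
  have h3 : Module.length (R ⧸ maximalIdeal R) (GrPiece (maximalIdeal R) j) =
    Module.finrank (R ⧸ maximalIdeal R) (GrPiece (maximalIdeal R) j) := Module.length_eq_finrank _ _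
  rw [h2, h3] at h1
  have h4 := length_quotient_ne_top (le_rfl : maximalIdeal R ^ j ≤ _)
  rw [localHilbertSeries, coeff_mk, colength, colength, h1, ENat.toNat_add (by simp) h4]
  simp

end Hilbert

section Quotient

variable {P : Type*} [CommRing P]

theorem colength_map_mk (J K : Ideal P) :
    colength (K.map (Ideal.Quotient.mk J)) = colength (J ⊔ K) := by
  rw [colength, colength]
  congr 1
  rw [← Module.length_eq_of_surjective (S := P) (R := P ⧸ J) Ideal.Quotient.mk_surjective]
  exact LinearEquiv.length_eq (DoubleQuot.quotQuotEquivQuotSupₐ P J K).toLinearEquiv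

variable [IsLocalRing P]

theorem maximalIdeal_quotient (J : Ideal P) [IsLocalRing (P ⧸ J)] :
    maximalIdeal (P ⧸ J) = (maximalIdeal P).map (Ideal.Quotient.mk J) := by
  have := IsLocalHom.of_surjective (Ideal.Quotient.mk J) Ideal.Quotient.mk_surjective
  exact (map_maximalIdeal_of_surjective _ Ideal.Quotient.mk_surjective).symm

variable [IsNoetherianRing P]

open PowerSeries in
/-- The Hilbert series of `P / J` in terms of the length series of `J`; the shift by one degree
arises because the coefficient of `zⁿ` in the length series measures `P / (J + 𝔪ⁿ)`. -/
theorem X_mul_localHilbertSeries_quotient (J : Ideal P) [IsLocalRing (P ⧸ J)] :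
    X * localHilbertSeries (P ⧸ J) = (1 - X) * lengthSeries J := by
  ext n
  rw [← pow_one (X : PowerSeries ℤ), sub_mul, one_mul, map_sub, coeff_X_pow_mul', coeff_X_pow_mul']
  rcases n with _ | n
  · simp [lengthSeries, colength_top]
  · rw [if_pos (by omega), if_pos (by omega), Nat.add_sub_cancel, coeff_localHilbertSeries]
    simp only [maximalIdeal_quotient, ← Ideal.map_pow, colength_map_mk, lengthSeries, coeff_mk]

/-- Dividing by an ideal inside the square of the maximal ideal does not change the embedding
dimension. -/
theorem spanFinrank_maximalIdeal_quotient {J : Ideal P} [IsLocalRing (P ⧸ J)]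
    (hJ : J ≤ maximalIdeal P ^ 2) :
    (maximalIdeal (P ⧸ J)).spanFinrank = (maximalIdeal P).spanFinrank := by
  refine le_antisymm ?_ ?_
  · rw [maximalIdeal_quotient]
    exact Ideal.spanFinrank_map_le_of_fg _ (IsNoetherian.noetherian _)
  · obtain ⟨s, hs, hs'⟩ := Submodule.FG.exists_span_finset_card_eq_spanFinrank
      (IsNoetherian.noetherian (maximalIdeal (P ⧸ J)))
    classical
    let t : Finset P := s.image Quotient.out
    have ht : (Ideal.span (t : Set P)).map (Ideal.Quotient.mk J) = maximalIdeal (P ⧸ J) := by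
      rw [Ideal.map_span, ← hs']
      congr 1
      rw [Finset.coe_image, Set.image_image]
      refine (Set.image_congr fun x _ => Quotient.out_eq x).trans (Set.image_id' _)
    rw [maximalIdeal_quotient] at ht
    have h1 := congrArg (Ideal.comap (Ideal.Quotient.mk J)) ht
    rw [Ideal.comap_map_of_surjective' _ Ideal.Quotient.mk_surjective,
      Ideal.comap_map_of_surjective' _ Ideal.Quotient.mk_surjective, Ideal.mk_ker] at h1
    have hJ1 : J ≤ maximalIdeal P := hJ.trans (Ideal.pow_le_self two_ne_zero)
    rw [sup_eq_left.2 hJ1] at h1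
    have h2 : maximalIdeal P ≤ Ideal.span (t : Set P) := by
      refine Submodule.le_of_le_smul_of_le_jacobson_bot (IsNoetherian.noetherian _)
        (maximalIdeal_le_jacobson _) ?_
      conv_lhs => rw [← h1]
      rw [Ideal.smul_eq_mul, ← pow_two]
      exact sup_le_sup_left hJ _
    have h3 : Ideal.span (t : Set P) = maximalIdeal P :=
      le_antisymm (le_sup_left.trans h1.le) h2
    rw [← h3, ← hs]
    refine (Submodule.spanFinrank_span_le_ncard_of_finite t.finite_toSet).trans ?_
    rw [Set.ncard_coe_finset]
    exact Finset.card_image_le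

variable [Infinite (ResidueField P)]

open PowerSeries in
/-- A quotient of `P` by a regular sequence of elements of `𝔪²` has minimal multiplicity if and only
if the elements have degree-two leading forms which are a regular sequence. -/
theorem exists_hasMultiplicity_iff_strictSeq {d : ℕ} (hd : ringKrullDim P = d)
    (hd' : (maximalIdeal P).spanFinrank = d) {G : List (P × ℕ)} (hO : HasOrders G)
    (hG : ∀ p ∈ G, p.2 = 2) (hreg : RingTheory.Sequence.IsRegular P (G.map Prod.fst))
    [IsLocalRing (P ⧸ seqIdeal G)] :
    (∃ c, HasCodim (P ⧸ seqIdeal G) c ∧ HasMultiplicity (P ⧸ seqIdeal G) (2 ^ c)) ↔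
      StrictSeq ⊥ G := by
  have hdim := ringKrullDim_add_length_eq_ringKrullDim_of_isRegular _ hreg
  rw [List.length_map, hd] at hdim
  change ringKrullDim (P ⧸ seqIdeal G) + _ = _ at hdim
  have hJ : seqIdeal G ≤ maximalIdeal P ^ 2 := by
    refine Ideal.span_le.2 fun x hx => ?_
    obtain ⟨p, hp, rfl⟩ := List.mem_map.1 hx
    rw [← hG p hp]
    exact (hO p hp).1
  have hcodim := spanFinrank_maximalIdeal_quotient hJ
  obtain ⟨e, he⟩ : ∃ e : ℕ, ringKrullDim (P ⧸ seqIdeal G) = e := by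
    have h1 := ringKrullDim_ne_bot (R := P ⧸ seqIdeal G)
    obtain ⟨e, he⟩ := WithBot.ne_bot_iff_exists.1 h1
    rw [← he] at hdim ⊢
    cases e with
    | top =>
      have h2 : (⊤ : ℕ∞) + G.length = d := by exact_mod_cast hdim
      rw [top_add] at h2
      exact absurd h2.symm (ENat.natCast_ne_top d)
    | coe e => exact ⟨e, rfl⟩
  rw [he] at hdim
  have hlen : e + G.length = d := by exact_mod_cast hdim
  have hX := X_mul_localHilbertSeries_quotient (seqIdeal G)
  have hX0 : (X : PowerSeries ℤ) ≠ 0 := X_ne_zero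
  constructor
  · rintro ⟨c, hc, d', h, hd'', hh, h1⟩
    rw [HasCodim, he, hcodim, hd'] at hc
    have hc : e + c = d := by exact_mod_cast hc
    obtain rfl : c = G.length := by omega
    obtain rfl : d' = e := by rw [he] at hd''; exact_mod_cast hd''.symm
    refine strictSeq_of_multiplicity hd hd' hO hG (by omega) (h := h) ?_ h1
    rw [show d - G.length = d' by omega, ← hh]
    linear_combination (-(1 - X) ^ d') * hX
  · intro hs
    refine ⟨G.length, ?_, e, (1 + Polynomial.X) ^ G.length, he, ?_, by norm_num⟩
    · rw [HasCodim, he, hcodim, hd']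
      exact hdim
    · have h1 := hs.lengthSeries_eq hd hd' hO
      rw [geomProd_of_forall_eq_two hG] at h1
      refine mul_left_cancel₀ hX0 ?_
      have h2 : (geom 1 * (1 - X)) ^ (e + 1) = 1 := by
        rw [show geom 1 * (1 - X) = 1 by simpa using geom_mul one_pos, one_pow]
      have h3 : (geom 2 * (1 - X ^ 2)) ^ G.length = 1 := by rw [geom_mul two_pos, one_pow]
      have h4 : (geom 1 * (1 - X)) ^ G.length = 1 := by
        rw [show geom 1 * (1 - X) = 1 by simpa using geom_mul one_pos, one_pow]
      have h5 : (1 - X ^ 2 : PowerSeries ℤ) ^ G.length =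
          (1 - X) ^ G.length * (1 + X) ^ G.length := by
        rw [← mul_pow]; ring
      rw [mul_pow] at h2 h3 h4
      have h6 : X * localHilbertSeries (P ⧸ seqIdeal G) * (1 - X) ^ e =
          (1 - X) ^ (e + 1) * lengthSeries (seqIdeal G) := by
        linear_combination (1 - X) ^ e * hX
      rw [show ((((1 + Polynomial.X) ^ G.length : Polynomial ℤ)) : PowerSeries ℤ) =
        (1 + X) ^ G.length by simp, ← mul_assoc, h6]
      rw [← hlen, show e + G.length + 1 = (e + 1) + G.length by omega, pow_add] at h1
      calc (1 - X) ^ (e + 1) * lengthSeries (seqIdeal G)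
          = (1 - X) ^ (e + 1) * (1 - X ^ 2) ^ G.length *
            (geom 2 ^ G.length * lengthSeries (seqIdeal G)) := by
              linear_combination (-(1 - X) ^ (e + 1) * lengthSeries (seqIdeal G)) * h3
        _ = X * (1 + X) ^ G.length := by
              rw [h1, h5]
              linear_combination X * (1 + X) ^ G.length *
                (h2 + geom 1 ^ (e + 1) * (1 - X) ^ (e + 1) * h4)

end Quotient

/-! ### A numerical criterion for strictness in terms of leading forms -/

section Criterion

open PowerSeries

variable {P : Type*} [CommRing P]

/-- Additivity of length along `0 → P / (A ∩ B) → P / A × P / B → P / (A + B) → 0`. -/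
theorem length_quotient_inf_add (A B : Ideal P) :
    Module.length P (P ⧸ A) + Module.length P (P ⧸ B) =
      Module.length P (P ⧸ (A ⊓ B)) + Module.length P (P ⧸ (A ⊔ B)) := by
  rw [← Module.length_prod]
  refine Module.length_eq_add_of_exact
    (LinearMap.prod (Submodule.factor (inf_le_left : A ⊓ B ≤ A))
      (Submodule.factor (inf_le_right : A ⊓ B ≤ B)))
    ((Submodule.factor (le_sup_left : A ≤ A ⊔ B)).coprod
      (-(Submodule.factor (le_sup_right : B ≤ A ⊔ B)))) ?_ ?_ ?_
  · refine (injective_iff_map_eq_zero _).2 fun w hw => ?_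
    obtain ⟨w, rfl⟩ := Submodule.Quotient.mk_surjective _ w
    obtain ⟨h1, h2⟩ := Prod.mk.inj hw
    exact (Submodule.Quotient.mk_eq_zero _).2
      ⟨(Submodule.Quotient.mk_eq_zero _).1 h1, (Submodule.Quotient.mk_eq_zero _).1 h2⟩
  · intro w
    obtain ⟨w, rfl⟩ := Submodule.factor_surjective (le_sup_left : A ≤ A ⊔ B) w
    exact ⟨(w, 0), by simp⟩
  · rintro ⟨v, w⟩
    obtain ⟨v, rfl⟩ := Submodule.Quotient.mk_surjective _ v
    obtain ⟨w, rfl⟩ := Submodule.Quotient.mk_surjective _ w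
    constructor
    · intro h
      have h : v - w ∈ A ⊔ B := by
        refine (Submodule.Quotient.mk_eq_zero _).1 ?_
        rw [Submodule.Quotient.mk_sub, sub_eq_add_neg]
        exact h
      obtain ⟨a, ha, b, hb, hab⟩ := Submodule.mem_sup.1 h
      refine ⟨Submodule.Quotient.mk (v - a), Prod.ext ?_ ?_⟩
      · refine (Submodule.Quotient.eq _).2 ?_
        simpa using ha
      · refine (Submodule.Quotient.eq _).2 ?_
        have e : v - a - w = b := by rw [sub_right_comm, ← hab, add_sub_cancel_left]
        exact e ▸ hb
    · rintro ⟨z, hz⟩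
      obtain ⟨z, rfl⟩ := Submodule.Quotient.mk_surjective _ z
      obtain ⟨h1, h2⟩ := Prod.mk.inj hz
      rw [← h1, ← h2]
      simp only [LinearMap.coprod_apply, LinearMap.neg_apply]
      exact add_neg_cancel _

variable [IsLocalRing P] [IsNoetherianRing P]

theorem colength_inf_add {A B : Ideal P} {m : ℕ} (hA : maximalIdeal P ^ m ≤ A)
    (hB : maximalIdeal P ^ m ≤ B) :
    colength A + colength B = colength (A ⊓ B) + colength (A ⊔ B) := by
  have h := length_quotient_inf_add A B
  have h1 := length_quotient_ne_top hA
  have h2 := length_quotient_ne_top hB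
  have h3 := length_quotient_ne_top (le_inf hA hB)
  have h4 := length_quotient_ne_top (hA.trans (le_sup_left : A ≤ A ⊔ B))
  simp only [colength]
  rw [← ENat.toNat_add h1 h2, h, ENat.toNat_add h3 h4]

/-- The component of degree `n` of the associated graded ring of `P / (L)` is a quotient of `𝔪ⁿ`
modulo `𝔪ⁿ⁺¹` and the leading forms of the elements of `L`; here in terms of colengths. -/
theorem colength_add_leadingIdeal {L : List (P × ℕ)} (hL : HasOrders L) (n : ℕ) :
    colength (seqIdeal L ⊔ maximalIdeal P ^ (n + 1)) + colength (maximalIdeal P ^ n) ≤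
      colength (leadingIdeal L n ⊔ maximalIdeal P ^ (n + 1)) +
        colength (seqIdeal L ⊔ maximalIdeal P ^ n) := by
  have hn : maximalIdeal P ^ (n + 1) ≤ maximalIdeal P ^ n := Ideal.pow_le_pow_right (Nat.le_succ n)
  have h := colength_inf_add (A := maximalIdeal P ^ n) (B := seqIdeal L ⊔ maximalIdeal P ^ (n + 1))
    hn le_sup_right
  rw [sup_left_comm, sup_eq_left.2 hn] at h
  have h1 := colength_mono (le_sup_right : _ ≤ leadingIdeal L n ⊔ maximalIdeal P ^ (n + 1))
    (le_inf (sup_le (leadingIdeal_le_pow hL n) hn)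
      (sup_le_sup_right (leadingIdeal_le_seqIdeal L n) _))
  omega

/-- For strict sequences there are no further relations: the inequality `colength_add_leadingIdeal`
is an equality. -/
theorem StrictSeq.colength_leadingIdeal_add {L : List (P × ℕ)} (hL : HasOrders L)
    (hs : StrictSeq ⊥ L) (n : ℕ) :
    colength (leadingIdeal L n ⊔ maximalIdeal P ^ (n + 1)) +
        colength (seqIdeal L ⊔ maximalIdeal P ^ n) =
      colength (seqIdeal L ⊔ maximalIdeal P ^ (n + 1)) + colength (maximalIdeal P ^ n) := by
  refine le_antisymm ?_ (colength_add_leadingIdeal hL n)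
  have hn : maximalIdeal P ^ (n + 1) ≤ maximalIdeal P ^ n := Ideal.pow_le_pow_right (Nat.le_succ n)
  have h := colength_inf_add (A := maximalIdeal P ^ n) (B := seqIdeal L ⊔ maximalIdeal P ^ (n + 1))
    hn le_sup_right
  rw [sup_left_comm, sup_eq_left.2 hn] at h
  have h1 := colength_mono (le_inf hn le_sup_right : maximalIdeal P ^ (n + 1) ≤
      maximalIdeal P ^ n ⊓ (seqIdeal L ⊔ maximalIdeal P ^ (n + 1)))
    (show maximalIdeal P ^ n ⊓ (seqIdeal L ⊔ maximalIdeal P ^ (n + 1)) ≤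
      leadingIdeal L n ⊔ maximalIdeal P ^ (n + 1) by
    rintro e ⟨he, he'⟩
    obtain ⟨y, hy, m, hm, rfl⟩ := Submodule.mem_sup.1 he'
    have hy' : y ∈ maximalIdeal P ^ n := by
      have := sub_mem he (hn hm)
      rwa [add_sub_cancel_right] at this
    refine add_mem (Ideal.mem_sup_left ?_) (Ideal.mem_sup_right hm)
    have := hs.inf_le hL n ⟨Ideal.mem_sup_right hy, Ideal.mem_sup_right hy'⟩
    rwa [bot_sup_eq] at this)
  omega

omit [IsNoetherianRing P] in
theorem coeff_one_sub_X_mul_lengthSeries (J : Ideal P) (n : ℕ) :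
    coeff (n + 1) ((1 - X : PowerSeries ℤ) * lengthSeries J) =
      (colength (J ⊔ maximalIdeal P ^ (n + 1)) : ℤ) - colength (J ⊔ maximalIdeal P ^ n) := by
  rw [← pow_one (X : PowerSeries ℤ), sub_mul, one_mul, map_sub, coeff_X_pow_mul',
    if_pos (by omega), Nat.add_sub_cancel]
  simp [lengthSeries]

theorem coeff_X_mul_one_add_X_pow (q n : ℕ) :
    coeff (n + 1) (X * (1 + X) ^ q : PowerSeries ℤ) = q.choose n := by
  rw [coeff_succ_X_mul]
  have := Polynomial.coeff_one_add_X_pow ℤ q n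
  rw [← Polynomial.coeff_coe] at this
  simpa using this

variable [Infinite (ResidueField P)] {d : ℕ}

/-- A sequence of `q` elements of order two and `d - q` elements of order one, in a regular local
ring of dimension `d`, is strict if and only if its leading forms generate in each degree
a subspace of sufficiently large dimension. Only finitely many degrees matter, because the leading
forms then generate a primary ideal. -/
theorem strictSeq_iff_colength_leadingIdeal_le (hd : ringKrullDim P = d)
    (hd' : (maximalIdeal P).spanFinrank = d) {G X : List (P × ℕ)} (hO : HasOrders (G ++ X))
    (hG : ∀ p ∈ G, p.2 = 2) (hX : ∀ p ∈ X, p.2 = 1) (hlen : G.length + X.length = d) :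
    StrictSeq ⊥ (G ++ X) ↔ ∀ n ≤ G.length + 1,
      colength (leadingIdeal (G ++ X) n ⊔ maximalIdeal P ^ (n + 1)) ≤
        G.length.choose n + colength (maximalIdeal P ^ n) := by
  have hprod : geomProd (G ++ X) = geom 2 ^ G.length * geom 1 ^ X.length := by
    rw [← geomProd_of_forall_eq_two hG, ← geomProd_of_forall_eq_one hX]
    simp [geomProd]
  have hq1 : geom 1 * (1 - PowerSeries.X) = 1 := by simpa using geom_mul one_pos
  have h2 : ((1 + PowerSeries.X) * geom 2) ^ G.length = geom 1 ^ G.length := by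
    rw [one_add_X_mul_geom_two]
  rw [mul_pow] at h2
  have h3 : geomProd (G ++ X) * (1 + PowerSeries.X) ^ G.length = geom 1 ^ d := by
    rw [hprod, ← hlen, pow_add]
    linear_combination geom 1 ^ X.length * h2
  constructor
  · intro hs n _
    have h1 := hs.lengthSeries_eq hd hd' hO
    have h0 : IsUnit (geomProd (G ++ X)) := by
      rw [hprod]
      exact ((IsUnit.of_mul_eq_one _ (geom_mul two_pos)).pow _).mul
        ((IsUnit.of_mul_eq_one _ (geom_mul one_pos)).pow _)
    have h4 : (1 - PowerSeries.X) * lengthSeries (seqIdeal (G ++ X)) =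
        PowerSeries.X * (1 + PowerSeries.X) ^ G.length := by
      refine h0.mul_left_cancel ?_
      linear_combination (1 - PowerSeries.X) * h1 - PowerSeries.X * h3 +
        PowerSeries.X * geom 1 ^ d * hq1
    have h5 := congrArg (coeff (n + 1)) h4
    rw [coeff_one_sub_X_mul_lengthSeries, coeff_X_mul_one_add_X_pow] at h5
    have h6 := hs.colength_leadingIdeal_add hO n
    omega
  · intro h
    -- from degree `G.length + 1` on all forms are in the ideal of the leading forms
    have hge : ∀ n, G.length + 1 ≤ n →
        maximalIdeal P ^ n ≤ leadingIdeal (G ++ X) n ⊔ maximalIdeal P ^ (n + 1) := by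
      intro n hn
      induction n, hn using Nat.le_induction with
      | base =>
        have h1 := h _ le_rfl
        rw [Nat.choose_succ_self, zero_add] at h1
        have hle : leadingIdeal (G ++ X) (G.length + 1) ⊔ maximalIdeal P ^ (G.length + 1 + 1) ≤
            maximalIdeal P ^ (G.length + 1) :=
          sup_le (leadingIdeal_le_pow hO _) (Ideal.pow_le_pow_right (Nat.le_succ _))
        rcases hle.eq_or_lt with h2 | h2
        · exact h2.ge
        · exact absurd (colength_strictMono le_sup_right h2) (by omega)
      | succ n hn ih =>
        rw [pow_succ']
        refine (Ideal.mul_mono_right ih).trans ?_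
        rw [Ideal.mul_sup, ← pow_succ']
        exact sup_le_sup_right (maximalIdeal_mul_leadingIdeal_le _ n) _
    have hall : ∀ n, colength (leadingIdeal (G ++ X) n ⊔ maximalIdeal P ^ (n + 1)) ≤
        G.length.choose n + colength (maximalIdeal P ^ n) := by
      intro n
      rcases le_total n (G.length + 1) with hn | hn
      · exact h n hn
      · exact (colength_mono le_rfl (hge n hn)).trans (Nat.le_add_left _ _)
    have hδ : IsNonneg (PowerSeries.X * (1 + PowerSeries.X) ^ G.length -
        (1 - PowerSeries.X) * lengthSeries (seqIdeal (G ++ X))) := by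
      intro n
      rcases n with _ | n
      · simp [lengthSeries, colength_top]
      · rw [map_sub, coeff_one_sub_X_mul_lengthSeries, coeff_X_mul_one_add_X_pow]
        have h1 := hall n
        have h2 := colength_add_leadingIdeal hO n
        omega
    rw [strictSeq_iff_excess_eq_zero ⊥ hO]
    refine (excess_nonneg ⊥ hO).eq_zero_of_add_eq_zero
      (((geom_nonneg 1).mul (geomProd_nonneg (G ++ X))).mul hδ) ?_
    rw [excess, bot_sup_eq, lengthSeries_bot hd hd']
    linear_combination (geom 1 * PowerSeries.X) * h3 -
      geomProd (G ++ X) * lengthSeries (seqIdeal (G ++ X)) * hq1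

end Criterion

/-! ### Openness of strictness in affine families -/

section Openness

variable {P : Type*} [CommRing P] [IsLocalRing P]

instance moduleResidueFieldGrPiece (j : ℕ) :
    Module (ResidueField P) (GrPiece (maximalIdeal P) j) :=
  inferInstanceAs (Module (P ⧸ maximalIdeal P) (GrPiece (maximalIdeal P) j))

theorem residue_smul_mk {j : ℕ} (x y : P) (hy : y ∈ maximalIdeal P ^ j) :
    residue P x • GrPiece.mk j y hy = GrPiece.mk j (x * y) (Ideal.mul_mem_left _ x hy) := rfl

theorem sum_residue_smul_mk {j : ℕ} {ι : Type*} (s : Finset ι) (c y : ι → P)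
    (hy : ∀ i, y i ∈ maximalIdeal P ^ j) :
    ∑ i ∈ s, residue P (c i) • GrPiece.mk j (y i) (hy i) = GrPiece.mk j (∑ i ∈ s, c i * y i)
      (sum_mem fun i _ => Ideal.mul_mem_left _ _ (hy i)) := by
  classical
  induction s using Finset.induction_on with
  | empty => simp only [Finset.sum_empty]; rfl
  | insert i s hi ih =>
    rw [Finset.sum_insert hi, ih, residue_smul_mk, GrPiece.mk_add_mk]
    simp only [Finset.sum_insert hi]

theorem indepMod_pow_succ_iff {j : ℕ} {ι : Type*} [Fintype ι] {y : ι → P}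
    (hy : ∀ i, y i ∈ maximalIdeal P ^ j) :
    IndepMod (maximalIdeal P ^ (j + 1)) y ↔
      LinearIndependent (ResidueField P) fun i => GrPiece.mk j (y i) (hy i) := by
  rw [Fintype.linearIndependent_iff]
  constructor
  · intro h c hc i
    choose b hb using fun i => residue_surjective (R := P) (c i)
    obtain rfl : (fun i => residue P (b i)) = c := funext hb
    rw [sum_residue_smul_mk _ _ _ hy, GrPiece.zero_eq_mk, GrPiece.mk_eq_mk_iff, sub_zero] at hc
    exact (residue_eq_zero_iff _).2 (h b hc i)
  · intro h c hc i
    refine (residue_eq_zero_iff _).1 (h (fun i => residue P (c i)) ?_ i)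
    rw [sum_residue_smul_mk _ _ _ hy, GrPiece.zero_eq_mk, GrPiece.mk_eq_mk_iff, sub_zero]
    exact hc

/-- Linear independence is an open condition on vectors which depend affinely on parameters. -/
theorem exists_eval_ne_zero_of_linearIndependent {k V σ ι : Type*} [Field k] [AddCommGroup V]
    [Module k V] [Fintype σ] [Finite ι] (u : ι → V) (v : ι → σ → V) (x₀ : σ → k)
    (h : LinearIndependent k fun j => u j + ∑ l, x₀ l • v j l) :
    ∃ p : MvPolynomial σ k, p.eval x₀ ≠ 0 ∧ ∀ x, p.eval x ≠ 0 →
      LinearIndependent k fun j => u j + ∑ l, x l • v j l := by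
  classical
  have := Fintype.ofFinite ι
  obtain ⟨φ, hφ⟩ := LinearMap.exists_leftInverse_of_injective
    (Fintype.linearCombination k fun j => u j + ∑ l, x₀ l • v j l)
    (LinearMap.ker_eq_bot.2 (LinearIndependent.fintypeLinearCombination_injective h))
  let M : Matrix ι ι (MvPolynomial σ k) := Matrix.of fun j i =>
    MvPolynomial.C (φ (u j) i) + ∑ l, MvPolynomial.X l * MvPolynomial.C (φ (v j l) i)
  have hM : ∀ x, M.det.eval x = (Matrix.of fun j => φ (u j + ∑ l, x l • v j l)).det := by
    intro x
    rw [RingHom.map_det]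
    congr 1
    ext j i
    simp [M]
  refine ⟨M.det, ?_, fun x hx => ?_⟩
  · have h1 : (Matrix.of fun j => φ (u j + ∑ l, x₀ l • v j l)) = (1 : Matrix ι ι k) := by
      ext j i
      have := LinearMap.congr_fun hφ (Pi.single j 1)
      simp only [LinearMap.comp_apply, Fintype.linearCombination_apply_single, one_smul] at this
      rw [Matrix.of_apply, this, Matrix.one_apply, LinearMap.id_apply, Pi.single_apply]
      simp [eq_comm]
    rw [hM, h1, Matrix.det_one]
    exact one_ne_zero
  · rw [hM] at hx
    have h1 := Matrix.linearIndependent_rows_iff_isUnit.2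
      ((Matrix.isUnit_iff_isUnit_det _).2 hx.isUnit)
    exact LinearIndependent.of_comp φ h1

theorem mem_leadingIdeal_ofFn {q n s : ℕ} {y : Fin q → P} {z : P} :
    z ∈ leadingIdeal (List.ofFn fun i => (y i, s)) n ↔
      ∃ c : Fin q → P, (∀ i, c i ∈ maximalIdeal P ^ (n - s)) ∧ ∑ i, c i * y i = z := by
  induction q generalizing z with
  | zero => simp [leadingIdeal, eq_comm]
  | succ q ih =>
    rw [List.ofFn_succ, leadingIdeal, Submodule.mem_sup]
    constructor
    · rintro ⟨a, ha, b, hb, rfl⟩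
      obtain ⟨c₀, hc₀, rfl⟩ := Ideal.mem_span_singleton_mul.1 ha
      obtain ⟨c, hc, rfl⟩ := ih.1 hb
      exact ⟨Fin.cons c₀ c, Fin.cases hc₀ hc, by simp [Fin.sum_univ_succ, mul_comm]⟩
    · rintro ⟨c, hc, rfl⟩
      refine ⟨y 0 * c 0, Ideal.mul_mem_mul (Ideal.mem_span_singleton_self _) (hc 0),
        ∑ i : Fin q, c i.succ * y i.succ, ih.2 ⟨fun i => c i.succ, fun i => hc _, rfl⟩, ?_⟩
      rw [Fin.sum_univ_succ, mul_comm]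

theorem leadingIdeal_append (L M : List (P × ℕ)) (n : ℕ) :
    leadingIdeal (L ++ M) n = leadingIdeal L n ⊔ leadingIdeal M n := by
  induction L with
  | nil => simp [leadingIdeal]
  | cons p L ih => rw [List.cons_append, leadingIdeal, leadingIdeal, ih, sup_assoc]

/-- The family `F i - a (s i) * g` of elements of order two. -/
def quadraticFamily {q : ℕ} {σ : Type*} (F : Fin q → P) (s : Fin q → σ) (g : P) (a : σ → P) :
    List (P × ℕ) :=
  List.ofFn fun i => (F i - a (s i) * g, 2)

variable {q : ℕ} {σ : Type*} {F : Fin q → P} {s : Fin q → σ} {g : P}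

omit [IsLocalRing P] in
theorem length_quadraticFamily (a : σ → P) : (quadraticFamily F s g a).length = q := by
  simp [quadraticFamily]

omit [IsLocalRing P] in
theorem snd_of_mem_quadraticFamily (a : σ → P) : ∀ p ∈ quadraticFamily F s g a, p.2 = 2 := by
  intro p hp
  obtain ⟨i, rfl⟩ := (List.mem_ofFn' _ _).1 hp
  rfl

theorem hasOrders_quadraticFamily (hF : ∀ i, F i ∈ maximalIdeal P ^ 2)
    (hg : g ∈ maximalIdeal P ^ 2) (a : σ → P) : HasOrders (quadraticFamily F s g a) := by
  intro p hp
  obtain ⟨i, rfl⟩ := (List.mem_ofFn' _ _).1 hp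
  exact ⟨sub_mem (hF i) (Ideal.mul_mem_left _ _ hg), two_pos⟩

variable [IsNoetherianRing P] [Fintype σ]

/-- Lower semicontinuity of the rank of the leading forms in one degree: a basis at `a₀` is written
in terms of the generators, and the same combinations of the deformed generators stay independent
wherever a minor does not vanish. -/
theorem exists_eval_ne_zero_colength_leadingIdeal_le (hF : ∀ i, F i ∈ maximalIdeal P ^ 2)
    (hg : g ∈ maximalIdeal P ^ 2) {X : List (P × ℕ)} (hX : HasOrders X) (a₀ : σ → P) (n : ℕ) :
    ∃ p : MvPolynomial σ (ResidueField P), p.eval (fun i => residue P (a₀ i)) ≠ 0 ∧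
      ∀ a : σ → P, p.eval (fun i => residue P (a i)) ≠ 0 →
        colength (leadingIdeal (quadraticFamily F s g a ++ X) n ⊔ maximalIdeal P ^ (n + 1)) ≤
          colength (leadingIdeal (quadraticFamily F s g a₀ ++ X) n ⊔ maximalIdeal P ^ (n + 1)) := by
  classical
  have hn : maximalIdeal P ^ (n + 1) ≤ maximalIdeal P ^ n := Ideal.pow_le_pow_right (Nat.le_succ n)
  have hO : ∀ a, HasOrders (quadraticFamily F s g a ++ X) := fun a =>
    HasOrders.append.2 ⟨hasOrders_quadraticFamily hF hg a, hX⟩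
  have hle : ∀ a, leadingIdeal (quadraticFamily F s g a ++ X) n ⊔ maximalIdeal P ^ (n + 1) ≤
      maximalIdeal P ^ n := fun a => sup_le (leadingIdeal_le_pow (hO a) n) hn
  obtain ⟨r, hr⟩ := Nat.exists_eq_add_of_le (colength_mono le_rfl (le_sup_right :
    maximalIdeal P ^ (n + 1) ≤ leadingIdeal (quadraticFamily F s g a₀ ++ X) n ⊔ _))
  obtain ⟨e, he, hind⟩ := exists_indepMod le_rfl le_sup_right
    ((Ideal.mul_mono_right (hle a₀)).trans (pow_succ' _ _).ge) hr.symm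
  have hdec : ∀ j, ∃ c : Fin q → P, (∀ i, c i ∈ maximalIdeal P ^ (n - 2)) ∧
      ∃ x ∈ leadingIdeal X n ⊔ maximalIdeal P ^ (n + 1),
        e j = ∑ i, c i * (F i - a₀ (s i) * g) + x := by
    intro j
    have h := he j
    rw [leadingIdeal_append, sup_assoc] at h
    obtain ⟨y, hy, x, hx, hyx⟩ := Submodule.mem_sup.1 h
    obtain ⟨c, hc, rfl⟩ := mem_leadingIdeal_ofFn.1 hy
    exact ⟨c, hc, x, hx, hyx.symm⟩
  choose c hc x hx hex using hdec
  have hpow : ∀ {u v}, u ∈ maximalIdeal P ^ (n - 2) → v ∈ maximalIdeal P ^ 2 →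
      u * v ∈ maximalIdeal P ^ n := fun hu hv =>
    Ideal.pow_le_pow_right (by omega) (GrPiece.mul_mem_pow hu hv)
  have hx' : ∀ j, x j ∈ maximalIdeal P ^ n := fun j =>
    (sup_le (leadingIdeal_le_pow hX n) hn : _ ≤ maximalIdeal P ^ n) (hx j)
  -- the constant and the linear terms of the deformation of the basis `e`
  let b : Fin r → P := fun j => ∑ i, c j i * F i + x j
  have hb : ∀ j, b j ∈ maximalIdeal P ^ n := fun j =>
    add_mem (sum_mem fun i _ => hpow (hc j i) (hF i)) (hx' j)
  let w : Fin r → σ → P := fun j l => ∑ i with s i = l, -(c j i * g)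
  have hw : ∀ j l, w j l ∈ maximalIdeal P ^ n := fun j l =>
    sum_mem fun i _ => neg_mem (hpow (hc j i) hg)
  let E : (σ → P) → Fin r → P := fun a j => ∑ i, c j i * (F i - a (s i) * g) + x j
  have hE : ∀ a j, E a j = b j + ∑ l, a l * w j l := by
    intro a j
    have h1 : ∑ l, a l * w j l = ∑ i, -(c j i * (a (s i) * g)) := by
      simp only [w, Finset.mul_sum]
      rw [← Finset.sum_fiberwise (s := Finset.univ) (g := s)]
      refine Finset.sum_congr rfl fun l _ => Finset.sum_congr rfl fun i hi => ?_
      rw [(Finset.mem_filter.1 hi).2]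
      ring
    rw [h1]
    simp only [E, b]
    rw [add_right_comm, ← Finset.sum_add_distrib]
    congr 1
    exact Finset.sum_congr rfl fun i _ => by ring
  have hEmem : ∀ a j, E a j ∈ maximalIdeal P ^ n := fun a j => by
    rw [hE]
    exact add_mem (hb j) (sum_mem fun l _ => Ideal.mul_mem_left _ _ (hw j l))
  have hmk : ∀ a j, GrPiece.mk n (E a j) (hEmem a j) =
      GrPiece.mk n (b j) (hb j) + ∑ l, residue P (a l) • GrPiece.mk n (w j l) (hw j l) := by
    intro a j
    rw [sum_residue_smul_mk _ _ _ (hw j), GrPiece.mk_add_mk]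
    simp only [hE]
  have hlin := (indepMod_pow_succ_iff (hEmem a₀)).1 (by
    have : E a₀ = e := funext fun j => (hex j).symm
    rwa [this])
  simp only [hmk] at hlin
  obtain ⟨p, hp, hp'⟩ := exists_eval_ne_zero_of_linearIndependent _ _ _ hlin
  refine ⟨p, hp, fun a ha => ?_⟩
  have h1 := hp' _ ha
  simp only [← hmk] at h1
  have h2 := ((indepMod_pow_succ_iff (hEmem a)).2 h1).colength_add_card_le le_rfl
    (le_sup_right : _ ≤ leadingIdeal (quadraticFamily F s g a ++ X) n ⊔ maximalIdeal P ^ (n + 1))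
    fun j => by
      rw [leadingIdeal_append, sup_assoc]
      exact add_mem (Ideal.mem_sup_left (mem_leadingIdeal_ofFn.2 ⟨c j, hc j, rfl⟩))
        (Ideal.mem_sup_right (hx j))
  rw [Fintype.card_fin] at h2
  omega

variable [Infinite (ResidueField P)]

/-- Strictness of an affine family of elements of order two is an open condition on the residues of
the parameters. -/
theorem exists_eval_ne_zero_strictSeq {d : ℕ} (hd : ringKrullDim P = d)
    (hd' : (maximalIdeal P).spanFinrank = d) (hqd : q ≤ d) (hF : ∀ i, F i ∈ maximalIdeal P ^ 2)
    (hg : g ∈ maximalIdeal P ^ 2) (a₀ : σ → P) (h₀ : StrictSeq ⊥ (quadraticFamily F s g a₀)) :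
    ∃ p : MvPolynomial σ (ResidueField P), p.eval (fun i => residue P (a₀ i)) ≠ 0 ∧
      ∀ a : σ → P, p.eval (fun i => residue P (a i)) ≠ 0 →
        StrictSeq ⊥ (quadraticFamily F s g a) := by
  obtain ⟨X, hX1, hX2, hXO, hXs⟩ := h₀.exists_append hd hd' (hasOrders_quadraticFamily hF hg a₀)
    (m := d - q) (by rw [length_quadraticFamily]; omega)
  have hX := (HasOrders.append.1 hXO).2
  choose p hp hp' using fun n => exists_eval_ne_zero_colength_leadingIdeal_le (s := s) hF hg hX a₀ n
  have hlen : ∀ a, (quadraticFamily F s g a).length + X.length = d := fun a => by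
    rw [length_quadraticFamily]; omega
  refine ⟨∏ n ∈ Finset.range (q + 2), p n, ?_, fun a ha => ?_⟩
  · rw [map_prod]
    exact Finset.prod_ne_zero_iff.2 fun n _ => hp n
  · rw [map_prod, Finset.prod_ne_zero_iff] at ha
    have h1 := (strictSeq_iff_colength_leadingIdeal_le hd hd' hXO (snd_of_mem_quadraticFamily a₀)
      hX2 (hlen a₀)).1 hXs
    refine (strictSeq_append.1 ((strictSeq_iff_colength_leadingIdeal_le hd hd'
      (HasOrders.append.2 ⟨hasOrders_quadraticFamily hF hg a, hX⟩) (snd_of_mem_quadraticFamily a)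
      hX2 (hlen a)).2 fun n hn => ?_)).1
    rw [length_quadraticFamily] at h1 hn ⊢
    exact (hp' n a (ha n (Finset.mem_range.2 (by omega)))).trans (h1 n hn)

omit [Fintype σ] in
/-- A union of basic open subsets is Zariski-open. -/
theorem isZariskiOpen_of_forall_exists {k : Type*} [Field k] {U : Set (σ → k)}
    (h : ∀ x₀ ∈ U, ∃ p : MvPolynomial σ k, p.eval x₀ ≠ 0 ∧ ∀ x, p.eval x ≠ 0 → x ∈ U) :
    IsZariskiOpen U := by
  refine ⟨MvPolynomial.vanishingIdeal k Uᶜ, ?_⟩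
  refine Set.Subset.antisymm (fun x hx p hp => ?_) fun x hx hxU => ?_
  · exact hp x hx
  · obtain ⟨p, hp, hp'⟩ := h x hxU
    refine hp ?_
    have : p ∈ MvPolynomial.vanishingIdeal k Uᶜ := fun y hy => by
      by_contra hne
      exact hy (hp' y hne)
    exact hx p this

end Openness

/-! ### Regular sequences of quadratic parts -/

section QuadraticPart

variable {P : Type*} [CommRing P] [IsLocalRing P]

/-- The ideal of the associated graded ring generated by the initial forms of the elements of `J`:
its component of degree `n` consists of the classes of the elements of `J ⊓ 𝔪ⁿ`. -/
def initialFormIdeal (J : Ideal P) : Ideal (AssocGraded P) where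
  carrier := {w | ∀ n, ∃ z ∈ J, ∃ hz : z ∈ maximalIdeal P ^ n, w n = GrPiece.mk n z hz}
  add_mem' {v w} hv hw n := by
    obtain ⟨z, hz, hz', e⟩ := hv n
    obtain ⟨y, hy, hy', e'⟩ := hw n
    exact ⟨z + y, add_mem hz hy, add_mem hz' hy', by
      rw [DirectSum.add_apply, e, e', GrPiece.mk_add_mk]⟩
  zero_mem' n := ⟨0, zero_mem _, zero_mem _, rfl⟩
  smul_mem' v w hw := by
    classical
    -- a homogeneous product has components in the right degrees
    have hof : ∀ {k : ℕ} {z : P} (_ : z ∈ J) (hz : z ∈ maximalIdeal P ^ k) (n : ℕ),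
        ∃ y ∈ J, ∃ hy : y ∈ maximalIdeal P ^ n,
          DirectSum.of (GrPiece (maximalIdeal P)) k (GrPiece.mk k z hz) n = GrPiece.mk n y hy := by
      intro k z hzJ hz n
      by_cases hk : k = n
      · subst hk
        exact ⟨z, hzJ, hz, DirectSum.of_eq_same _ _⟩
      · exact ⟨0, zero_mem _, zero_mem _, DirectSum.of_eq_of_ne _ _ _ (Ne.symm hk)⟩
    rw [smul_eq_mul, ← DirectSum.sum_support_of w, Finset.mul_sum]
    intro n
    induction v using DirectSum.induction_on with
    | zero => exact ⟨0, zero_mem _, zero_mem _, by simp only [zero_mul, Finset.sum_const_zero]; rfl⟩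
    | add v v' hv hv' =>
      obtain ⟨z, hz, hz', e⟩ := hv
      obtain ⟨y, hy, hy', e'⟩ := hv'
      exact ⟨z + y, add_mem hz hy, add_mem hz' hy', by
        simp only [add_mul, Finset.sum_add_distrib]
        rw [DirectSum.add_apply, e, e', GrPiece.mk_add_mk]⟩
    | of k b =>
      induction DFinsupp.support w using Finset.induction_on with
      | empty => exact ⟨0, zero_mem _, zero_mem _, rfl⟩
      | insert i s hi ih =>
        obtain ⟨z, hz, hz', e⟩ := ih
        obtain ⟨y, hy, hy', e'⟩ := hw i
        induction b using GrPiece.ind with | h x hx => ?_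
        have h1 : DirectSum.of (GrPiece (maximalIdeal P)) k (GrPiece.mk k x hx) *
            DirectSum.of (GrPiece (maximalIdeal P)) i (w i) =
            DirectSum.of (GrPiece (maximalIdeal P)) (k + i) (GrPiece.mk (k + i) (x * y)
              (GrPiece.mul_mem_pow hx hy')) := by
          rw [DirectSum.of_mul_of, e']
          rfl
        obtain ⟨u, hu, hu', e''⟩ := hof (J.mul_mem_left x hy) (GrPiece.mul_mem_pow hx hy') n
        exact ⟨u + z, add_mem hu hz, add_mem hu' hz', by
          rw [Finset.sum_insert hi, DirectSum.add_apply, e, h1, e'', GrPiece.mk_add_mk]⟩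

theorem of_mem_initialFormIdeal {J : Ideal P} {n : ℕ} {z : P} (hz : z ∈ maximalIdeal P ^ n) :
    DirectSum.of (GrPiece (maximalIdeal P)) n (GrPiece.mk n z hz) ∈ initialFormIdeal J ↔
      z ∈ J ⊔ maximalIdeal P ^ (n + 1) := by
  constructor
  · intro h
    obtain ⟨y, hy, hy', e⟩ := h n
    rw [DirectSum.of_eq_same, GrPiece.mk_eq_mk_iff] at e
    have : z = y + (z - y) := by ring
    rw [this]
    exact add_mem (Ideal.mem_sup_left hy) (Ideal.mem_sup_right e)
  · intro h k
    obtain ⟨y, hy, m, hm, rfl⟩ := Submodule.mem_sup.1 h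
    by_cases hk : n = k
    · subst hk
      have hm' := Ideal.pow_le_pow_right (Nat.le_succ n) hm
      have hy' : y ∈ maximalIdeal P ^ n := by
        have := sub_mem hz hm'
        rwa [add_sub_cancel_right] at this
      refine ⟨y, hy, hy', (DirectSum.of_eq_same _ _).trans ((GrPiece.mk_eq_mk_iff _ _).2 ?_)⟩
      rwa [add_sub_cancel_left]
    · exact ⟨0, zero_mem _, zero_mem _, DirectSum.of_eq_of_ne _ _ _ (Ne.symm hk)⟩

theorem of_mul_quadraticPart {n : ℕ} {c f : P} (hc : c ∈ maximalIdeal P ^ n)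
    (hf : f ∈ maximalIdeal P ^ 2) :
    DirectSum.of (GrPiece (maximalIdeal P)) n (GrPiece.mk n c hc) * quadraticPart f hf =
      DirectSum.of (GrPiece (maximalIdeal P)) (n + 2) (GrPiece.mk (n + 2) (c * f)
        (GrPiece.mul_mem_pow hc hf)) := by
  rw [quadraticPart, DirectSum.of_mul_of]
  rfl

/-- If the quadratic parts of the `F i` are a regular sequence, then the `F i` are strict. -/
theorem strictSeq_of_isWeaklyRegular_quadraticPart {q : ℕ} (F : Fin q → P)
    (hF : ∀ i, F i ∈ maximalIdeal P ^ 2)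
    (h : RingTheory.Sequence.IsWeaklyRegular (AssocGraded P)
      (List.ofFn fun i => quadraticPart (F i) (hF i))) :
    StrictSeq ⊥ (List.ofFn fun i => (F i, 2)) := by
  induction q with
  | zero => simp [StrictSeq]
  | succ q ih =>
    rw [List.ofFn_succ', List.concat_eq_append,
      RingTheory.Sequence.isWeaklyRegular_append_iff,
      RingTheory.Sequence.isWeaklyRegular_singleton_iff] at h
    obtain ⟨h1, h2⟩ := h
    have ih := ih (fun i => F i.castSucc) (fun i => hF i.castSucc) h1
    rw [List.ofFn_succ', List.concat_eq_append, strictSeq_append]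
    refine ⟨ih, ?_, trivial⟩
    have hO : HasOrders (List.ofFn fun i : Fin q => (F i.castSucc, 2)) := by
      intro p hp
      obtain ⟨i, rfl⟩ := (List.mem_ofFn' _ _).1 hp
      exact ⟨hF _, two_pos⟩
    rw [bot_sup_eq]
    set J := seqIdeal (List.ofFn fun i : Fin q => (F i.castSucc, 2)) with hJ
    set f := F (Fin.last q)
    set Q := Ideal.ofList (List.ofFn fun i : Fin q => quadraticPart (F i.castSucc)
      (hF i.castSucc)) with hQ
    have hQmem : ∀ i : Fin q, quadraticPart (F i.castSucc) (hF i.castSucc) ∈ Q := fun i =>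
      Ideal.subset_span ((List.mem_ofFn' _ _).2 ⟨i, rfl⟩)
    have hFJ : ∀ i : Fin q, F i.castSucc ∈ J := fun i =>
      Ideal.subset_span (List.mem_map.2
        ⟨(F i.castSucc, 2), (List.mem_ofFn' _ _).2 ⟨i, rfl⟩, rfl⟩)
    have hQJ : Q ≤ initialFormIdeal J := by
      refine Ideal.span_le.2 fun w hw => ?_
      obtain ⟨i, rfl⟩ := (List.mem_ofFn' _ _).1 hw
      exact (of_mem_initialFormIdeal _).2 (Ideal.mem_sup_left (hFJ i))
    have hreg : ∀ w, w * quadraticPart f (hF _) ∈ Q → w ∈ Q := by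
      intro w hw
      have htop : Q • (⊤ : Submodule (AssocGraded P) (AssocGraded P)) = Q := by simp
      rw [← htop]
      refine (Submodule.Quotient.mk_eq_zero _).1 (h2.right_eq_zero_of_smul ?_)
      rw [← Submodule.Quotient.mk_smul, Submodule.Quotient.mk_eq_zero, htop, smul_eq_mul, mul_comm]
      exact hw
    intro n
    induction n with
    | zero => intro z _; simp
    | succ n ihn =>
      intro z hz
      have hz0 := ihn z ((sup_le_sup_left (Ideal.pow_le_pow_right (by omega)) J :
        J ⊔ maximalIdeal P ^ (n + 1 + 2) ≤ J ⊔ maximalIdeal P ^ (n + 2)) hz)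
      obtain ⟨j, hj, z, hzn, rfl⟩ := Submodule.mem_sup.1 hz0
      have hz1 : f * z ∈ J ⊔ maximalIdeal P ^ (n + 1 + 2) := by
        have := sub_mem hz (Ideal.mem_sup_left (J.mul_mem_left f hj))
        rwa [mul_add, add_sub_cancel_left] at this
      refine add_mem (Ideal.mem_sup_left hj) ((of_mem_initialFormIdeal hzn).1
        (hQJ (hreg _ ?_)))
      have hzf : z * f ∈ maximalIdeal P ^ (n + 2) := GrPiece.mul_mem_pow hzn (hF _)
      obtain ⟨y, hy, m, hm, hym⟩ := Submodule.mem_sup.1 hz1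
      have hy' : y ∈ maximalIdeal P ^ (n + 2) := by
        have := sub_mem hzf (Ideal.pow_le_pow_right (by omega) hm : m ∈ maximalIdeal P ^ (n + 2))
        rwa [mul_comm, ← hym, add_sub_cancel_right] at this
      have hlead := ih.inf_le hO (n + 2) ⟨Ideal.mem_sup_right hy, Ideal.mem_sup_right hy'⟩
      rw [bot_sup_eq, mem_leadingIdeal_ofFn] at hlead
      obtain ⟨c, hc, rfl⟩ := hlead
      rw [Nat.add_sub_cancel] at hc
      have e : DirectSum.of (GrPiece (maximalIdeal P)) (n + 2) (GrPiece.mk (n + 2) (z * f) hzf) =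
          ∑ i, DirectSum.of (GrPiece (maximalIdeal P)) n (GrPiece.mk n (c i) (hc i)) *
            quadraticPart (F i.castSucc) (hF i.castSucc) := by
        simp only [of_mul_quadraticPart]
        rw [← map_sum]
        congr 1
        have := sum_residue_smul_mk Finset.univ (fun _ => 1) (fun i => c i * F i.castSucc)
          (fun i => GrPiece.mul_mem_pow (hc i) (hF i.castSucc))
        simp only [map_one, one_smul, one_mul] at this
        rw [this, GrPiece.mk_eq_mk_iff, mul_comm z f, ← hym, add_sub_cancel_left]
        rwa [show n + 2 + 1 = n + 1 + 2 by omega]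
      rw [of_mul_quadraticPart, e]
      exact sum_mem fun i _ => Ideal.mul_mem_left _ _ (hQmem i)

end QuadraticPart

/-! ### Completions of local rings and of their quotients -/

section CompletionMap

variable {A B : Type*} [CommRing A] [CommRing B] {φ : A →+* B} {I : Ideal A} {J : Ideal B}

theorem evalₐ_eq_mk_of_le {m n : ℕ} (hle : m ≤ n) {x : AdicCompletion I A} {a : A}
    (hx : AdicCompletion.evalₐ I n x = Ideal.Quotient.mk (I ^ n) a) :
    AdicCompletion.evalₐ I m x = Ideal.Quotient.mk (I ^ m) a := by
  induction x using AdicCompletion.induction_on with | _ b => ?_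
  rw [AdicCompletion.evalₐ_mk] at hx ⊢
  refine (AdicCompletion.Ideal.mk_eq_mk I hle b).symm.trans (Ideal.Quotient.eq.2 ?_)
  exact Ideal.pow_le_pow_right hle (Ideal.Quotient.eq.1 hx)

theorem factorPow_comp_quotientMap_comp_evalₐ (h : I ≤ J.comap φ) {m n : ℕ} (hle : m ≤ n) :
    (Ideal.Quotient.factorPow J hle).comp ((Ideal.quotientMap (J ^ n) φ
      ((Ideal.pow_right_mono h n).trans (Ideal.le_comap_pow φ n))).comp
        (AdicCompletion.evalₐ I n : AdicCompletion I A →+* A ⧸ I ^ n)) =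
    (Ideal.quotientMap (J ^ m) φ ((Ideal.pow_right_mono h m).trans (Ideal.le_comap_pow φ m))).comp
      (AdicCompletion.evalₐ I m : AdicCompletion I A →+* A ⧸ I ^ m) := by
  ext x
  obtain ⟨a, ha⟩ := Ideal.Quotient.mk_surjective (AdicCompletion.evalₐ I n x)
  have hm := evalₐ_eq_mk_of_le hle ha.symm
  simp [← ha, hm]

/-- The map of adic completions induced by a ring homomorphism which takes `I` into `J`. -/
noncomputable def adicCompletionMap (h : I ≤ J.comap φ) :
    AdicCompletion I A →+* AdicCompletion J B :=
  AdicCompletion.liftRingHom J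
    (fun n => (Ideal.quotientMap (J ^ n) φ
      ((Ideal.pow_right_mono h n).trans (Ideal.le_comap_pow φ n))).comp
        (AdicCompletion.evalₐ I n : AdicCompletion I A →+* A ⧸ I ^ n))
    (factorPow_comp_quotientMap_comp_evalₐ h)

theorem evalₐ_adicCompletionMap (h : I ≤ J.comap φ) {n : ℕ} {x : AdicCompletion I A} {a : A}
    (hx : AdicCompletion.evalₐ I n x = Ideal.Quotient.mk (I ^ n) a) :
    AdicCompletion.evalₐ J n (adicCompletionMap h x) = Ideal.Quotient.mk (J ^ n) (φ a) := by
  refine (AdicCompletion.evalₐ_liftRingHom J _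
    (factorPow_comp_quotientMap_comp_evalₐ h) n x).trans ?_
  simp [hx]

theorem adicCompletionMap_algebraMap (h : I ≤ J.comap φ) (a : A) :
    adicCompletionMap h (algebraMap A _ a) = algebraMap B _ (φ a) := by
  refine AdicCompletion.ext_evalₐ fun n => ?_
  rw [evalₐ_adicCompletionMap h (a := a)]
  · rfl
  · rfl

theorem evalₐ_eq_zero_iff (hI : I.FG) {n : ℕ} {x : AdicCompletion I A} :
    AdicCompletion.evalₐ I n x = 0 ↔ x ∈ I.map (algebraMap A (AdicCompletion I A)) ^ n := by
  rw [← Ideal.map_pow, ← Submodule.restrictScalars_mem A, ← Ideal.smul_top_eq_map,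
    AdicCompletion.pow_smul_top_eq_ker_eval hI, LinearMap.mem_ker]
  have h : (I ^ n • ⊤ : Ideal A) = I ^ n := by simp
  exact ⟨fun h0 => by rw [← AdicCompletion.factor_evalₐ_eq_eval I x h.ge, h0, map_zero],
    fun h0 => by rw [← AdicCompletion.factor_eval_eq_evalₐ I x h.le, h0, map_zero]⟩

/-- Modulo the extension of `I` the map of completions is surjective because `φ` is; by completeness
it is then surjective. -/
theorem adicCompletionMap_surjective (hφ : Function.Surjective φ) (hI : I.FG)
    (hIJ : I.map φ = J) :
    Function.Surjective (adicCompletionMap (Ideal.map_le_iff_le_comap.1 hIJ.le)) := by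
  subst hIJ
  have h := Ideal.map_le_iff_le_comap.1 (le_refl (I.map φ))
  have hJ : (I.map φ).FG := hI.map φ
  have h1 := AdicCompletion.isAdicComplete_self I hI
  have h2 := AdicCompletion.isAdicComplete_self (I.map φ) hJ
  have hmap : (I.map (algebraMap A (AdicCompletion I A))).map (adicCompletionMap h) =
      (I.map φ).map (algebraMap B (AdicCompletion (I.map φ) B)) := by
    rw [Ideal.map_map, Ideal.map_map]
    exact congrArg (Ideal.map · I) (RingHom.ext fun a => adicCompletionMap_algebraMap h a)
  have : IsHausdorff ((I.map (algebraMap A (AdicCompletion I A))).map (adicCompletionMap h))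
      (AdicCompletion (I.map φ) B) := by rw [hmap]; infer_instance
  refine surjective_of_mk_map_comp_surjective (I := I.map (algebraMap A (AdicCompletion I A)))
    (adicCompletionMap h) fun y => ?_
  obtain ⟨y, rfl⟩ := Ideal.Quotient.mk_surjective y
  obtain ⟨b, hb⟩ := Ideal.Quotient.mk_surjective (AdicCompletion.evalₐ (I.map φ) 1 y)
  obtain ⟨a, rfl⟩ := hφ b
  refine ⟨algebraMap A _ a, ?_⟩
  rw [RingHom.comp_apply, adicCompletionMap_algebraMap, Ideal.Quotient.eq, hmap,
    ← pow_one (Ideal.map _ (I.map φ)), ← evalₐ_eq_zero_iff hJ, map_sub, ← hb, sub_eq_zero]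
  rfl

/-- The adic completion of a noetherian ring is noetherian, being a quotient of a ring of power
series. -/
theorem isNoetherianRing_adicCompletion [IsNoetherianRing A] (I : Ideal A) :
    IsNoetherianRing (AdicCompletion I A) := by
  obtain ⟨s, hs⟩ := IsNoetherian.noetherian I
  let φ : MvPolynomial s A →+* A := MvPolynomial.aeval (R := A) (fun x : s => (x : A))
  have hφ : Function.Surjective φ := fun a => ⟨MvPolynomial.C a, by simp [φ]⟩
  have hmap : (MvPolynomial.idealOfVars s A).map φ = I := by
    rw [MvPolynomial.idealOfVars, Ideal.map_span, ← hs, ← Set.range_comp]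
    congr 1
    ext a
    simp [φ]
  have h1 : IsNoetherianRing
      (AdicCompletion (MvPolynomial.idealOfVars s A) (MvPolynomial s A)) :=
    isNoetherianRing_of_ringEquiv _ (MvPowerSeries.toAdicCompletionAlgEquiv s A).toRingEquiv
  exact isNoetherianRing_of_surjective _ _ _
    (adicCompletionMap_surjective hφ (MvPolynomial.idealOfVars_fg s A) hmap)

end CompletionMap

section LocalCompletion

variable {P : Type*} [CommRing P] [IsLocalRing P] [IsNoetherianRing P]

/-- Krull's intersection theorem: ideals of a noetherian local ring are closed. -/
theorem mem_of_forall_mem_sup_pow (J : Ideal P) {x : P}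
    (h : ∀ n, x ∈ J ⊔ maximalIdeal P ^ n) : x ∈ J := by
  refine (Submodule.Quotient.mk_eq_zero J).1 (IsHausdorff.haus
    (inferInstance : IsHausdorff (maximalIdeal P) (P ⧸ J)) _ fun n => ?_)
  obtain ⟨j, hj, m, hm, rfl⟩ := Submodule.mem_sup.1 (h n)
  rw [SModEq.zero]
  have : (Submodule.Quotient.mk (j + m) : P ⧸ J) = m • Submodule.Quotient.mk 1 := by
    rw [← Submodule.Quotient.mk_smul, Submodule.Quotient.eq]
    simpa using hj
  rw [this]
  exact Submodule.smul_mem_smul hm trivial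

/-- If the leading forms are a regular sequence, so are the elements themselves. -/
theorem StrictSeq.isWeaklyRegular {L : List (P × ℕ)} (hs : StrictSeq ⊥ L) :
    RingTheory.Sequence.IsWeaklyRegular P (L.map Prod.fst) := by
  induction L using List.reverseRecOn with
  | nil => simp
  | append_singleton L p ih =>
    obtain ⟨h1, h2, -⟩ := strictSeq_append.1 hs
    rw [List.map_append, RingTheory.Sequence.isWeaklyRegular_append_iff, List.map_singleton,
      RingTheory.Sequence.isWeaklyRegular_singleton_iff]
    refine ⟨ih h1, ?_⟩
    have htop : Ideal.ofList (L.map Prod.fst) • (⊤ : Submodule P P) = seqIdeal L := by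
      simp [seqIdeal]
    rw [bot_sup_eq] at h2
    rw [htop, isSMulRegular_iff_right_eq_zero_of_smul]
    intro z hz
    obtain ⟨z, rfl⟩ := Submodule.Quotient.mk_surjective _ z
    rw [← Submodule.Quotient.mk_smul, Submodule.Quotient.mk_eq_zero] at hz
    rw [Submodule.Quotient.mk_eq_zero]
    exact mem_of_forall_mem_sup_pow _ fun n => h2 n z (Ideal.mem_sup_left hz)

/-- The completion of a regular local ring is regular. -/
theorem isRegularLocalRing_adicCompletion [Infinite (ResidueField P)] {d : ℕ}
    (hd : ringKrullDim P = d) (hd' : (maximalIdeal P).spanFinrank = d) :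
    IsRegularLocalRing (AdicCompletion (maximalIdeal P) P) := by
  have := isNoetherianRing_adicCompletion (maximalIdeal P)
  obtain ⟨Y, h1, h2, h3⟩ := extends_nil hd'
  rw [List.nil_append] at h1 h2 h3
  have hs := strictSeq_of_seqIdeal_eq (by rw [h2]; exact hd) h1 h3
  have hreg := hs.isWeaklyRegular.of_flat (S := AdicCompletion (maximalIdeal P) P)
  have hreg' := RingTheory.Sequence.IsRegular.of_isWeaklyRegular_of_mem_maximalIdeal _ (by
    intro r hr
    obtain ⟨x, hx, rfl⟩ := List.mem_map.1 hr
    rw [AdicCompletion.maximalIdeal_eq_map, ← h3]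
    exact Ideal.mem_map_of_mem _ (Ideal.subset_span hx)) hreg
  have hdim := ringKrullDim_add_length_eq_ringKrullDim_of_isRegular _ hreg'
  refine IsRegularLocalRing.of_spanFinrank_maximalIdeal_le _ ?_
  rw [AdicCompletion.spanFinrank_maximalIdeal_eq (R := P), hd', ← hdim, List.length_map,
    List.length_map, h2]
  have hnt : Nontrivial (AdicCompletion (maximalIdeal P) P ⧸ Ideal.ofList
      ((Y.map Prod.fst).map (algebraMap P (AdicCompletion (maximalIdeal P) P)))) := by
    refine Ideal.Quotient.nontrivial_iff.2 fun e => hreg'.2 ?_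
    rw [e]
    simp
  exact le_add_of_nonneg_left ringKrullDim_nonneg_of_nontrivial

/-- The completion of `P / J` is the quotient of the completion of `P` by the ideal generated by
`J`. -/
theorem nonempty_adicCompletion_quotient_equiv (J : Ideal P) [IsLocalRing (P ⧸ J)] :
    Nonempty (AdicCompletion (maximalIdeal (P ⧸ J)) (P ⧸ J) ≃+*
      AdicCompletion (maximalIdeal P) P ⧸
        J.map (algebraMap P (AdicCompletion (maximalIdeal P) P))) := by
  have hnoeth := isNoetherianRing_adicCompletion (maximalIdeal P)
  have hm := (maximalIdeal_quotient J).symm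
  have hfg : (maximalIdeal P).FG := IsNoetherian.noetherian _
  have h := Ideal.map_le_iff_le_comap.1 hm.le
  have hsurj := adicCompletionMap_surjective Ideal.Quotient.mk_surjective hfg hm
  suffices hker : RingHom.ker (adicCompletionMap h) =
      J.map (algebraMap P (AdicCompletion (maximalIdeal P) P)) from
    ⟨((Ideal.quotEquivOfEq hker.symm).trans (RingHom.quotientKerEquivOfSurjective hsurj)).symm⟩
  refine le_antisymm (fun x hx => mem_of_forall_mem_sup_pow _ fun n => ?_) ?_
  · obtain ⟨a, ha⟩ := Ideal.Quotient.mk_surjective (AdicCompletion.evalₐ (maximalIdeal P) n x)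
    have h1 := evalₐ_adicCompletionMap h ha.symm
    rw [(RingHom.mem_ker).1 hx, map_zero, eq_comm, Ideal.Quotient.eq_zero_iff_mem, ← hm,
      ← Ideal.map_pow, ← Ideal.mem_comap, Ideal.comap_map_of_surjective' _
      Ideal.Quotient.mk_surjective, Ideal.mk_ker, sup_comm] at h1
    have h2 : x - algebraMap P _ a ∈
        maximalIdeal (AdicCompletion (maximalIdeal P) P) ^ n := by
      rw [AdicCompletion.maximalIdeal_eq_map, ← evalₐ_eq_zero_iff hfg, map_sub, ← ha, sub_eq_zero]
      rfl
    have h3 : algebraMap P (AdicCompletion (maximalIdeal P) P) a ∈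
        J.map (algebraMap P (AdicCompletion (maximalIdeal P) P)) ⊔
          maximalIdeal (AdicCompletion (maximalIdeal P) P) ^ n := by
      rw [AdicCompletion.maximalIdeal_eq_map, ← Ideal.map_pow, ← Ideal.map_sup]
      exact Ideal.mem_map_of_mem _ h1
    rw [← sub_add_cancel x (algebraMap P _ a)]
    exact add_mem (Ideal.mem_sup_right h2) h3
  · rw [Ideal.map_le_iff_le_comap]
    intro a ha
    rw [Ideal.mem_comap, RingHom.mem_ker, adicCompletionMap_algebraMap,
      Ideal.Quotient.eq_zero_iff_mem.2 ha, map_zero]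

/-- A quotient of a regular local ring by a regular sequence is a complete intersection in the sense
of completions: regular sequences stay regular under the flat extension to the completion. -/
theorem isCompleteIntersection_quotient.{u} {P : Type u} [CommRing P] [IsLocalRing P]
    [IsNoetherianRing P] [Infinite (ResidueField P)] {d : ℕ} (hd : ringKrullDim P = d)
    (hd' : (maximalIdeal P).spanFinrank = d) {l : List P}
    (hl : ∀ r ∈ l, r ∈ maximalIdeal P) (hreg : RingTheory.Sequence.IsWeaklyRegular P l)
    [IsLocalRing (P ⧸ Ideal.ofList l)] : IsCompleteIntersection (P ⧸ Ideal.ofList l) := by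
  have h1 := isRegularLocalRing_adicCompletion hd hd'
  have h2 := hreg.of_flat (S := AdicCompletion (maximalIdeal P) P)
  refine ⟨AdicCompletion (maximalIdeal P) P, inferInstance, h1, l.map (algebraMap P _), ?_, ?_⟩
  · refine RingTheory.Sequence.IsRegular.of_isWeaklyRegular_of_mem_maximalIdeal _
      (fun r hr => ?_) h2
    obtain ⟨x, hx, rfl⟩ := List.mem_map.1 hr
    rw [AdicCompletion.maximalIdeal_eq_map]
    exact Ideal.mem_map_of_mem _ (hl x hx)
  · rw [← Ideal.map_ofList]
    exact nonempty_adicCompletion_quotient_equiv _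

end LocalCompletion

/-! ### The family -/

section Family

open RingTheory.Sequence

/-- In a local ring, a regular sequence `F, g` stays regular when multiples of `g` are subtracted
from the members of `F`: modulo `g` nothing changes, and regular sequences may be permuted. -/
theorem isWeaklyRegular_ofFn_sub_mul {P : Type*} [CommRing P] [IsLocalRing P] [IsNoetherianRing P]
    {q : ℕ} {F : Fin q → P} {g : P} (hF : ∀ i, F i ∈ maximalIdeal P) (hg : g ∈ maximalIdeal P)
    (h : IsWeaklyRegular P (List.ofFn F ++ [g])) (c : Fin q → P) :
    IsWeaklyRegular P (List.ofFn fun i => F i - c i * g) := by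
  have hmem : ∀ r ∈ List.ofFn F ++ [g], r ∈ maximalIdeal P := by
    intro r hr
    rcases List.mem_append.1 hr with hr | hr
    · obtain ⟨i, rfl⟩ := (List.mem_ofFn' _ _).1 hr
      exact hF i
    · rwa [List.mem_singleton.1 hr]
  have h1 := isWeaklyRegular_of_perm_of_subset_maximalIdeal h
    (List.perm_append_singleton g (List.ofFn F)) hmem
  have hmap : (List.ofFn F).map (Ideal.Quotient.mk (Ideal.span {g})) =
      (List.ofFn fun i => F i - c i * g).map (Ideal.Quotient.mk (Ideal.span {g})) := by
    rw [List.map_ofFn, List.map_ofFn]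
    congr 1
    funext i
    refine Ideal.Quotient.eq.2 ?_
    rw [sub_sub_cancel]
    exact Ideal.mul_mem_left _ _ (Ideal.mem_span_singleton_self g)
  rw [isWeaklyRegular_cons_iff', hmap, ← isWeaklyRegular_cons_iff'] at h1
  have hmem' : ∀ r ∈ g :: List.ofFn fun i => F i - c i * g, r ∈ maximalIdeal P := by
    intro r hr
    rcases List.mem_cons.1 hr with rfl | hr
    · exact hg
    · obtain ⟨i, rfl⟩ := (List.mem_ofFn' _ _).1 hr
      exact sub_mem (hF i) (Ideal.mul_mem_left _ _ hg)
  exact ((isWeaklyRegular_append_iff P _ [g]).1 (isWeaklyRegular_of_perm_of_subset_maximalIdeal h1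
    (List.perm_append_singleton g _).symm hmem')).1

variable {P : Type*} [CommRing P] [IsLocalRing P] [IsNoetherianRing P] [Infinite (ResidueField P)]

/-- The quotient of a regular local ring by a regular sequence in `𝔪²` is always a complete
intersection, so that only the multiplicity is at stake. -/
theorem isCIOfMinimalMultiplicity_iff_strictSeq {d : ℕ} (hd : ringKrullDim P = d)
    (hd' : (maximalIdeal P).spanFinrank = d) {G : List (P × ℕ)} (hO : HasOrders G)
    (hG : ∀ p ∈ G, p.2 = 2) (hreg : IsWeaklyRegular P (G.map Prod.fst)) :
    IsCIOfMinimalMultiplicity (P ⧸ seqIdeal G) ↔ StrictSeq ⊥ G := by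
  have hmem : ∀ r ∈ G.map Prod.fst, r ∈ maximalIdeal P := by
    intro r hr
    obtain ⟨p, hp, rfl⟩ := List.mem_map.1 hr
    exact Ideal.pow_le_self (hO p hp).2.ne' (hO p hp).1
  have hreg' := IsRegular.of_isWeaklyRegular_of_mem_maximalIdeal P hmem hreg
  have hnt : Nontrivial (P ⧸ seqIdeal G) := Ideal.Quotient.nontrivial_iff.2
    ((Ideal.span_le.2 hmem : seqIdeal G ≤ _).trans_lt
      (lt_top_iff_ne_top.2 (maximalIdeal.isMaximal P).ne_top)).ne
  have hloc : IsLocalRing (P ⧸ seqIdeal G) :=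
    IsLocalRing.of_surjective' (Ideal.Quotient.mk _) Ideal.Quotient.mk_surjective
  have hloc' : IsLocalRing (P ⧸ Ideal.ofList (G.map Prod.fst)) := hloc
  rw [← exists_hasMultiplicity_iff_strictSeq hd hd' hO hG hreg']
  exact ⟨fun ⟨_, _, _, h⟩ => h,
    fun h => ⟨hloc, inferInstance, isCompleteIntersection_quotient hd hd' hmem hreg, h⟩⟩

end Family

theorem theorem3 {P : Type*} [CommRing P] [IsRegularLocalRing P] [IsAlgClosed (ResidueField P)]
    {n q : ℕ} (hq : q ≤ n) (f : Fin (n + 1) → P) (hf : ∀ i, f i ∈ maximalIdeal P ^ 2)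
    (hreg : RingTheory.Sequence.IsRegular P
      (List.ofFn (fun i : Fin q => f (Fin.castLE hq i).castSucc) ++ [f (Fin.last n)]))
    (hquad : RingTheory.Sequence.IsRegular (AssocGraded P)
      (List.ofFn fun i : Fin q =>
        quadraticPart (f (Fin.castLE hq i).castSucc) (hf (Fin.castLE hq i).castSucc))) :
    (∀ a : Fin n → P, (fun i => residue P (a i)) ∈ minimalMultiplicityLocus hq f ↔
      IsCIOfMinimalMultiplicity (FamilyRing hq f a)) ∧
    IsZariskiOpen (minimalMultiplicityLocus hq f) ∧
    (minimalMultiplicityLocus hq f).Nonempty := by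
  have hinf : Infinite (ResidueField P) := IsAlgClosed.instInfinite
  have hd : ringKrullDim P = (maximalIdeal P).spanFinrank :=
    ((isRegularLocalRing_iff P).1 inferInstance).symm
  let F : Fin q → P := fun i => f (Fin.castLE hq i).castSucc
  let G : (Fin n → P) → List (P × ℕ) := quadraticFamily F (Fin.castLE hq) (f (Fin.last n))
  have hO : ∀ a, HasOrders (G a) := hasOrders_quadraticFamily (fun i => hf _) (hf _)
  have hmem : ∀ i, f i ∈ maximalIdeal P := fun i => Ideal.pow_le_self two_ne_zero (hf i)
  have hmap : ∀ a, (G a).map Prod.fst =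
      List.ofFn fun i => F i - a (Fin.castLE hq i) * f (Fin.last n) := fun a => by
    simp only [G, quadraticFamily, List.map_ofFn]
    rfl
  have hwreg : ∀ a, RingTheory.Sequence.IsWeaklyRegular P ((G a).map Prod.fst) := fun a => by
    rw [hmap]
    exact isWeaklyRegular_ofFn_sub_mul (fun i => hmem _) (hmem _) hreg.1 _
  have hqd : q ≤ (maximalIdeal P).spanFinrank := by
    have h1 := RingTheory.Sequence.IsRegular.of_isWeaklyRegular_of_mem_maximalIdeal P
      (fun r hr => by
        obtain ⟨p, hp, rfl⟩ := List.mem_map.1 hr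
        exact Ideal.pow_le_self (hO 0 p hp).2.ne' (hO 0 p hp).1) (hwreg 0)
    have h2 := ringKrullDim_add_length_eq_ringKrullDim_of_isRegular _ h1
    have h3 : Nontrivial (P ⧸ Ideal.ofList ((G 0).map Prod.fst)) := by
      refine Ideal.Quotient.nontrivial_iff.2 fun e => h1.2 ?_
      rw [e]
      simp
    rw [hd, List.length_map, length_quadraticFamily] at h2
    have h4 : (q : WithBot ℕ∞) ≤ ((maximalIdeal P).spanFinrank : WithBot ℕ∞) :=
      h2 ▸ le_add_of_nonneg_left ringKrullDim_nonneg_of_nontrivial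
    exact_mod_cast h4
  have hiff : ∀ a, IsCIOfMinimalMultiplicity (FamilyRing hq f a) ↔ StrictSeq ⊥ (G a) := by
    intro a
    rw [← isCIOfMinimalMultiplicity_iff_strictSeq hd rfl (hO a) (snd_of_mem_quadraticFamily a)
      (hwreg a)]
    have hJ : seqIdeal (G a) = Ideal.span (Set.range fun i : Fin q =>
        f (Fin.castLE hq i).castSucc - a (Fin.castLE hq i) * f (Fin.last n)) := by
      rw [seqIdeal, hmap, Ideal.ofList]
      congr 1
      ext x
      exact List.mem_ofFn' _ _
    rw [hJ]
  have hopen : ∀ a₀, StrictSeq ⊥ (G a₀) → ∃ p : MvPolynomial (Fin n) (ResidueField P),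
      p.eval (fun i => residue P (a₀ i)) ≠ 0 ∧
        ∀ a : Fin n → P, p.eval (fun i => residue P (a i)) ≠ 0 → StrictSeq ⊥ (G a) :=
    fun a₀ h₀ => exists_eval_ne_zero_strictSeq hd rfl hqd (fun i => hf _) (hf _) a₀ h₀
  refine ⟨fun a => ⟨?_, fun h => ⟨a, rfl, h⟩⟩, isZariskiOpen_of_forall_exists ?_, ?_⟩
  · rintro ⟨a₀, ha₀, h⟩
    obtain ⟨p, hp, hp'⟩ := hopen a₀ ((hiff a₀).1 h)
    exact (hiff a).2 (hp' a (ha₀ ▸ hp))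
  · rintro _ ⟨a₀, rfl, h⟩
    obtain ⟨p, hp, hp'⟩ := hopen a₀ ((hiff a₀).1 h)
    refine ⟨p, hp, fun x hx => ?_⟩
    choose a ha using fun i => residue_surjective (R := P) (x i)
    obtain rfl : (fun i => residue P (a i)) = x := funext ha
    exact ⟨a, rfl, (hiff a).2 (hp' a hx)⟩
  · refine ⟨fun i => residue P ((0 : Fin n → P) i), 0, rfl, (hiff 0).2 ?_⟩
    have h1 := strictSeq_of_isWeaklyRegular_quadraticPart F (fun i => hf _) hquad.1
    simpa [G, quadraticFamily] using h1
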